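/- Let $\Omega\subset\mathbb R^d$, $d\ge1$, be a bounded convex domain, let $0<\lambda,\Lambda$, and for an open set $U$ let $\mathcal M(\lambda,\Lambda;U)$ be the set of all $A\in[L^\infty(U)]^{d\times d}$ such that $A(x)\xi\cdot\xi\ge\lambda|\xi|^2$ and $A(x)\xi\cdot\xi\ge\Lambda^{-1}|A(x)\xi|^2$ for almost all $x\in U$ and all $\xi\in\mathbb R^d$. Problem. Let $S\subset(0,\infty)$ accumulate at $0$, and for $\varepsilon\in S$ let $\iota=\iota(\varepsilon)>0$ and $A^\varepsilon\in\mathcal M(\lambda,\Lambda;\Omega)$, with $\iota\to0$ as $\varepsilon\to0$. Let $\bar A\in[L^\infty(\Omega)]^{d\times d}$ be the effective matrix: for every $f\in L^2(\Omega)$ the problem $-\operatorname{div}(\bar A\nabla\bar u)=f$ in $\Omega$, $\bar u=0$ on $\partial\Omega$ has a weak solution $\bar u\in H_0^1(\Omega)$, and the weak solutions $u^\varepsilon\in H_0^2(\Omega)$ of $\iota^2\Delta^2u^\varepsilon-\operatorname{div}(A^\varepsilon\nabla u^\varepsilon)=f$ in $\Omega$, $u^\varepsilon=\partial_nu^\varepsilon=0$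 on $\partial\Omega$, satisfy, as $\varepsilon\to0$, $u^\varepsilon\rightharpoonup\bar u$ weakly in $H_0^1(\Omega)$, $\iota\Delta u^\varepsilon\rightharpoonup0$ weakly in $L^2(\Omega)$ and $A^\varepsilon\nabla u^\varepsilon\rightharpoonup\bar A\nabla\bar u$ weakly in $[L^2(\Omega)]^d$. Suppose that $\bar A$ is Lipschitz continuous on $\overline\Omega$. Fix $f\in L^2(\Omega)$ and let $\bar u$ be the corresponding weak solution, with $\bar u\in H^2(\Omega)$. Macroscopic solver. Let $\mathcal T_H$ be a conforming triangulation of $\Omega$ by simplices $K$ with diameters $h_K$, let $H=\max_Kh_K$, let $\rho_K$ be the diameter of the largest ball inscribed into $K$, and suppose $h_K/\rho_K\le\sigma$ and $H/h_K\le\tau$ for all $K$. Let $X_H$ be the space of all $Z_H\in H_0^1(\Omega)$ that are affine on each $K\in\mathcal T_H$. On each $K$ let a quadrature scheme with nodes $x_l\in K$ and weights $\omega_l\ge0$ ($1\le l\le L$) be given with $|K|\sum_l\omega_lp(x_l)=\int_Kp$ for all polynomials $p$ of degree at most one. Cell problems. Let $\varepsilon\in S$ and $\delta>0$. For each node $x_l$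 let $I_\delta=x_l+\delta(-\frac12,\frac12)^d$, where $A^\varepsilon$ is defined on $I_\delta$ and belongs to $\mathcal M(\lambda,\Lambda;I_\delta)$, and let $X_h\subset H^2(I_\delta)$ be a finite-dimensional subspace (for example a conforming finite element space). Let $V_h\subset X_h$ be one of the following spaces, of the same type for all nodes: $X_h\cap H_0^2(I_\delta)$; $X_h\cap H_0^1(I_\delta)$; the set of $z_h\in X_h$ such that $z_h$ and $\nabla z_h$ have mean zero over $I_\delta$; or the set of $z_h\in X_h\cap H^2_{\mathrm{per}}(I_\delta)$ with mean zero over $I_\delta$. For an affine function $V_l$ let $v_h$ be the solution of: $v_h-V_l\in V_h$ and $$\int_{I_\delta}A^\varepsilon\nabla v_h\cdot\nabla z_h+\iota^2\int_{I_\delta}\nabla^2v_h:\nabla^2z_h=0\quad\text{for all }z_h\in V_h.$$ The matrix $A_H(x_l)$ is given by $A_H(x_l)\,\frac1{|I_\delta|}\int_{I_\delta}\nabla v_h=\frac1{|I_\delta|}\int_{I_\delta}A^\varepsilon\nabla v_h$ for all such $V_l$. HMM-FEM solution. Let $u_H\in X_H$ satisfy $$\sum_{K\in\mathcal T_H}|K|\sum_{l=1}^L\omega_l\,\nabla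 Z_H|_K\cdot A_H(x_l)\nabla u_H|_K=\int_\Omega fZ_H\quad\text{for all }Z_H\in X_H.$$ Conclusion. There is a constant $C$ such that $$\|\nabla(\bar u-u_H)\|_{L^2(\Omega)}\le C\bigl(H\|\bar u\|_{H^2(\Omega)}+e(\mathrm{HMM})\|f\|_{H^{-1}(\Omega)}\bigr),\qquad e(\mathrm{HMM})=\max_{K\in\mathcal T_H,\,x_l\in K}|(\bar A-A_H)(x_l)|,$$ where $|\cdot|$ is the $\ell^2$ (spectral) norm of matrices. The constant $C$ depends only on $\Omega$, $\lambda$, $\Lambda$, $\sigma$, $\tau$ and a bound for the maximum norm and the Lipschitz constant of $\bar A$ on $\overline\Omega$ (hence also on $d$); in particular it is independent of $\varepsilon$, $\iota$, $\delta$, $H$, the spaces $X_h$, the type of boundary condition, the quadrature scheme, $\bar u$ and $f$. -/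

import Mathlib

open MeasureTheory Set Filter Topology
open scoped ContDiff

noncomputable section

namespace HMM

/-- Points and vectors of `ℝ^d`, with the Euclidean norm. -/
abbrev Vec (d : ℕ) := EuclideanSpace ℝ (Fin d)

/-- Real `d × d` matrices, as linear maps of `ℝ^d`. The norm of this type is the operator norm of
the Euclidean norm, that is, the `ℓ²`-norm of matrices. -/
abbrev Mat (d : ℕ) := Vec d →L[ℝ] Vec d

/-! ### Sobolev spaces on an open set `U`

Elements are functions together with their weak derivatives: `G` is the weak gradient, and `D i` is
the weak gradient of the `i`-th component of `G`, that is, the `i`-th row of the Hessian. These are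
determined by the function up to null sets. -/

/-- Test functions: `φ ∈ C_0^∞(U)`. -/
def IsTest {d : ℕ} (U : Set (Vec d)) (φ : Vec d → ℝ) : Prop :=
  ContDiff ℝ ∞ φ ∧ HasCompactSupport φ ∧ tsupport φ ⊆ U

/-- `G` is the gradient of `u` on `U` in the sense of distributions. -/
def HasWeakGradient {d : ℕ} (U : Set (Vec d)) (u : Vec d → ℝ) (G : Vec d → Vec d) : Prop :=
  ∀ φ : Vec d → ℝ, IsTest U φ → ∀ i : Fin d,
    ∫ x in U, u x * gradient φ x i = - ∫ x in U, G x i * φ x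

/-- `u ∈ H¹(U)` with weak gradient `G`. -/
def MemH1 {d : ℕ} (U : Set (Vec d)) (u : Vec d → ℝ) (G : Vec d → Vec d) : Prop :=
  MemLp u 2 (volume.restrict U) ∧ MemLp G 2 (volume.restrict U) ∧ HasWeakGradient U u G

/-- `u ∈ H²(U)` with weak gradient `G` and weak Hessian `D`. -/
def MemH2 {d : ℕ} (U : Set (Vec d)) (u : Vec d → ℝ) (G : Vec d → Vec d)
    (D : Fin d → Vec d → Vec d) : Prop :=
  MemH1 U u G ∧ ∀ i, MemH1 U (fun x => G x i) (D i)

/-- The norm of `L²(U; ℝ^d)`. -/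
def normL2 {d : ℕ} (U : Set (Vec d)) (G : Vec d → Vec d) : ℝ :=
  √(∫ x in U, ‖G x‖ ^ 2)

/-- The norm of `H¹(U)`. -/
def normH1 {d : ℕ} (U : Set (Vec d)) (u : Vec d → ℝ) (G : Vec d → Vec d) : ℝ :=
  √((∫ x in U, (u x) ^ 2) + ∫ x in U, ‖G x‖ ^ 2)

/-- The norm of `H²(U)`. -/
def normH2 {d : ℕ} (U : Set (Vec d)) (u : Vec d → ℝ) (G : Vec d → Vec d)
    (D : Fin d → Vec d → Vec d) : ℝ :=
  √((∫ x in U, (u x) ^ 2) + (∫ x in U, ‖G x‖ ^ 2) + ∑ i, ∫ x in U, ‖D i x‖ ^ 2)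

/-- The functions `φ n` are smooth and converge to `u` in `H¹(U)`. -/
def ConvergesH1 {d : ℕ} (U : Set (Vec d)) (φ : ℕ → Vec d → ℝ) (u : Vec d → ℝ)
    (G : Vec d → Vec d) : Prop :=
  Tendsto (fun n => normH1 U (fun x => φ n x - u x) (fun x => gradient (φ n) x - G x))
    atTop (𝓝 0)

/-- The functions `φ n` are smooth and converge to `u` in `H²(U)`. -/
def ConvergesH2 {d : ℕ} (U : Set (Vec d)) (φ : ℕ → Vec d → ℝ) (u : Vec d → ℝ)
    (G : Vec d → Vec d) (D : Fin d → Vec d → Vec d) : Prop :=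
  Tendsto (fun n => normH2 U (fun x => φ n x - u x) (fun x => gradient (φ n) x - G x)
    (fun i x => gradient (fun y => gradient (φ n) y i) x - D i x)) atTop (𝓝 0)

/-- `u ∈ H_0^1(U)`, the closure of `C_0^∞(U)` in `H¹(U)`. -/
def MemH01 {d : ℕ} (U : Set (Vec d)) (u : Vec d → ℝ) (G : Vec d → Vec d) : Prop :=
  MemH1 U u G ∧ ∃ φ : ℕ → Vec d → ℝ, (∀ n, IsTest U (φ n)) ∧ ConvergesH1 U φ u G

/-- `u ∈ H_0^2(U)`, the closure of `C_0^∞(U)` in `H²(U)`. -/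
def MemH02 {d : ℕ} (U : Set (Vec d)) (u : Vec d → ℝ) (G : Vec d → Vec d)
    (D : Fin d → Vec d → Vec d) : Prop :=
  MemH2 U u G D ∧ ∃ φ : ℕ → Vec d → ℝ, (∀ n, IsTest U (φ n)) ∧ ConvergesH2 U φ u G D

/-- The norm in `H^{-1}(U)`, the dual of `H_0^1(U)`, of the functional `v ↦ (f, v)_U`. -/
def normHneg1 {d : ℕ} (U : Set (Vec d)) (f : Vec d → ℝ) : ℝ :=
  sSup {r | ∃ v G, MemH01 U v G ∧ normH1 U v G ≤ 1 ∧ r = ∫ x in U, f x * v x}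

/-! ### Coefficients, the singularly perturbed problem and its homogenization -/

/-- The set `M(λ, Λ; U)` of coefficient matrices. -/
def CoeffClass {d : ℕ} (lam Lam : ℝ) (U : Set (Vec d)) : Set (Vec d → Mat d) :=
  {A | MemLp A ⊤ (volume.restrict U) ∧ ∀ᵐ x ∂(volume.restrict U), ∀ ξ : Vec d,
    lam * ‖ξ‖ ^ 2 ≤ inner ℝ (A x ξ) ξ ∧ 1 / Lam * ‖A x ξ‖ ^ 2 ≤ inner ℝ (A x ξ) ξ}

/-- The Laplacian, as the trace of the Hessian. -/
def lapl {d : ℕ} (D : Fin d → Vec d → Vec d) (x : Vec d) : ℝ := ∑ i, D i x i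

/-- `u ∈ H_0^2(Ω)` is the weak solution of `ι² Δ² u - div (A ∇u) = f` in `Ω` with
`u = ∂_n u = 0` on the boundary. -/
def IsSingularSolution {d : ℕ} (Ω : Set (Vec d)) (ι : ℝ) (A : Vec d → Mat d) (f : Vec d → ℝ)
    (u : Vec d → ℝ) (G : Vec d → Vec d) (D : Fin d → Vec d → Vec d) : Prop :=
  MemH02 Ω u G D ∧ ∀ z Gz Dz, MemH02 Ω z Gz Dz →
    ι ^ 2 * (∫ x in Ω, lapl D x * lapl Dz x) + (∫ x in Ω, inner ℝ (A x (G x)) (Gz x))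
      = ∫ x in Ω, f x * z x

/-- `u ∈ H_0^1(Ω)` is the weak solution of `- div (A ∇u) = f` in `Ω` with `u = 0` on the
boundary. -/
def IsEllipticSolution {d : ℕ} (Ω : Set (Vec d)) (A : Vec d → Mat d) (f : Vec d → ℝ)
    (u : Vec d → ℝ) (G : Vec d → Vec d) : Prop :=
  MemH01 Ω u G ∧ ∀ z Gz, MemH01 Ω z Gz →
    (∫ x in Ω, inner ℝ (A x (G x)) (Gz x)) = ∫ x in Ω, f x * z x

/-- `Abar` is the effective matrix (the `H`-limit) of the family `(ι ε, A ε)`, `ε ∈ S`, as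
`ε → 0` in `S`: for every right-hand side the homogenized problem is solvable, and, for its weak
solution `u` and the solutions `v ε` of the singularly perturbed problems, `v ε ⇀ u` weakly in
`H_0^1(Ω)`, `ι ε Δ(v ε) ⇀ 0` weakly in `L²(Ω)` and `A ε ∇(v ε) ⇀ Abar ∇u` weakly in
`L²(Ω; ℝ^d)`. -/
def IsEffectiveMatrix {d : ℕ} (Ω : Set (Vec d)) (S : Set ℝ) (ι : ℝ → ℝ)
    (A : ℝ → Vec d → Mat d) (Abar : Vec d → Mat d) : Prop :=
  MemLp Abar ⊤ (volume.restrict Ω) ∧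
  ∀ f : Vec d → ℝ, MemLp f 2 (volume.restrict Ω) →
    (∃ u G, IsEllipticSolution Ω Abar f u G) ∧
    ∀ u G, IsEllipticSolution Ω Abar f u G →
      ∃ (v : ℝ → Vec d → ℝ) (Gv : ℝ → Vec d → Vec d) (Dv : ℝ → Fin d → Vec d → Vec d),
        (∀ ε ∈ S, IsSingularSolution Ω (ι ε) (A ε) f (v ε) (Gv ε) (Dv ε)) ∧
        (∀ g : Vec d → ℝ, MemLp g 2 (volume.restrict Ω) →
          Tendsto (fun ε => ∫ x in Ω, v ε x * g x) (𝓝[S] 0) (𝓝 (∫ x in Ω, u x * g x)) ∧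
          Tendsto (fun ε => ∫ x in Ω, ι ε * lapl (Dv ε) x * g x) (𝓝[S] 0) (𝓝 0)) ∧
        (∀ F : Vec d → Vec d, MemLp F 2 (volume.restrict Ω) →
          Tendsto (fun ε => ∫ x in Ω, inner ℝ (Gv ε x) (F x)) (𝓝[S] 0)
            (𝓝 (∫ x in Ω, inner ℝ (G x) (F x))) ∧
          Tendsto (fun ε => ∫ x in Ω, inner ℝ (A ε x (Gv ε x)) (F x)) (𝓝[S] 0)
            (𝓝 (∫ x in Ω, inner ℝ (Abar x (G x)) (F x))))

/-! ### The macroscopic mesh, its finite element space and quadrature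

A simplex is given by the set `K` of its `d + 1` vertices. -/

/-- The closed simplex with vertex set `K`. -/
def simplex {d : ℕ} (K : Finset (Vec d)) : Set (Vec d) := convexHull ℝ (K : Set (Vec d))

/-- `T` is a (conforming) triangulation of `Ω` into nondegenerate simplices: they cover the closure
of `Ω`, and any two meet in their common face, which may be empty. -/
structure IsTriangulation {d : ℕ} (Ω : Set (Vec d)) (T : Finset (Finset (Vec d))) : Prop where
  card_eq : ∀ K ∈ T, K.card = d + 1
  affineIndependent : ∀ K ∈ T, AffineIndependent ℝ (fun p : K => (p : Vec d))
  cover : ⋃ K ∈ T, simplex K = closure Ω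
  inter : ∀ K ∈ T, ∀ K' ∈ T,
    simplex K ∩ simplex K' = convexHull ℝ ((K : Set (Vec d)) ∩ (K' : Set (Vec d)))

/-- The diameter `h_K`. -/
def diamK {d : ℕ} (K : Finset (Vec d)) : ℝ := Metric.diam (simplex K)

/-- The diameter `ρ_K` of the largest ball inscribed into the simplex. -/
def rhoK {d : ℕ} (K : Finset (Vec d)) : ℝ :=
  2 * sSup {r : ℝ | 0 ≤ r ∧ ∃ c, Metric.ball c r ⊆ simplex K}

/-- The mesh size `H = max_K h_K`. -/
def meshSize {d : ℕ} (T : Finset (Finset (Vec d))) : ℝ := sSup (diamK '' (T : Set (Finset (Vec d))))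

/-- Shape regularity: `h_K / ρ_K ≤ σ`. -/
def ShapeRegular {d : ℕ} (σ : ℝ) (T : Finset (Finset (Vec d))) : Prop :=
  ∀ K ∈ T, diamK K ≤ σ * rhoK K

/-- The inverse assumption: `H / h_K ≤ τ`. -/
def InverseAssumption {d : ℕ} (τ : ℝ) (T : Finset (Finset (Vec d))) : Prop :=
  ∀ K ∈ T, meshSize T ≤ τ * diamK K

/-- `Z`, with weak gradient `G`, belongs to the linear Lagrange finite element space `X_H`: it is in
`H_0^1(Ω)`, and on each simplex `K` it is an affine function, whose gradient is `g K`. -/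
def MemXH {d : ℕ} (Ω : Set (Vec d)) (T : Finset (Finset (Vec d))) (Z : Vec d → ℝ)
    (G : Vec d → Vec d) (g : Finset (Vec d) → Vec d) : Prop :=
  MemH01 Ω Z G ∧ ∀ K ∈ T, ∃ c : ℝ, ∀ᵐ x ∂(volume.restrict (simplex K)), Z x = c + inner ℝ (g K) x

/-- Quadrature weights `wt K l ≥ 0` and nodes `x K l ∈ K`, exact for linear polynomials on each
simplex of `T`. -/
structure IsQuadrature {d : ℕ} (T : Finset (Finset (Vec d))) {L : ℕ}
    (wt : Finset (Vec d) → Fin L → ℝ) (x : Finset (Vec d) → Fin L → Vec d) : Prop where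
  weight_nonneg : ∀ K ∈ T, ∀ l, 0 ≤ wt K l
  node_mem : ∀ K ∈ T, ∀ l, x K l ∈ simplex K
  exact_linear : ∀ K ∈ T, ∀ (c : ℝ) (ξ : Vec d),
    volume.real (simplex K) * ∑ l, wt K l * (c + inner ℝ ξ (x K l))
      = ∫ y in simplex K, (c + inner ℝ ξ y)

/-- The bilinear form `a_H(V, Z)`, in terms of the elementwise gradients `gV`, `gZ`; `AH K l` is the
value of `A_H` at the node `x_l` of `K`. -/
def aH {d : ℕ} (T : Finset (Finset (Vec d))) {L : ℕ} (wt : Finset (Vec d) → Fin L → ℝ)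
    (AH : Finset (Vec d) → Fin L → Mat d) (gV gZ : Finset (Vec d) → Vec d) : ℝ :=
  ∑ K ∈ T, volume.real (simplex K) * ∑ l, wt K l * inner ℝ (gZ K) (AH K l (gV K))

/-- `e(HMM)`: the maximum of `|(Abar - A_H)(x_l)|` over all simplices and quadrature nodes. -/
def eHMM {d : ℕ} (T : Finset (Finset (Vec d))) {L : ℕ} (x : Finset (Vec d) → Fin L → Vec d)
    (Abar : Vec d → Mat d) (AH : Finset (Vec d) → Fin L → Mat d) : ℝ :=
  sSup {r | ∃ K ∈ T, ∃ l, r = ‖Abar (x K l) - AH K l‖}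

/-! ### The cell problems -/

/-- The (open) cell `I_δ = x + δ Y`, with `Y` the unit cube centred at the origin. -/
def cell {d : ℕ} (x : Vec d) (δ : ℝ) : Set (Vec d) := {y | ∀ i, |y i - x i| < δ / 2}

/-- `z ∈ H_per^2(I_δ)`, the closure in `H²(I_δ)` of the smooth `δ`-periodic functions. -/
def MemH2per {d : ℕ} (x : Vec d) (δ : ℝ) (z : Vec d → ℝ) (G : Vec d → Vec d)
    (D : Fin d → Vec d → Vec d) : Prop :=
  MemH2 (cell x δ) z G D ∧ ∃ φ : ℕ → Vec d → ℝ,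
    (∀ n, ContDiff ℝ ∞ (φ n) ∧ ∀ y i, φ n (y + EuclideanSpace.single i δ) = φ n y) ∧
    ConvergesH2 (cell x δ) φ z G D

/-- The four types of boundary conditions for the cell problems. -/
inductive CellBC where
  | essential
  | natural
  | free
  | periodic

/-- `z ∈ V_h`, where `V_h` is the subspace of `X_h` given by the boundary condition. -/
def MemVh {d : ℕ} (x : Vec d) (δ : ℝ) (Xh : Submodule ℝ (Vec d → ℝ)) (bc : CellBC)
    (z : Vec d → ℝ) (G : Vec d → Vec d) (D : Fin d → Vec d → Vec d) : Prop :=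
  z ∈ Xh ∧ MemH2 (cell x δ) z G D ∧
    match bc with
    | .essential => MemH02 (cell x δ) z G D
    | .natural => MemH01 (cell x δ) z G
    | .free => (∫ y in cell x δ, z y) = 0 ∧ (⨍ y in cell x δ, G y) = 0
    | .periodic => (∫ y in cell x δ, z y) = 0 ∧ MemH2per x δ z G D

/-- The bilinear form `a^ε(v, z) = (A ∇v, ∇z) + ι² (∇²v, ∇²z)` on the cell. -/
def aCell {d : ℕ} (U : Set (Vec d)) (ι : ℝ) (A : Vec d → Mat d)
    (Gv : Vec d → Vec d) (Dv : Fin d → Vec d → Vec d)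
    (Gz : Vec d → Vec d) (Dz : Fin d → Vec d → Vec d) : ℝ :=
  (∫ y in U, inner ℝ (A y (Gv y)) (Gz y))
    + ι ^ 2 * ∫ y in U, ∑ i, inner ℝ (Dv i y) (Dz i y)

/-- `v` solves the discrete cell problem on the cell around `x` for the affine function
`V_l y = c + ξ · (y - x)`: `v - V_l ∈ V_h` and `a^ε(v, z) = 0` for all `z ∈ V_h`. -/
def IsCellSolution {d : ℕ} (x : Vec d) (δ ι : ℝ) (A : Vec d → Mat d)
    (Xh : Submodule ℝ (Vec d → ℝ)) (bc : CellBC) (c : ℝ) (ξ : Vec d)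
    (v : Vec d → ℝ) (Gv : Vec d → Vec d) (Dv : Fin d → Vec d → Vec d) : Prop :=
  MemVh x δ Xh bc (fun y => v y - (c + inner ℝ ξ (y - x))) (fun y => Gv y - ξ) Dv ∧
  ∀ z Gz Dz, MemVh x δ Xh bc z Gz Dz → aCell (cell x δ) ι A Gv Dv Gz Dz = 0

/-- `B` is the matrix `A_H(x)`: it maps the mean of `∇v` over the cell to the mean of `A ∇v`, for
the solution `v` of the cell problem with any affine function. -/
def IsCellMatrix {d : ℕ} (x : Vec d) (δ ι : ℝ) (A : Vec d → Mat d)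
    (Xh : Submodule ℝ (Vec d → ℝ)) (bc : CellBC) (B : Mat d) : Prop :=
  ∀ c ξ v Gv Dv, IsCellSolution x δ ι A Xh bc c ξ v Gv Dv →
    B (⨍ y in cell x δ, Gv y) = ⨍ y in cell x δ, A y (Gv y)

/-- `Xh` is a finite-dimensional space of `H²` functions on the cell. -/
def IsCellSpace {d : ℕ} (x : Vec d) (δ : ℝ) (Xh : Submodule ℝ (Vec d → ℝ)) : Prop :=
  FiniteDimensional ℝ Xh ∧ ∀ z ∈ Xh, ∃ G D, MemH2 (cell x δ) z G D

/-- `u`, with weak gradient `G` and elementwise gradients `g`, is the HMM-FEM solution `u_H ∈ X_H`: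
`a_H(u_H, Z_H) = (f, Z_H)` for all `Z_H ∈ X_H`. -/
def IsMacroSolution {d : ℕ} (Ω : Set (Vec d)) (T : Finset (Finset (Vec d))) {L : ℕ}
    (wt : Finset (Vec d) → Fin L → ℝ) (AH : Finset (Vec d) → Fin L → Mat d) (f : Vec d → ℝ)
    (u : Vec d → ℝ) (G : Vec d → Vec d) (g : Finset (Vec d) → Vec d) : Prop :=
  MemXH Ω T u G g ∧ ∀ Z GZ gZ, MemXH Ω T Z GZ gZ → aH T wt AH g gZ = ∫ x in Ω, f x * Z x

end HMM

end

noncomputable section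

namespace HMM

variable {d : ℕ}

/-! ### Square integrable functions -/

section L2

variable {α E F : Type*} [MeasurableSpace α] {μ : Measure α} [NormedAddCommGroup E]
  [NormedAddCommGroup F]

lemma integrable_norm_sq {f : α → E} (hf : MemLp f 2 μ) : Integrable (fun x => ‖f x‖ ^ 2) μ :=
  (memLp_two_iff_integrable_sq_norm hf.1).1 hf

lemma lintegral_enorm_sq {f : α → E} (hf : MemLp f 2 μ) :
    ∫⁻ x, ‖f x‖ₑ ^ 2 ∂μ = ENNReal.ofReal (∫ x, ‖f x‖ ^ 2 ∂μ) := by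
  rw [ofReal_integral_eq_lintegral_ofReal (integrable_norm_sq hf)
    (ae_of_all _ fun x => by positivity)]
  refine lintegral_congr fun x => ?_
  rw [ENNReal.ofReal_pow (norm_nonneg _), ofReal_norm]

lemma integral_norm_sq_nonneg (f : α → E) : 0 ≤ ∫ x, ‖f x‖ ^ 2 ∂μ :=
  integral_nonneg fun x => by positivity

lemma toReal_eLpNorm_two {f : α → E} (hf : MemLp f 2 μ) :
    (eLpNorm f 2 μ).toReal = √(∫ x, ‖f x‖ ^ 2 ∂μ) := by
  rw [eLpNorm_eq_lintegral_rpow_enorm_toReal (by norm_num) (by norm_num)]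
  simp only [ENNReal.toReal_ofNat, ENNReal.rpow_ofNat]
  rw [lintegral_enorm_sq hf, ← ENNReal.toReal_rpow, ENNReal.toReal_ofReal
    (integral_norm_sq_nonneg f), Real.sqrt_eq_rpow]

lemma sqrt_integral_norm_add_sq_le {f g : α → E} (hf : MemLp f 2 μ) (hg : MemLp g 2 μ) :
    √(∫ x, ‖f x + g x‖ ^ 2 ∂μ) ≤ √(∫ x, ‖f x‖ ^ 2 ∂μ) + √(∫ x, ‖g x‖ ^ 2 ∂μ) := by
  have h := eLpNorm_add_le hf.1 hg.1 (p := 2) (by norm_num)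
  rw [← toReal_eLpNorm_two hf, ← toReal_eLpNorm_two hg]
  have e := toReal_eLpNorm_two (hf.add hg)
  simp only [Pi.add_apply] at e
  rw [← e]
  rw [← ENNReal.toReal_add hf.2.ne hg.2.ne]
  exact ENNReal.toReal_mono (ENNReal.add_ne_top.2 ⟨hf.2.ne, hg.2.ne⟩) h

lemma integral_norm_add_sq_le {f g : α → E} (hf : MemLp f 2 μ) (hg : MemLp g 2 μ) :
    ∫ x, ‖f x + g x‖ ^ 2 ∂μ ≤ 2 * ∫ x, ‖f x‖ ^ 2 ∂μ + 2 * ∫ x, ‖g x‖ ^ 2 ∂μ := by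
  rw [← integral_const_mul, ← integral_const_mul, ← integral_add
    ((integrable_norm_sq hf).const_mul _) ((integrable_norm_sq hg).const_mul _)]
  refine integral_mono (integrable_norm_sq (hf.add hg))
    (((integrable_norm_sq hf).const_mul _).add ((integrable_norm_sq hg).const_mul _)) fun x => ?_
  have h1 := norm_add_le (f x) (g x)
  have h2 := norm_nonneg (f x + g x)
  nlinarith [sq_nonneg (‖f x‖ - ‖g x‖)]

lemma integral_norm_sub_sq_le {f g : α → E} (hf : MemLp f 2 μ) (hg : MemLp g 2 μ) :
    ∫ x, ‖f x - g x‖ ^ 2 ∂μ ≤ 2 * ∫ x, ‖f x‖ ^ 2 ∂μ + 2 * ∫ x, ‖g x‖ ^ 2 ∂μ := by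
  simpa [sub_eq_add_neg] using integral_norm_add_sq_le hf hg.neg

lemma integrable_mul_of_memLp {f g : α → ℝ} (hf : MemLp f 2 μ) (hg : MemLp g 2 μ) :
    Integrable (fun x => f x * g x) μ := hf.integrable_mul hg

lemma integrable_norm_mul_norm {f : α → E} {g : α → F} (hf : MemLp f 2 μ) (hg : MemLp g 2 μ) :
    Integrable (fun x => ‖f x‖ * ‖g x‖) μ := hf.norm.integrable_mul hg.norm

lemma integral_norm_mul_norm_le {f : α → E} {g : α → F} (hf : MemLp f 2 μ) (hg : MemLp g 2 μ) :
    ∫ x, ‖f x‖ * ‖g x‖ ∂μ ≤ √(∫ x, ‖f x‖ ^ 2 ∂μ) * √(∫ x, ‖g x‖ ^ 2 ∂μ) := by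
  have h := integral_mul_le_Lp_mul_Lq_of_nonneg (μ := μ) (p := 2) (q := 2)
    ⟨by norm_num, by norm_num, by norm_num⟩
    (ae_of_all _ fun x => norm_nonneg (f x)) (ae_of_all _ fun x => norm_nonneg (g x))
    (by simpa using hf.norm) (by simpa using hg.norm)
  simpa [Real.sqrt_eq_rpow] using h

variable [InnerProductSpace ℝ E]

lemma integrable_inner_of_memLp {f g : α → E} (hf : MemLp f 2 μ) (hg : MemLp g 2 μ) :
    Integrable (fun x => inner ℝ (f x) (g x)) μ :=
  (integrable_norm_mul_norm hf hg).mono' (hf.1.inner hg.1)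
    (ae_of_all _ fun _ => norm_inner_le_norm _ _)

lemma abs_integral_inner_le {f g : α → E} (hf : MemLp f 2 μ) (hg : MemLp g 2 μ) :
    |∫ x, inner ℝ (f x) (g x) ∂μ| ≤ √(∫ x, ‖f x‖ ^ 2 ∂μ) * √(∫ x, ‖g x‖ ^ 2 ∂μ) := by
  refine le_trans ?_ (integral_norm_mul_norm_le hf hg)
  exact (norm_integral_le_integral_norm _).trans (integral_mono
    (integrable_inner_of_memLp hf hg).norm (integrable_norm_mul_norm hf hg)
    fun x => norm_inner_le_norm _ _)

lemma abs_integral_mul_le {f g : α → ℝ} (hf : MemLp f 2 μ) (hg : MemLp g 2 μ) :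
    |∫ x, f x * g x ∂μ| ≤ √(∫ x, f x ^ 2 ∂μ) * √(∫ x, g x ^ 2 ∂μ) := by
  have h := abs_integral_inner_le hf hg
  simpa [mul_comm] using h

end L2

lemma memLp_const_restrict {E : Type*} [NormedAddCommGroup E] {U : Set (Vec d)}
    (hU : Bornology.IsBounded U) (c : E) : MemLp (fun _ : Vec d => c) 2 (volume.restrict U) := by
  have : IsFiniteMeasure (volume.restrict U) := ⟨by
    simpa using hU.measure_lt_top⟩
  exact memLp_const c

lemma memLp_of_continuous {E : Type*} [NormedAddCommGroup E] {U : Set (Vec d)}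
    (hU : Bornology.IsBounded U) {f : Vec d → E} (hf : Continuous f) :
    MemLp f 2 (volume.restrict U) := by
  have : IsFiniteMeasure (volume.restrict U) := ⟨by
    simpa using hU.measure_lt_top⟩
  obtain ⟨C, hC⟩ := (hU.isCompact_closure.image hf).isBounded.exists_norm_le
  refine MemLp.of_bound hf.aestronglyMeasurable C ?_
  have hcl : ∀ᵐ x ∂(volume.restrict U), x ∈ closure U :=
    ae_mono (Measure.restrict_mono subset_closure le_rfl)
      (ae_restrict_mem isClosed_closure.measurableSet)
  filter_upwards [hcl] with x hx
  exact hC _ ⟨x, hx, rfl⟩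

lemma memLp_coord {G : Vec d → Vec d} {μ : Measure (Vec d)}
    (hG : MemLp G 2 μ) (i : Fin d) : MemLp (fun x => G x i) 2 μ :=
  (EuclideanSpace.proj (𝕜 := ℝ) (ι := Fin d) i).comp_memLp' hG

/-! ### Gradients and test functions -/

lemma gradient_apply_coord (φ : Vec d → ℝ) (x : Vec d) (i : Fin d) :
    gradient φ x i = fderiv ℝ φ x (EuclideanSpace.single i 1) := by
  rw [← inner_gradient_left, EuclideanSpace.inner_single_right]
  simp

lemma continuous_gradient {φ : Vec d → ℝ} (hφ : ContDiff ℝ 1 φ) : Continuous (gradient φ) :=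
  (InnerProductSpace.toDual ℝ (Vec d)).symm.continuous.comp (hφ.continuous_fderiv (by norm_num))

lemma norm_gradient (φ : Vec d → ℝ) (x : Vec d) : ‖gradient φ x‖ = ‖fderiv ℝ φ x‖ :=
  LinearIsometryEquiv.norm_map _ _

lemma IsTest.contDiff_one {U : Set (Vec d)} {φ : Vec d → ℝ} (h : IsTest U φ) :
    ContDiff ℝ 1 φ := h.1.of_le (by exact_mod_cast le_top)

lemma IsTest.mono {U V : Set (Vec d)} {φ : Vec d → ℝ} (h : IsTest U φ) (hUV : U ⊆ V) :
    IsTest V φ := ⟨h.1, h.2.1, h.2.2.trans hUV⟩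

lemma gradient_eq_zero_of_notMem {φ : Vec d → ℝ} {x : Vec d} (hx : x ∉ tsupport φ) :
    gradient φ x = 0 := by
  rw [← norm_eq_zero, norm_gradient]
  have : fderiv ℝ φ x = 0 := by
    by_contra h
    exact hx (support_fderiv_subset ℝ h)
  simp [this]

lemma IsTest.hasCompactSupport_gradient {U : Set (Vec d)} {φ : Vec d → ℝ} (h : IsTest U φ) :
    HasCompactSupport (gradient φ) :=
  HasCompactSupport.of_support_subset_isCompact h.2.1 fun _ hx =>
    by_contra fun hn => hx (gradient_eq_zero_of_notMem hn)

lemma IsTest.memLp {U : Set (Vec d)} {φ : Vec d → ℝ} (h : IsTest U φ) (p : ENNReal)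
    (μ : Measure (Vec d)) [IsFiniteMeasureOnCompacts μ] : MemLp φ p μ :=
  h.1.continuous.memLp_of_hasCompactSupport h.2.1

lemma IsTest.memLp_gradient {U : Set (Vec d)} {φ : Vec d → ℝ} (h : IsTest U φ) (p : ENNReal)
    (μ : Measure (Vec d)) [IsFiniteMeasureOnCompacts μ] : MemLp (gradient φ) p μ :=
  (continuous_gradient h.contDiff_one).memLp_of_hasCompactSupport h.hasCompactSupport_gradient

lemma IsTest.memLp_gradient_coord {U : Set (Vec d)} {φ : Vec d → ℝ} (h : IsTest U φ)
    (μ : Measure (Vec d)) [IsFiniteMeasureOnCompacts μ] (i : Fin d) :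
    MemLp (fun x => gradient φ x i) 2 μ :=
  memLp_coord (h.memLp_gradient 2 μ) i

lemma IsTest.setIntegral_mul_gradient {U : Set (Vec d)} {φ : Vec d → ℝ} (h : IsTest U φ)
    (u : Vec d → ℝ) (i : Fin d) :
    ∫ x in U, u x * gradient φ x i = ∫ x, u x * gradient φ x i := by
  refine setIntegral_eq_integral_of_forall_compl_eq_zero fun x hx => ?_
  rw [gradient_eq_zero_of_notMem fun hn => hx (h.2.2 hn)]
  simp

lemma IsTest.setIntegral_mul {U : Set (Vec d)} {φ : Vec d → ℝ} (h : IsTest U φ)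
    (u : Vec d → ℝ) : ∫ x in U, u x * φ x = ∫ x, u x * φ x := by
  refine setIntegral_eq_integral_of_forall_compl_eq_zero fun x hx => ?_
  rw [image_eq_zero_of_notMem_tsupport fun hn => hx (h.2.2 hn), mul_zero]

/-- Integration by parts against a test function. -/
lemma hasWeakGradient_of_contDiff (U : Set (Vec d)) {u : Vec d → ℝ} (hu : ContDiff ℝ 1 u) :
    HasWeakGradient U u (gradient u) := by
  intro φ hφ i
  rw [hφ.setIntegral_mul_gradient, hφ.setIntegral_mul]
  simp only [gradient_apply_coord]
  have hcu := hu.continuous_fderiv (n := 1) (by norm_num)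
  have hcφ := hφ.contDiff_one.continuous_fderiv (n := 1) (by norm_num)
  refine integral_mul_fderiv_eq_neg_fderiv_mul_of_integrable ?_ ?_ ?_ ?_ ?_
  · exact ((hcu.clm_apply continuous_const).mul hφ.1.continuous).integrable_of_hasCompactSupport
      hφ.2.1.mul_left
  · exact (hu.continuous.mul (hcφ.clm_apply continuous_const)).integrable_of_hasCompactSupport
      (HasCompactSupport.mul_left (hφ.2.1.fderiv_apply ℝ _))
  · exact (hu.continuous.mul hφ.1.continuous).integrable_of_hasCompactSupport hφ.2.1.mul_left
  · exact fun x _ => hu.differentiable (by norm_num) x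
  · exact fun x _ => hφ.contDiff_one.differentiable (by norm_num) x

lemma HasWeakGradient.mono {U V : Set (Vec d)} {u : Vec d → ℝ} {G : Vec d → Vec d}
    (h : HasWeakGradient U u G) (hVU : V ⊆ U) : HasWeakGradient V u G := by
  intro φ hφ i
  rw [hφ.setIntegral_mul_gradient, hφ.setIntegral_mul]
  have := h φ (hφ.mono hVU) i
  rwa [(hφ.mono hVU).setIntegral_mul_gradient, (hφ.mono hVU).setIntegral_mul] at this

lemma MemH1.mono {U V : Set (Vec d)} {u : Vec d → ℝ} {G : Vec d → Vec d}
    (h : MemH1 U u G) (hVU : V ⊆ U) : MemH1 V u G :=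
  ⟨h.1.mono_measure (Measure.restrict_mono hVU le_rfl),
    h.2.1.mono_measure (Measure.restrict_mono hVU le_rfl), h.2.2.mono hVU⟩

lemma MemH2.mono {U V : Set (Vec d)} {u : Vec d → ℝ} {G : Vec d → Vec d}
    {D : Fin d → Vec d → Vec d} (h : MemH2 U u G D) (hVU : V ⊆ U) : MemH2 V u G D :=
  ⟨h.1.mono hVU, fun i => (h.2 i).mono hVU⟩

lemma memH1_zero (U : Set (Vec d)) : MemH1 U (fun _ => 0) (fun _ => 0) :=
  ⟨MemLp.zero', MemLp.zero', fun φ _ i => by simp⟩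

lemma MemH1.add {U : Set (Vec d)} {u v : Vec d → ℝ} {G K : Vec d → Vec d}
    (hu : MemH1 U u G) (hv : MemH1 U v K) :
    MemH1 U (fun x => u x + v x) (fun x => G x + K x) := by
  refine ⟨hu.1.add hv.1, hu.2.1.add hv.2.1, fun φ hφ i => ?_⟩
  have h1 := hφ.memLp_gradient_coord (volume.restrict U) i
  have h2 := hφ.memLp 2 (volume.restrict U)
  simp only [add_mul, PiLp.add_apply]
  rw [integral_add (integrable_mul_of_memLp hu.1 h1) (integrable_mul_of_memLp hv.1 h1),
    integral_add (integrable_mul_of_memLp (memLp_coord hu.2.1 i) h2)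
      (integrable_mul_of_memLp (memLp_coord hv.2.1 i) h2), hu.2.2 φ hφ i, hv.2.2 φ hφ i]
  ring

lemma MemH1.smul {U : Set (Vec d)} {u : Vec d → ℝ} {G : Vec d → Vec d}
    (hu : MemH1 U u G) (c : ℝ) : MemH1 U (fun x => c * u x) (fun x => c • G x) := by
  refine ⟨hu.1.const_mul c, hu.2.1.const_smul c, fun φ hφ i => ?_⟩
  simp only [PiLp.smul_apply, smul_eq_mul, mul_assoc]
  rw [integral_const_mul, integral_const_mul, hu.2.2 φ hφ i]
  ring

lemma MemH1.sub {U : Set (Vec d)} {u v : Vec d → ℝ} {G K : Vec d → Vec d}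
    (hu : MemH1 U u G) (hv : MemH1 U v K) :
    MemH1 U (fun x => u x - v x) (fun x => G x - K x) := by
  have := hu.add (hv.smul (-1))
  simpa [sub_eq_add_neg] using this

lemma hasGradientAt_affine (c : ℝ) (ξ x₀ x : Vec d) :
    HasGradientAt (fun y : Vec d => c + inner ℝ ξ (y - x₀)) ξ x := by
  rw [hasGradientAt_iff_hasFDerivAt]
  have h := (innerSL ℝ ξ).hasFDerivAt.comp x ((hasFDerivAt_id x).sub_const x₀)
  exact h.const_add c

lemma contDiff_affine (c : ℝ) (ξ x₀ : Vec d) {n : WithTop ℕ∞} :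
    ContDiff ℝ n (fun y : Vec d => c + inner ℝ ξ (y - x₀)) :=
  contDiff_const.add (contDiff_const.inner ℝ (contDiff_id.sub contDiff_const))

lemma memH1_affine {U : Set (Vec d)} (hU : Bornology.IsBounded U) (c : ℝ) (ξ x₀ : Vec d) :
    MemH1 U (fun x => c + inner ℝ ξ (x - x₀)) (fun _ => ξ) := by
  refine ⟨memLp_of_continuous hU (contDiff_affine (n := 0) c ξ x₀).continuous,
    memLp_const_restrict hU ξ, ?_⟩
  have := hasWeakGradient_of_contDiff U (contDiff_affine (n := 1) c ξ x₀)
  rwa [gradient_eq fun x => hasGradientAt_affine c ξ x₀ x] at this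

lemma ae_eq_of_hasWeakGradient {U : Set (Vec d)} (hU : IsOpen U) {u v : Vec d → ℝ}
    {G K : Vec d → Vec d} (hG : MemLp G 2 (volume.restrict U))
    (hK : MemLp K 2 (volume.restrict U)) (hu : HasWeakGradient U u G)
    (hv : HasWeakGradient U v K) (huv : u =ᵐ[volume.restrict U] v) :
    G =ᵐ[volume.restrict U] K := by
  have key : ∀ i : Fin d, ∀ᵐ x ∂(volume.restrict U), G x i - K x i = 0 := by
    intro i
    have hd := (memLp_coord hG i).sub (memLp_coord hK i)
    rw [ae_restrict_iff' hU.measurableSet]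
    refine hU.ae_eq_zero_of_integral_contDiff_smul_eq_zero (f := fun x => G x i - K x i) ?_ ?_
    · rw [locallyIntegrableOn_iff hU.isLocallyClosed]
      intro k hk hkc
      have : IsFiniteMeasure (volume.restrict k) := ⟨by simpa using hkc.measure_lt_top⟩
      exact (hd.mono_measure (Measure.restrict_mono hk le_rfl)).integrable (by norm_num)
    · intro φ h1 h2 h3
      have hφ : IsTest U φ := ⟨h1, h2, h3⟩
      have e1 := hu φ hφ i
      have e2 := hv φ hφ i
      have e3 : ∫ x in U, u x * gradient φ x i = ∫ x in U, v x * gradient φ x i :=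
        integral_congr_ae (huv.mono fun x hx => by simp only [hx])
      have h4 := hφ.memLp 2 (volume.restrict U)
      have := integral_sub (integrable_mul_of_memLp (memLp_coord hG i) h4)
        (integrable_mul_of_memLp (memLp_coord hK i) h4)
      have e5 := hφ.setIntegral_mul (fun x => G x i - K x i)
      simp only [smul_eq_mul]
      simp only [sub_mul] at e5
      simp only [mul_comm (φ _), sub_mul]
      rw [← e5, this]
      linarith
  filter_upwards [ae_all_iff.2 key] with x hx
  ext i
  linarith [hx i]

/-! ### Limits in `L²` and the space `H_0^1` -/

section L2limit

variable {α E : Type*} [MeasurableSpace α] {μ : Measure α} [NormedAddCommGroup E]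

lemma tendsto_integral_norm_sq {f : ℕ → α → E} {g : α → E} (hf : ∀ n, MemLp (f n) 2 μ)
    (hg : MemLp g 2 μ) (h : Tendsto (fun n => ∫ x, ‖f n x - g x‖ ^ 2 ∂μ) atTop (𝓝 0)) :
    Tendsto (fun n => ∫ x, ‖f n x‖ ^ 2 ∂μ) atTop (𝓝 (∫ x, ‖g x‖ ^ 2 ∂μ)) := by
  have h0 : Tendsto (fun n => √(∫ x, ‖f n x - g x‖ ^ 2 ∂μ)) atTop (𝓝 0) := by
    simpa [Function.comp_def] using (Real.continuous_sqrt.tendsto 0).comp h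
  have h1 : Tendsto (fun n => √(∫ x, ‖f n x‖ ^ 2 ∂μ)) atTop (𝓝 √(∫ x, ‖g x‖ ^ 2 ∂μ)) := by
    rw [tendsto_iff_dist_tendsto_zero]
    refine squeeze_zero (fun _ => dist_nonneg) (fun n => ?_) h0
    have a := sqrt_integral_norm_add_sq_le ((hf n).sub hg) hg
    have b := sqrt_integral_norm_add_sq_le (hg.sub (hf n)) (hf n)
    simp only [Pi.sub_apply, sub_add_cancel] at a b
    have e : ∫ x, ‖g x - f n x‖ ^ 2 ∂μ = ∫ x, ‖f n x - g x‖ ^ 2 ∂μ := by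
      simp only [norm_sub_rev]
    rw [e] at b
    rw [Real.dist_eq, abs_le]
    constructor <;> linarith
  have h2 := h1.pow 2
  simpa [Real.sq_sqrt (integral_norm_sq_nonneg _)] using h2

lemma tendsto_integral_inner [InnerProductSpace ℝ E] {f : ℕ → α → E} {g k : α → E}
    (hf : ∀ n, MemLp (f n) 2 μ)
    (hg : MemLp g 2 μ) (h : Tendsto (fun n => ∫ x, ‖f n x - g x‖ ^ 2 ∂μ) atTop (𝓝 0))
    (hk : MemLp k 2 μ) :
    Tendsto (fun n => ∫ x, inner ℝ (f n x) (k x) ∂μ) atTop (𝓝 (∫ x, inner ℝ (g x) (k x) ∂μ)) := by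
  have h0 : Tendsto (fun n => √(∫ x, ‖f n x - g x‖ ^ 2 ∂μ)) atTop (𝓝 0) := by
    simpa [Function.comp_def] using (Real.continuous_sqrt.tendsto 0).comp h
  rw [tendsto_iff_dist_tendsto_zero]
  refine squeeze_zero (fun _ => dist_nonneg) (fun n => ?_)
    (by simpa using h0.mul_const √(∫ x, ‖k x‖ ^ 2 ∂μ))
  rw [Real.dist_eq, ← integral_sub (integrable_inner_of_memLp (hf n) hk)
    (integrable_inner_of_memLp hg hk)]
  simp only [← inner_sub_left]
  exact abs_integral_inner_le ((hf n).sub hg) hk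

lemma tendsto_integral_mul {f : ℕ → α → ℝ} {g k : α → ℝ} (hf : ∀ n, MemLp (f n) 2 μ)
    (hg : MemLp g 2 μ) (h : Tendsto (fun n => ∫ x, ‖f n x - g x‖ ^ 2 ∂μ) atTop (𝓝 0))
    (hk : MemLp k 2 μ) :
    Tendsto (fun n => ∫ x, f n x * k x ∂μ) atTop (𝓝 (∫ x, g x * k x ∂μ)) := by
  have := tendsto_integral_inner hf hg h hk
  simpa [mul_comm] using this

end L2limit

lemma normH1_sq {U : Set (Vec d)} (u : Vec d → ℝ) (G : Vec d → Vec d) :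
    normH1 U u G ^ 2 = (∫ x in U, ‖u x‖ ^ 2) + ∫ x in U, ‖G x‖ ^ 2 := by
  unfold normH1
  rw [Real.sq_sqrt (add_nonneg (integral_nonneg fun x => by positivity)
    (integral_norm_sq_nonneg _))]
  simp

lemma convergesH1_iff {U : Set (Vec d)} {φ : ℕ → Vec d → ℝ} {u : Vec d → ℝ} {G : Vec d → Vec d} :
    ConvergesH1 U φ u G ↔
      Tendsto (fun n => ∫ x in U, ‖φ n x - u x‖ ^ 2) atTop (𝓝 0) ∧
      Tendsto (fun n => ∫ x in U, ‖gradient (φ n) x - G x‖ ^ 2) atTop (𝓝 0) := by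
  constructor
  · intro h
    have h2 : Tendsto (fun n => (∫ x in U, ‖φ n x - u x‖ ^ 2) +
        ∫ x in U, ‖gradient (φ n) x - G x‖ ^ 2) atTop (𝓝 0) := by
      have := Tendsto.pow (h : Tendsto _ _ _) 2
      simpa [normH1_sq] using this
    exact ⟨squeeze_zero (fun n => integral_norm_sq_nonneg _)
        (fun n => le_add_of_nonneg_right (integral_norm_sq_nonneg _)) h2,
      squeeze_zero (fun n => integral_norm_sq_nonneg _)
        (fun n => le_add_of_nonneg_left (integral_norm_sq_nonneg _)) h2⟩
  · rintro ⟨h1, h2⟩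
    have := (Real.continuous_sqrt.tendsto 0).comp (by simpa using h1.add h2)
    simpa [ConvergesH1, normH1, Function.comp_def] using this

lemma ConvergesH2.convergesH1 {U : Set (Vec d)} {φ : ℕ → Vec d → ℝ} {u : Vec d → ℝ}
    {G : Vec d → Vec d} {D : Fin d → Vec d → Vec d} (h : ConvergesH2 U φ u G D) :
    ConvergesH1 U φ u G := by
  refine squeeze_zero (fun n => Real.sqrt_nonneg _) (fun n => Real.sqrt_le_sqrt ?_) h
  exact le_add_of_nonneg_right (Finset.sum_nonneg fun i _ => integral_norm_sq_nonneg _)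

lemma MemH02.memH01 {U : Set (Vec d)} {u : Vec d → ℝ} {G : Vec d → Vec d}
    {D : Fin d → Vec d → Vec d} (h : MemH02 U u G D) : MemH01 U u G := by
  obtain ⟨h1, φ, h2, h3⟩ := h
  exact ⟨h1.1, φ, h2, h3.convergesH1⟩

lemma MemH01.exists_tendsto {U : Set (Vec d)} {u : Vec d → ℝ} {G : Vec d → Vec d}
    (h : MemH01 U u G) : ∃ φ : ℕ → Vec d → ℝ, (∀ n, IsTest U (φ n)) ∧
      Tendsto (fun n => ∫ x in U, ‖φ n x - u x‖ ^ 2) atTop (𝓝 0) ∧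
      Tendsto (fun n => ∫ x in U, ‖gradient (φ n) x - G x‖ ^ 2) atTop (𝓝 0) := by
  obtain ⟨_, φ, h2, h3⟩ := h
  exact ⟨φ, h2, convergesH1_iff.1 h3⟩

/-- A limit in `H¹` of test functions belongs to `H_0^1`. -/
lemma memH01_of_tendsto {U : Set (Vec d)} {u : Vec d → ℝ} {G : Vec d → Vec d}
    {φ : ℕ → Vec d → ℝ} (hu : MemLp u 2 (volume.restrict U)) (hG : MemLp G 2 (volume.restrict U))
    (hφ : ∀ n, IsTest U (φ n))
    (h1 : Tendsto (fun n => ∫ x in U, ‖φ n x - u x‖ ^ 2) atTop (𝓝 0))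
    (h2 : Tendsto (fun n => ∫ x in U, ‖gradient (φ n) x - G x‖ ^ 2) atTop (𝓝 0)) :
    MemH01 U u G := by
  refine ⟨⟨hu, hG, fun ψ hψ i => ?_⟩, φ, hφ, convergesH1_iff.2 ⟨h1, h2⟩⟩
  have a := tendsto_integral_mul (fun n => (hφ n).memLp 2 (volume.restrict U)) hu h1
    (hψ.memLp_gradient_coord (volume.restrict U) i)
  have h3 : Tendsto (fun n => ∫ x in U, ‖gradient (φ n) x i - G x i‖ ^ 2) atTop (𝓝 0) := by
    refine squeeze_zero (fun n => integral_norm_sq_nonneg _) (fun n => ?_) h2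
    have hm := ((hφ n).memLp_gradient 2 (volume.restrict U)).sub hG
    refine integral_mono (integrable_norm_sq (memLp_coord hm i)) (integrable_norm_sq hm)
      fun x => ?_
    exact pow_le_pow_left₀ (norm_nonneg _) (PiLp.norm_apply_le (gradient (φ n) x - G x) i) 2
  have b := (tendsto_integral_mul (fun n => (hφ n).memLp_gradient_coord (volume.restrict U) i)
    (memLp_coord hG i) h3 (hψ.memLp 2 (volume.restrict U))).neg
  exact tendsto_nhds_unique
    (a.congr fun n => hasWeakGradient_of_contDiff U (hφ n).contDiff_one ψ hψ i) b

lemma memH01_zero (U : Set (Vec d)) : MemH01 U (fun _ => 0) (fun _ => 0) := by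
  refine ⟨memH1_zero U, fun _ _ => 0, fun n => ⟨contDiff_const, ?_, ?_⟩, ?_⟩
  · exact HasCompactSupport.zero
  · simp [tsupport]
  · rw [convergesH1_iff]
    simp

lemma IsTest.add {U : Set (Vec d)} {φ ψ : Vec d → ℝ} (hφ : IsTest U φ) (hψ : IsTest U ψ) :
    IsTest U (fun x => φ x + ψ x) :=
  ⟨hφ.1.add hψ.1, hφ.2.1.add hψ.2.1, (tsupport_add φ ψ).trans (union_subset hφ.2.2 hψ.2.2)⟩

lemma IsTest.smul {U : Set (Vec d)} {φ : Vec d → ℝ} (hφ : IsTest U φ) (c : ℝ) :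
    IsTest U (fun x => c * φ x) :=
  ⟨contDiff_const.mul hφ.1, hφ.2.1.mul_left, (tsupport_mul_subset_right).trans hφ.2.2⟩

lemma gradient_add' {φ ψ : Vec d → ℝ} {x : Vec d} (hφ : DifferentiableAt ℝ φ x)
    (hψ : DifferentiableAt ℝ ψ x) :
    gradient (fun x => φ x + ψ x) x = gradient φ x + gradient ψ x := by
  ext i
  simp only [gradient_apply_coord, PiLp.add_apply]
  rw [fderiv_fun_add hφ hψ]
  rfl

lemma gradient_const_mul' {φ : Vec d → ℝ} {x : Vec d} (hφ : DifferentiableAt ℝ φ x) (c : ℝ) :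
    gradient (fun x => c * φ x) x = c • gradient φ x := by
  ext i
  simp only [gradient_apply_coord, PiLp.smul_apply]
  rw [fderiv_const_mul hφ]
  rfl

lemma IsTest.differentiable {U : Set (Vec d)} {φ : Vec d → ℝ} (hφ : IsTest U φ) :
    Differentiable ℝ φ := hφ.contDiff_one.differentiable (by norm_num)

lemma MemH01.add {U : Set (Vec d)} {u v : Vec d → ℝ} {G K : Vec d → Vec d}
    (hu : MemH01 U u G) (hv : MemH01 U v K) :
    MemH01 U (fun x => u x + v x) (fun x => G x + K x) := by
  obtain ⟨φ, hφ, h1, h2⟩ := hu.exists_tendsto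
  obtain ⟨ψ, hψ, k1, k2⟩ := hv.exists_tendsto
  refine ⟨hu.1.add hv.1, fun n x => φ n x + ψ n x, fun n => (hφ n).add (hψ n), ?_⟩
  rw [convergesH1_iff]
  constructor
  · refine squeeze_zero (fun n => integral_norm_sq_nonneg _) (fun n => ?_)
      (by simpa using (h1.const_mul 2).add (k1.const_mul 2))
    have := integral_norm_add_sq_le (((hφ n).memLp 2 (volume.restrict U)).sub hu.1.1)
      (((hψ n).memLp 2 (volume.restrict U)).sub hv.1.1)
    simpa [add_sub_add_comm] using this
  · refine squeeze_zero (fun n => integral_norm_sq_nonneg _) (fun n => ?_)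
      (by simpa using (h2.const_mul 2).add (k2.const_mul 2))
    have := integral_norm_add_sq_le (((hφ n).memLp_gradient 2 (volume.restrict U)).sub hu.1.2.1)
      (((hψ n).memLp_gradient 2 (volume.restrict U)).sub hv.1.2.1)
    simpa [add_sub_add_comm, gradient_add' ((hφ n).differentiable _)
      ((hψ n).differentiable _)] using this

lemma MemH01.smul {U : Set (Vec d)} {u : Vec d → ℝ} {G : Vec d → Vec d}
    (hu : MemH01 U u G) (c : ℝ) : MemH01 U (fun x => c * u x) (fun x => c • G x) := by
  obtain ⟨φ, hφ, h1, h2⟩ := hu.exists_tendsto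
  refine ⟨hu.1.smul c, fun n x => c * φ n x, fun n => (hφ n).smul c, ?_⟩
  rw [convergesH1_iff]
  constructor
  · simpa only [← mul_sub, norm_mul, mul_pow, integral_const_mul, mul_zero] using
      h1.const_mul (‖c‖ ^ 2)
  · simpa only [gradient_const_mul' ((hφ _).differentiable _), ← smul_sub, norm_smul, mul_pow,
      integral_const_mul, mul_zero] using h2.const_mul (‖c‖ ^ 2)

lemma MemH01.sub {U : Set (Vec d)} {u v : Vec d → ℝ} {G K : Vec d → Vec d}
    (hu : MemH01 U u G) (hv : MemH01 U v K) :
    MemH01 U (fun x => u x - v x) (fun x => G x - K x) := by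
  have := hu.add (hv.smul (-1))
  simpa [sub_eq_add_neg] using this

/-! ### The Poincaré inequality and the `H^{-1}` norm -/

lemma IsTest.integral_sq_le {U : Set (Vec d)} {φ : Vec d → ℝ} (hφ : IsTest U φ) (i : Fin d)
    {R : ℝ} (hU : ∀ x ∈ U, ‖x‖ ≤ R) :
    ∫ x in U, ‖φ x‖ ^ 2 ≤ 4 * R ^ 2 * ∫ x in U, ‖gradient φ x‖ ^ 2 := by
  have hc : ContDiff ℝ 1 (fun x : Vec d => x i * φ x) := by
    have := hφ.contDiff_one
    fun_prop
  have h := hasWeakGradient_of_contDiff U hc φ hφ i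
  have hg : ∀ x : Vec d, gradient (fun x : Vec d => x i * φ x) x i
      = φ x + x i * gradient φ x i := by
    intro x
    simp only [gradient_apply_coord]
    have h1 : HasFDerivAt (fun x : Vec d => x i) (EuclideanSpace.proj (𝕜 := ℝ) i) x :=
      (EuclideanSpace.proj (𝕜 := ℝ) (ι := Fin d) i).hasFDerivAt
    have h2 : HasFDerivAt (fun x : Vec d => x i * φ x) _ x :=
      h1.mul (hφ.differentiable x).hasFDerivAt
    rw [h2.fderiv]
    simp
    ring
  simp only [hg] at h
  have m1 := hφ.memLp 2 (volume.restrict U)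
  have m2 := hφ.memLp_gradient_coord (volume.restrict U) i
  have m3 : MemLp (fun x : Vec d => x i * gradient φ x i) 2 (volume.restrict U) := by
    have hcg := continuous_gradient hφ.contDiff_one
    refine Continuous.memLp_of_hasCompactSupport (by fun_prop) ?_
    refine HasCompactSupport.mul_left ?_
    exact hφ.hasCompactSupport_gradient.comp_left (g := fun v : Vec d => v i) rfl
  have e1 : ∫ x in U, (φ x + x i * gradient φ x i) * φ x
      = (∫ x in U, φ x * φ x) + ∫ x in U, x i * gradient φ x i * φ x := by
    simp only [add_mul]
    exact integral_add (integrable_mul_of_memLp m1 m1) (integrable_mul_of_memLp m3 m1)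
  have e2 : ∫ x in U, x i * φ x * gradient φ x i = ∫ x in U, x i * gradient φ x i * φ x :=
    integral_congr_ae (ae_of_all _ fun x => by ring)
  rw [e1, e2] at h
  have e3 := (abs_le.1 (abs_integral_mul_le m3 m1)).1
  have e4 : ∫ x in U, (x i * gradient φ x i) ^ 2 ≤ R ^ 2 * ∫ x in U, ‖gradient φ x‖ ^ 2 := by
    rw [← integral_const_mul]
    have hUm : ∀ᵐ x ∂(volume.restrict U), ‖x‖ ≤ R := by
      refine ae_restrict_of_ae_restrict_of_subset (t := {x : Vec d | ‖x‖ ≤ R}) hU ?_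
      exact ae_restrict_mem (isClosed_le continuous_norm continuous_const).measurableSet
    refine integral_mono_ae m3.integrable_sq ((integrable_norm_sq
      (hφ.memLp_gradient 2 (volume.restrict U))).const_mul _) ?_
    filter_upwards [hUm] with x hx
    rw [mul_pow, ← sq_abs (x i), ← sq_abs (gradient φ x i)]
    have a1 := PiLp.norm_apply_le x i
    have a2 := PiLp.norm_apply_le (gradient φ x) i
    rw [Real.norm_eq_abs] at a1 a2
    gcongr
    exact a1.trans hx
  have e5 : ∫ x in U, ‖φ x‖ ^ 2 = ∫ x in U, φ x * φ x :=
    integral_congr_ae (ae_of_all _ fun x => by simp [sq])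
  have e6 : ∫ x in U, φ x ^ 2 = ∫ x in U, φ x * φ x := by simp only [sq]
  rw [e6] at e3
  rw [e5]
  set X := ∫ x in U, φ x * φ x
  set Y := ∫ x in U, ‖gradient φ x‖ ^ 2
  have hX : 0 ≤ X := integral_nonneg fun x => mul_self_nonneg _
  have hs : √(∫ x in U, (x i * gradient φ x i) ^ 2) ≤ √(R ^ 2 * Y) := Real.sqrt_le_sqrt e4
  have e7 : X ≤ 2 * (√(R ^ 2 * Y) * √X) := by
    have := mul_le_mul_of_nonneg_right hs (Real.sqrt_nonneg X)
    linarith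
  have hY : 0 ≤ R ^ 2 * Y := mul_nonneg (sq_nonneg _) (integral_norm_sq_nonneg _)
  have a := Real.sq_sqrt hX
  have b := Real.sq_sqrt hY
  nlinarith [sq_nonneg (√X - 2 * √(R ^ 2 * Y))]

/-- The Poincaré inequality in `H_0^1`. -/
lemma MemH01.integral_sq_le {U : Set (Vec d)} {u : Vec d → ℝ} {G : Vec d → Vec d}
    (hd : 0 < d) (h : MemH01 U u G) {R : ℝ} (hU : ∀ x ∈ U, ‖x‖ ≤ R) :
    ∫ x in U, ‖u x‖ ^ 2 ≤ 4 * R ^ 2 * ∫ x in U, ‖G x‖ ^ 2 := by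
  obtain ⟨φ, hφ, h1, h2⟩ := h.exists_tendsto
  have a := tendsto_integral_norm_sq (fun n => (hφ n).memLp 2 (volume.restrict U)) h.1.1 h1
  have b := tendsto_integral_norm_sq (fun n => (hφ n).memLp_gradient 2 (volume.restrict U))
    h.1.2.1 h2
  exact le_of_tendsto_of_tendsto' a (b.const_mul _) fun n => (hφ n).integral_sq_le ⟨0, hd⟩ hU

lemma bddAbove_normHneg1 {U : Set (Vec d)} {f : Vec d → ℝ}
    (hf : MemLp f 2 (volume.restrict U)) :
    BddAbove {r | ∃ v G, MemH01 U v G ∧ normH1 U v G ≤ 1 ∧ r = ∫ x in U, f x * v x} := by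
  refine ⟨√(∫ x in U, f x ^ 2), ?_⟩
  rintro r ⟨v, G, hv, h1, rfl⟩
  have a := abs_integral_mul_le hf hv.1.1
  have b : √(∫ x in U, v x ^ 2) ≤ 1 := by
    refine le_trans (Real.sqrt_le_sqrt ?_) h1
    exact le_add_of_nonneg_right (integral_norm_sq_nonneg _)
  calc _ ≤ _ := le_abs_self _
    _ ≤ _ := a
    _ ≤ √(∫ x in U, f x ^ 2) * 1 := by gcongr
    _ = _ := mul_one _

lemma normHneg1_nonneg {U : Set (Vec d)} {f : Vec d → ℝ}
    (hf : MemLp f 2 (volume.restrict U)) : 0 ≤ normHneg1 U f :=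
  le_csSup (bddAbove_normHneg1 hf) ⟨_, _, memH01_zero U, by simp [normH1], by simp⟩

lemma integral_mul_le_normHneg1 {U : Set (Vec d)} {f : Vec d → ℝ}
    (hf : MemLp f 2 (volume.restrict U)) {v : Vec d → ℝ} {G : Vec d → Vec d}
    (hv : MemH01 U v G) : ∫ x in U, f x * v x ≤ normHneg1 U f * normH1 U v G := by
  have key : ∀ t > normH1 U v G, ∫ x in U, f x * v x ≤ normHneg1 U f * t := by
    intro t ht
    have ht0 : 0 < t := (Real.sqrt_nonneg _).trans_lt ht
    have h1 : normH1 U (fun x => t⁻¹ * v x) (fun x => t⁻¹ • G x) ≤ 1 := by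
      refine (sq_le_one_iff₀ (Real.sqrt_nonneg _)).1 ?_
      have e := normH1_sq (U := U) (fun x => t⁻¹ * v x) (fun x => t⁻¹ • G x)
      simp only [norm_smul, norm_mul, mul_pow, integral_const_mul] at e
      have e' := normH1_sq (U := U) v G
      rw [← mul_add, ← e'] at e
      refine e.trans_le ?_
      rw [norm_inv, Real.norm_of_nonneg ht0.le, ← mul_pow]
      refine pow_le_one₀ (mul_nonneg (by positivity) (Real.sqrt_nonneg _)) ?_
      rw [inv_mul_le_iff₀ ht0, mul_one]
      exact ht.le
    have h2 := le_csSup (bddAbove_normHneg1 hf) ⟨_, _, hv.smul t⁻¹, h1, rfl⟩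
    have e : ∫ x in U, f x * (t⁻¹ * v x) = t⁻¹ * ∫ x in U, f x * v x := by
      rw [← integral_const_mul]
      exact integral_congr_ae (ae_of_all _ fun x => by ring)
    rw [e, inv_mul_le_iff₀ ht0] at h2
    rw [mul_comm]
    exact h2
  refine ge_of_tendsto (x := 𝓝[>] (normH1 U v G)) (f := fun t => normHneg1 U f * t) ?_ ?_
  · exact (tendsto_id.mono_left nhdsWithin_le_nhds).const_mul _
  · filter_upwards [self_mem_nhdsWithin] with t ht using key t ht

lemma MemH01.normH1_le {U : Set (Vec d)} {u : Vec d → ℝ} {G : Vec d → Vec d}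
    (hd : 0 < d) (h : MemH01 U u G) {R : ℝ} (hU : ∀ x ∈ U, ‖x‖ ≤ R) :
    normH1 U u G ≤ √(4 * R ^ 2 + 1) * √(∫ x in U, ‖G x‖ ^ 2) := by
  rw [← Real.sqrt_mul (by positivity)]
  refine Real.sqrt_le_sqrt ?_
  have := h.integral_sq_le hd hU
  simp only [Real.norm_eq_abs, sq_abs] at this
  linarith

/-! ### Coefficients -/

lemma memLp_clm_apply {α : Type*} [MeasurableSpace α] {μ : Measure α} {A : α → Mat d}
    {G : α → Vec d} (hA : MemLp A ⊤ μ) (hG : MemLp G 2 μ) : MemLp (fun x => A x (G x)) 2 μ := by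
  have hm : AEStronglyMeasurable (fun x => A x (G x)) μ :=
    isBoundedBilinearMap_apply.continuous.comp_aestronglyMeasurable (hA.1.prodMk hG.1)
  refine MemLp.of_le_mul (c := (eLpNorm A ⊤ μ).toReal) hG hm ?_
  have h := ae_le_eLpNormEssSup (f := A) (μ := μ)
  filter_upwards [h] with x hx
  refine ((A x).le_opNorm _).trans ?_
  gcongr
  rw [eLpNorm_exponent_top, ← toReal_enorm]
  refine ENNReal.toReal_mono ?_ hx
  rw [← eLpNorm_exponent_top]
  exact hA.2.ne

lemma integral_coeff_ge {U : Set (Vec d)} {lam Lam : ℝ} {A : Vec d → Mat d}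
    (hA : A ∈ CoeffClass lam Lam U) {G : Vec d → Vec d} (hG : MemLp G 2 (volume.restrict U)) :
    lam * ∫ x in U, ‖G x‖ ^ 2 ≤ ∫ x in U, inner ℝ (A x (G x)) (G x) := by
  rw [← integral_const_mul]
  refine integral_mono_ae ((integrable_norm_sq hG).const_mul _)
    (integrable_inner_of_memLp (memLp_clm_apply hA.1 hG) hG) ?_
  filter_upwards [hA.2] with x hx using (hx _).1

lemma integral_coeff_ge' {U : Set (Vec d)} {lam Lam : ℝ} {A : Vec d → Mat d}
    (hA : A ∈ CoeffClass lam Lam U) {G : Vec d → Vec d} (hG : MemLp G 2 (volume.restrict U)) :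
    1 / Lam * ∫ x in U, ‖A x (G x)‖ ^ 2 ≤ ∫ x in U, inner ℝ (A x (G x)) (G x) := by
  have hAG := memLp_clm_apply hA.1 hG
  rw [← integral_const_mul]
  refine integral_mono_ae ((integrable_norm_sq hAG).const_mul _)
    (integrable_inner_of_memLp hAG hG) ?_
  filter_upwards [hA.2] with x hx using (hx _).2

lemma IsSingularSolution.norm_gradient_le {Ω : Set (Vec d)} (hd : 0 < d) {R : ℝ}
    (hΩ : ∀ x ∈ Ω, ‖x‖ ≤ R) {lam Lam ι : ℝ} (hlam : 0 < lam) {A : Vec d → Mat d}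
    (hA : A ∈ CoeffClass lam Lam Ω) {f : Vec d → ℝ} (hf : MemLp f 2 (volume.restrict Ω))
    {u : Vec d → ℝ} {G : Vec d → Vec d} {D : Fin d → Vec d → Vec d}
    (h : IsSingularSolution Ω ι A f u G D) :
    √(∫ x in Ω, ‖G x‖ ^ 2) ≤ √(4 * R ^ 2 + 1) / lam * normHneg1 Ω f := by
  have h1 := h.2 u G D h.1
  have h2 := integral_coeff_ge hA h.1.1.1.2.1
  have h3 := integral_mul_le_normHneg1 hf h.1.memH01
  have h4 := h.1.memH01.normH1_le hd hΩ
  have h5 : 0 ≤ ι ^ 2 * ∫ x in Ω, lapl D x * lapl D x :=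
    mul_nonneg (sq_nonneg _) (integral_nonneg fun x => mul_self_nonneg _)
  have hN := normHneg1_nonneg hf
  set N := normHneg1 Ω f
  set X := ∫ x in Ω, ‖G x‖ ^ 2
  have hX : 0 ≤ X := integral_norm_sq_nonneg _
  have h6 : lam * X ≤ N * (√(4 * R ^ 2 + 1) * √X) := by
    have := mul_le_mul_of_nonneg_left h4 hN
    linarith
  rw [div_mul_eq_mul_div, le_div_iff₀ hlam]
  rcases (Real.sqrt_nonneg X).eq_or_lt with h0 | h0
  · rw [← h0, zero_mul]
    exact mul_nonneg (Real.sqrt_nonneg _) hN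
  · have a := Real.sq_sqrt hX
    refine le_of_mul_le_mul_right ?_ h0
    nlinarith

/-- The energy estimate for the homogenized solution, inherited from the singularly perturbed
problems. -/
lemma IsEffectiveMatrix.norm_gradient_le {Ω : Set (Vec d)} (hd : 0 < d) {R : ℝ}
    (hΩ : ∀ x ∈ Ω, ‖x‖ ≤ R) {lam Lam : ℝ} (hlam : 0 < lam) {S : Set ℝ} (hS : 0 ∈ closure S)
    {ι : ℝ → ℝ} {A : ℝ → Vec d → Mat d}
    (hA : ∀ ε ∈ S, A ε ∈ CoeffClass lam Lam Ω) {Abar : Vec d → Mat d}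
    (hAbar : IsEffectiveMatrix Ω S ι A Abar) {f : Vec d → ℝ}
    (hf : MemLp f 2 (volume.restrict Ω)) {u : Vec d → ℝ} {G : Vec d → Vec d}
    (h : IsEllipticSolution Ω Abar f u G) :
    √(∫ x in Ω, ‖G x‖ ^ 2) ≤ √(4 * R ^ 2 + 1) / lam * normHneg1 Ω f := by
  obtain ⟨v, Gv, Dv, hv, -, hw⟩ := (hAbar.2 f hf).2 u G h
  have hG := h.1.1.2.1
  have hlim := (hw G hG).1
  have : (𝓝[S] (0 : ℝ)).NeBot := mem_closure_iff_nhdsWithin_neBot.1 hS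
  set B := √(4 * R ^ 2 + 1) / lam * normHneg1 Ω f
  have hle : ∫ x in Ω, inner ℝ (G x) (G x) ≤ B * √(∫ x in Ω, ‖G x‖ ^ 2) := by
    refine le_of_tendsto hlim ?_
    filter_upwards [self_mem_nhdsWithin] with ε hε
    refine ((le_abs_self _).trans (abs_integral_inner_le (hv ε hε).1.1.1.2.1 hG)).trans ?_
    gcongr
    exact (hv ε hε).norm_gradient_le hd hΩ hlam (hA ε hε) hf
  simp only [real_inner_self_eq_norm_sq] at hle
  have hB : 0 ≤ B := mul_nonneg (by positivity) (normHneg1_nonneg hf)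
  set X := ∫ x in Ω, ‖G x‖ ^ 2
  have hX : 0 ≤ X := integral_norm_sq_nonneg _
  rcases (Real.sqrt_nonneg X).eq_or_lt with h0 | h0
  · rw [← h0]
    exact hB
  · refine le_of_mul_le_mul_right ?_ h0
    rwa [Real.mul_self_sqrt hX]

/-! ### Cells -/

lemma isOpen_cell (x : Vec d) (δ : ℝ) : IsOpen (cell x δ) := by
  unfold cell
  simp only [ofPred_forall]
  exact isOpen_iInter_of_finite fun i => isOpen_lt (by fun_prop) continuous_const

lemma norm_le_sum_abs (y : Vec d) : ‖y‖ ≤ ∑ i, |y i| := by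
  have h : y = ∑ i, y i • EuclideanSpace.single i (1 : ℝ) := by
    ext j
    simp [Finset.sum_apply, Pi.single_apply]
  conv_lhs => rw [h]
  refine (norm_sum_le _ _).trans (Finset.sum_le_sum fun i _ => ?_)
  simp [norm_smul]

lemma isBounded_cell (x : Vec d) (δ : ℝ) : Bornology.IsBounded (cell x δ) := by
  rw [isBounded_iff_forall_norm_le]
  refine ⟨∑ i, (|x i| + δ / 2), fun y hy => (norm_le_sum_abs y).trans
    (Finset.sum_le_sum fun i _ => ?_)⟩
  have := abs_add_le (x i) (y i - x i)
  rw [add_sub_cancel] at this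
  exact this.trans (by linarith [hy i])

lemma measure_cell_pos (x : Vec d) {δ : ℝ} (hδ : 0 < δ) : 0 < volume.real (cell x δ) := by
  refine ENNReal.toReal_pos ?_ (isBounded_cell x δ).measure_lt_top.ne
  exact ((isOpen_cell x δ).measure_pos volume ⟨x, fun i => by simpa using hδ⟩).ne'

/-- The mean of the derivatives of a smooth periodic function over the cell vanishes. -/
lemma integral_gradient_periodic (x : Vec d) {δ : ℝ} (hδ : 0 < δ) {φ : Vec d → ℝ}
    (hφ : ContDiff ℝ 1 φ) (hper : ∀ y i, φ (y + EuclideanSpace.single i δ) = φ y) (i : Fin d) :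
    ∫ y in cell x δ, gradient φ y i = 0 := by
  obtain ⟨n, rfl⟩ : ∃ n, d = n + 1 := ⟨d - 1, by have := i.pos; omega⟩
  set a : Fin (n + 1) → ℝ := fun j => x j - δ / 2
  set b : Fin (n + 1) → ℝ := fun j => x j + δ / 2
  have hcell : cell x δ = (WithLp.ofLp : Vec (n + 1) → _) ⁻¹' (univ.pi fun j => Ioo (a j) (b j)) := by
    ext y
    simp only [cell, mem_ofPred_eq, mem_preimage, mem_univ_pi, mem_Ioo, abs_lt, a, b]
    refine forall_congr' fun j => ?_
    constructor <;> rintro ⟨h1, h2⟩ <;> constructor <;> linarith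
  let L := EuclideanSpace.equiv (Fin (n + 1)) ℝ
  have hfd : ∀ z : Fin (n + 1) → ℝ, HasFDerivAt (fun z => φ (L.symm z))
      ((fderiv ℝ φ (L.symm z)).comp (L.symm : (Fin (n + 1) → ℝ) →L[ℝ] Vec (n + 1))) z := by
    intro z
    exact (hφ.differentiable (by norm_num) _).hasFDerivAt.comp z L.symm.hasFDerivAt
  have hc : Continuous fun z => fderiv ℝ φ (L.symm z) :=
    (hφ.continuous_fderiv (by norm_num)).comp L.symm.continuous
  have key := integral_divergence_of_hasFDerivAt_off_countable' a b
    (fun j => by simp only [a, b]; linarith)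
    (fun j z => if j = i then φ (L.symm z) else 0)
    (fun j z => if j = i then
      (fderiv ℝ φ (L.symm z)).comp (L.symm : (Fin (n + 1) → ℝ) →L[ℝ] Vec (n + 1)) else 0)
    ∅ countable_empty ?_ ?_ ?_
  · have e1 : ∀ z : Fin (n + 1) → ℝ, (∑ j, (if j = i then
      (fderiv ℝ φ (L.symm z)).comp (L.symm : (Fin (n + 1) → ℝ) →L[ℝ] Vec (n + 1)) else 0)
        (Pi.single j 1)) = gradient φ (L.symm z) i := by
      intro z
      rw [Finset.sum_eq_single i (by intro j _ hj; simp [hj]) (by simp)]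
      simp only [if_true, gradient_apply_coord]
      rfl
    simp only [e1] at key
    have e2 := (PiLp.volume_preserving_ofLp (Fin (n + 1))).setIntegral_preimage_emb
      (MeasurableEquiv.toLp 2 _).symm.measurableEmbedding
      (fun z => gradient φ (L.symm z) i) (univ.pi fun j => Ioo (a j) (b j))
    rw [hcell]
    refine Eq.trans e2 ?_
    have e3 : (univ.pi fun j => Ioo (a j) (b j)) =ᵐ[(volume : Measure (Fin (n + 1) → ℝ))] Icc a b :=
      Measure.univ_pi_Ioo_ae_eq_Icc
    rw [setIntegral_congr_set e3, key]
    refine Finset.sum_eq_zero fun j _ => ?_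
    rw [sub_eq_zero]
    refine integral_congr_ae (ae_of_all _ fun z => ?_)
    simp only
    split_ifs with h
    · subst h
      have : L.symm (j.insertNth (b j) z) = L.symm (j.insertNth (a j) z)
          + EuclideanSpace.single j δ := by
        ext k
        refine Fin.succAboveCases j ?_ (fun k => ?_) k
        · simp [L, a, b]
          ring
        · simp [L]
      rw [this, hper]
    · rfl
  · intro j
    by_cases h : j = i
    · simp only [h, if_true]
      exact (hφ.continuous.comp L.symm.continuous).continuousOn
    · simp only [h, if_false]
      exact continuousOn_const
  · intro z _ j
    by_cases h : j = i
    · simp only [h, if_true]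
      exact hfd z
    · simp only [h, if_false]
      exact hasFDerivAt_const _ _
  · refine (Continuous.continuousOn ?_).integrableOn_compact isCompact_Icc
    refine continuous_finsetSum _ fun j _ => ?_
    by_cases h : j = i
    · simp only [h, if_true]
      exact hc.clm_apply continuous_const
    · simp only [h, if_false]
      exact continuous_const

/-! ### Linear structure of the spaces of cell functions -/

lemma MemH2.add {U : Set (Vec d)} {u v : Vec d → ℝ} {G K : Vec d → Vec d}
    {D E : Fin d → Vec d → Vec d} (hu : MemH2 U u G D) (hv : MemH2 U v K E) :
    MemH2 U (fun x => u x + v x) (fun x => G x + K x) (fun i x => D i x + E i x) :=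
  ⟨hu.1.add hv.1, fun i => (hu.2 i).add (hv.2 i)⟩

lemma MemH2.smul {U : Set (Vec d)} {u : Vec d → ℝ} {G : Vec d → Vec d}
    {D : Fin d → Vec d → Vec d} (hu : MemH2 U u G D) (c : ℝ) :
    MemH2 U (fun x => c * u x) (fun x => c • G x) (fun i x => c • D i x) :=
  ⟨hu.1.smul c, fun i => (hu.2 i).smul c⟩

lemma memH2_zero (U : Set (Vec d)) : MemH2 U (fun _ => 0) (fun _ => 0) (fun _ _ => 0) :=
  ⟨memH1_zero U, fun _ => memH1_zero U⟩

lemma contDiff_gradient_coord {φ : Vec d → ℝ} (hφ : ContDiff ℝ ∞ φ) (i : Fin d) :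
    ContDiff ℝ ∞ (fun x => gradient φ x i) := by
  simp only [gradient_apply_coord]
  exact (hφ.fderiv_right (m := ∞) (by simp)).clm_apply contDiff_const

lemma normH2_sq {U : Set (Vec d)} (u : Vec d → ℝ) (G : Vec d → Vec d)
    (D : Fin d → Vec d → Vec d) :
    normH2 U u G D ^ 2 = (∫ x in U, ‖u x‖ ^ 2) + (∫ x in U, ‖G x‖ ^ 2)
      + ∑ i, ∫ x in U, ‖D i x‖ ^ 2 := by
  unfold normH2
  rw [Real.sq_sqrt]
  · simp
  · have h1 : 0 ≤ ∫ x in U, u x ^ 2 := integral_nonneg fun x => by positivity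
    have h2 : 0 ≤ ∫ x in U, ‖G x‖ ^ 2 := integral_norm_sq_nonneg _
    have h3 : 0 ≤ ∑ i, ∫ x in U, ‖D i x‖ ^ 2 :=
      Finset.sum_nonneg fun i _ => integral_norm_sq_nonneg _
    linarith

lemma convergesH2_iff {U : Set (Vec d)} {φ : ℕ → Vec d → ℝ} {u : Vec d → ℝ} {G : Vec d → Vec d}
    {D : Fin d → Vec d → Vec d} :
    ConvergesH2 U φ u G D ↔
      ConvergesH1 U φ u G ∧
      ∀ i, Tendsto (fun n => ∫ x in U, ‖gradient (fun y => gradient (φ n) y i) x - D i x‖ ^ 2)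
        atTop (𝓝 0) := by
  constructor
  · intro h
    refine ⟨h.convergesH1, fun i => ?_⟩
    have := Tendsto.pow (h : Tendsto _ _ _) 2
    simp only [normH2_sq] at this
    refine squeeze_zero (fun n => integral_norm_sq_nonneg _) (fun n => ?_) (by simpa using this)
    have h1 := Finset.single_le_sum (f := fun i => ∫ x in U,
      ‖gradient (fun y => gradient (φ n) y i) x - D i x‖ ^ 2)
      (fun j _ => integral_norm_sq_nonneg _) (Finset.mem_univ i)
    refine h1.trans (le_add_of_nonneg_left (add_nonneg (integral_nonneg fun x => by positivity)
      (integral_norm_sq_nonneg _)))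
  · rintro ⟨h, h3⟩
    obtain ⟨h1, h2⟩ := convergesH1_iff.1 h
    have := (Real.continuous_sqrt.tendsto 0).comp
      (by simpa using (h1.add h2).add (tendsto_finsetSum Finset.univ fun i _ => h3 i))
    simpa [ConvergesH2, normH2, Function.comp_def] using this

lemma ConvergesH1.add {U : Set (Vec d)} (hU : Bornology.IsBounded U) {φ ψ : ℕ → Vec d → ℝ}
    {u v : Vec d → ℝ} {G K : Vec d → Vec d} (hu : MemH1 U u G) (hv : MemH1 U v K)
    (hφ : ∀ n, ContDiff ℝ 1 (φ n)) (hψ : ∀ n, ContDiff ℝ 1 (ψ n))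
    (h : ConvergesH1 U φ u G) (k : ConvergesH1 U ψ v K) :
    ConvergesH1 U (fun n x => φ n x + ψ n x) (fun x => u x + v x) (fun x => G x + K x) := by
  rw [convergesH1_iff] at h k ⊢
  constructor
  · refine squeeze_zero (fun n => integral_norm_sq_nonneg _) (fun n => ?_)
      (by simpa using (h.1.const_mul 2).add (k.1.const_mul 2))
    have := integral_norm_add_sq_le ((memLp_of_continuous hU (hφ n).continuous).sub hu.1)
      ((memLp_of_continuous hU (hψ n).continuous).sub hv.1)
    simpa [add_sub_add_comm] using this
  · refine squeeze_zero (fun n => integral_norm_sq_nonneg _) (fun n => ?_)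
      (by simpa using (h.2.const_mul 2).add (k.2.const_mul 2))
    have := integral_norm_add_sq_le
      ((memLp_of_continuous hU (continuous_gradient (hφ n))).sub hu.2.1)
      ((memLp_of_continuous hU (continuous_gradient (hψ n))).sub hv.2.1)
    simpa [add_sub_add_comm, gradient_add' ((hφ n).differentiable (by norm_num) _)
      ((hψ n).differentiable (by norm_num) _)] using this

lemma ConvergesH1.smul {U : Set (Vec d)} {φ : ℕ → Vec d → ℝ}
    {u : Vec d → ℝ} {G : Vec d → Vec d} (hφ : ∀ n, ContDiff ℝ 1 (φ n))
    (h : ConvergesH1 U φ u G) (c : ℝ) :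
    ConvergesH1 U (fun n x => c * φ n x) (fun x => c * u x) (fun x => c • G x) := by
  rw [convergesH1_iff] at h ⊢
  constructor
  · simpa only [← mul_sub, norm_mul, mul_pow, integral_const_mul, mul_zero] using
      h.1.const_mul (‖c‖ ^ 2)
  · simpa only [gradient_const_mul' ((hφ _).differentiable (by norm_num) _), ← smul_sub,
      norm_smul, mul_pow, integral_const_mul, mul_zero] using h.2.const_mul (‖c‖ ^ 2)

lemma ConvergesH2.add {U : Set (Vec d)} (hU : Bornology.IsBounded U) {φ ψ : ℕ → Vec d → ℝ}
    {u v : Vec d → ℝ} {G K : Vec d → Vec d} {D E : Fin d → Vec d → Vec d}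
    (hu : MemH2 U u G D) (hv : MemH2 U v K E)
    (hφ : ∀ n, ContDiff ℝ ∞ (φ n)) (hψ : ∀ n, ContDiff ℝ ∞ (ψ n))
    (h : ConvergesH2 U φ u G D) (k : ConvergesH2 U ψ v K E) :
    ConvergesH2 U (fun n x => φ n x + ψ n x) (fun x => u x + v x) (fun x => G x + K x)
      (fun i x => D i x + E i x) := by
  have hφ1 := fun n => (hφ n).of_le (m := 1) (by exact_mod_cast le_top)
  have hψ1 := fun n => (hψ n).of_le (m := 1) (by exact_mod_cast le_top)
  rw [convergesH2_iff] at h k ⊢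
  refine ⟨h.1.add hU hu.1 hv.1 hφ1 hψ1 k.1, fun i => ?_⟩
  have hφ2 := fun n => (contDiff_gradient_coord (hφ n) i).of_le (m := 1) (by exact_mod_cast le_top)
  have hψ2 := fun n => (contDiff_gradient_coord (hψ n) i).of_le (m := 1) (by exact_mod_cast le_top)
  refine squeeze_zero (fun n => integral_norm_sq_nonneg _) (fun n => ?_)
    (by simpa using ((h.2 i).const_mul 2).add ((k.2 i).const_mul 2))
  have := integral_norm_add_sq_le
      ((memLp_of_continuous hU (continuous_gradient (hφ2 n))).sub (hu.2 i).2.1)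
      ((memLp_of_continuous hU (continuous_gradient (hψ2 n))).sub (hv.2 i).2.1)
  simpa [add_sub_add_comm, gradient_add' ((hφ1 n).differentiable (by norm_num) _)
      ((hψ1 n).differentiable (by norm_num) _),
      gradient_add' ((hφ2 n).differentiable (by norm_num) _)
      ((hψ2 n).differentiable (by norm_num) _)] using this

lemma ConvergesH2.smul {U : Set (Vec d)} {φ : ℕ → Vec d → ℝ}
    {u : Vec d → ℝ} {G : Vec d → Vec d} {D : Fin d → Vec d → Vec d}
    (hφ : ∀ n, ContDiff ℝ ∞ (φ n)) (h : ConvergesH2 U φ u G D) (c : ℝ) :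
    ConvergesH2 U (fun n x => c * φ n x) (fun x => c * u x) (fun x => c • G x)
      (fun i x => c • D i x) := by
  have hφ1 := fun n => (hφ n).of_le (m := 1) (by exact_mod_cast le_top)
  rw [convergesH2_iff] at h ⊢
  refine ⟨h.1.smul hφ1 c, fun i => ?_⟩
  have hφ2 := fun n => (contDiff_gradient_coord (hφ n) i).of_le (m := 1) (by exact_mod_cast le_top)
  simpa only [gradient_const_mul' ((hφ1 _).differentiable (by norm_num) _), PiLp.smul_apply,
    smul_eq_mul, gradient_const_mul' ((hφ2 _).differentiable (by norm_num) _), ← smul_sub,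
      norm_smul, mul_pow, integral_const_mul, mul_zero] using (h.2 i).const_mul (‖c‖ ^ 2)

lemma convergesH2_zero (U : Set (Vec d)) :
    ConvergesH2 U (fun _ _ => 0) (fun _ => 0) (fun _ => 0) (fun _ _ => 0) := by
  rw [convergesH2_iff, convergesH1_iff]
  simp

lemma MemH01.integral_gradient_eq_zero {U : Set (Vec d)} (hU : Bornology.IsBounded U)
    {z : Vec d → ℝ} {G : Vec d → Vec d} (h : MemH01 U z G) (i : Fin d) :
    ∫ y in U, G y i = 0 := by
  obtain ⟨φ, hφ, _, h2⟩ := h.exists_tendsto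
  have hk : MemLp (fun _ : Vec d => EuclideanSpace.single i (1 : ℝ)) 2 (volume.restrict U) :=
    memLp_const_restrict hU _
  have a := tendsto_integral_inner (fun n => (hφ n).memLp_gradient 2 (volume.restrict U))
    h.1.2.1 h2 hk
  simp only [EuclideanSpace.inner_single_right, conj_trivial, one_mul] at a
  refine tendsto_nhds_unique a (tendsto_const_nhds.congr fun n => ?_)
  have e := hasWeakGradient_of_contDiff U (contDiff_const (c := (1 : ℝ))) (φ n) (hφ n) i
  simpa using e.symm

lemma MemH2per.integral_gradient_eq_zero {x : Vec d} {δ : ℝ} (hδ : 0 < δ)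
    {z : Vec d → ℝ} {G : Vec d → Vec d} {D : Fin d → Vec d → Vec d} (h : MemH2per x δ z G D)
    (i : Fin d) : ∫ y in cell x δ, G y i = 0 := by
  obtain ⟨h1, φ, hφ, h2⟩ := h
  have hU := isBounded_cell x δ
  have hc := fun n => (hφ n).1.of_le (m := 1) (by exact_mod_cast le_top)
  have hk : MemLp (fun _ : Vec d => EuclideanSpace.single i (1 : ℝ)) 2
      (volume.restrict (cell x δ)) := memLp_const_restrict hU _
  have a := tendsto_integral_inner (fun n => memLp_of_continuous hU (continuous_gradient (hc n)))
    h1.1.2.1 (convergesH1_iff.1 h2.convergesH1).2 hk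
  simp only [EuclideanSpace.inner_single_right, conj_trivial, one_mul] at a
  exact tendsto_nhds_unique a (tendsto_const_nhds.congr fun n =>
    (integral_gradient_periodic x hδ (hc n) (hφ n).2 i).symm)

lemma integrable_of_memLp_restrict {E : Type*} [NormedAddCommGroup E] {U : Set (Vec d)}
    (hU : Bornology.IsBounded U) {G : Vec d → E} (hG : MemLp G 2 (volume.restrict U)) :
    IntegrableOn G U := by
  have : IsFiniteMeasure (volume.restrict U) := ⟨by simpa using hU.measure_lt_top⟩
  exact hG.integrable (by norm_num)

lemma integral_coord {U : Set (Vec d)} (hU : Bornology.IsBounded U) {G : Vec d → Vec d}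
    (hG : MemLp G 2 (volume.restrict U)) (i : Fin d) :
    (∫ y in U, G y) i = ∫ y in U, G y i :=
  ((EuclideanSpace.proj (𝕜 := ℝ) (ι := Fin d) i).integral_comp_comm
    (integrable_of_memLp_restrict hU hG)).symm

lemma MemVh.integral_gradient_eq_zero {x : Vec d} {δ : ℝ} (hδ : 0 < δ)
    {Xh : Submodule ℝ (Vec d → ℝ)} {bc : CellBC} {z : Vec d → ℝ} {G : Vec d → Vec d}
    {D : Fin d → Vec d → Vec d} (h : MemVh x δ Xh bc z G D) : ∫ y in cell x δ, G y = 0 := by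
  obtain ⟨-, h1, h2⟩ := h
  have hU := isBounded_cell x δ
  cases bc with
  | essential =>
    ext i
    rw [integral_coord hU h1.1.2.1]
    exact h2.memH01.integral_gradient_eq_zero hU i
  | natural =>
    ext i
    rw [integral_coord hU h1.1.2.1]
    exact h2.integral_gradient_eq_zero hU i
  | free =>
    have := h2.2
    rw [setAverage_eq, smul_eq_zero] at this
    exact this.resolve_left (inv_ne_zero (measure_cell_pos x hδ).ne')
  | periodic =>
    ext i
    rw [integral_coord hU h1.1.2.1]
    exact h2.2.integral_gradient_eq_zero hδ i

lemma MemH02.add {U : Set (Vec d)} (hU : Bornology.IsBounded U) {u v : Vec d → ℝ}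
    {G K : Vec d → Vec d} {D E : Fin d → Vec d → Vec d} (hu : MemH02 U u G D)
    (hv : MemH02 U v K E) :
    MemH02 U (fun x => u x + v x) (fun x => G x + K x) (fun i x => D i x + E i x) := by
  obtain ⟨h1, φ, hφ, h2⟩ := hu
  obtain ⟨k1, ψ, hψ, k2⟩ := hv
  exact ⟨h1.add k1, _, fun n => (hφ n).add (hψ n),
    h2.add hU h1 k1 (fun n => (hφ n).1) (fun n => (hψ n).1) k2⟩

lemma MemH02.smul {U : Set (Vec d)} {u : Vec d → ℝ} {G : Vec d → Vec d}
    {D : Fin d → Vec d → Vec d} (hu : MemH02 U u G D) (c : ℝ) :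
    MemH02 U (fun x => c * u x) (fun x => c • G x) (fun i x => c • D i x) := by
  obtain ⟨h1, φ, hφ, h2⟩ := hu
  exact ⟨h1.smul c, _, fun n => (hφ n).smul c, h2.smul (fun n => (hφ n).1) c⟩

lemma MemH2per.add {x : Vec d} {δ : ℝ} {u v : Vec d → ℝ}
    {G K : Vec d → Vec d} {D E : Fin d → Vec d → Vec d} (hu : MemH2per x δ u G D)
    (hv : MemH2per x δ v K E) :
    MemH2per x δ (fun x => u x + v x) (fun x => G x + K x) (fun i x => D i x + E i x) := by
  obtain ⟨h1, φ, hφ, h2⟩ := hu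
  obtain ⟨k1, ψ, hψ, k2⟩ := hv
  exact ⟨h1.add k1, fun n x => φ n x + ψ n x, fun n => ⟨(hφ n).1.add (hψ n).1, fun y i => by
    simp only [(hφ n).2 y i, (hψ n).2 y i]⟩,
    h2.add (isBounded_cell x δ) h1 k1 (fun n => (hφ n).1) (fun n => (hψ n).1) k2⟩

lemma MemH2per.smul {x : Vec d} {δ : ℝ} {u : Vec d → ℝ} {G : Vec d → Vec d}
    {D : Fin d → Vec d → Vec d} (hu : MemH2per x δ u G D) (c : ℝ) :
    MemH2per x δ (fun x => c * u x) (fun x => c • G x) (fun i x => c • D i x) := by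
  obtain ⟨h1, φ, hφ, h2⟩ := hu
  exact ⟨h1.smul c, fun n x => c * φ n x, fun n => ⟨contDiff_const.mul (hφ n).1, fun y i => by
    simp only [(hφ n).2 y i]⟩, h2.smul (fun n => (hφ n).1) c⟩

lemma MemVh.add {x : Vec d} {δ : ℝ} {Xh : Submodule ℝ (Vec d → ℝ)} {bc : CellBC}
    {u v : Vec d → ℝ} {G K : Vec d → Vec d} {D E : Fin d → Vec d → Vec d}
    (hu : MemVh x δ Xh bc u G D) (hv : MemVh x δ Xh bc v K E) :
    MemVh x δ Xh bc (fun x => u x + v x) (fun x => G x + K x) (fun i x => D i x + E i x) := by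
  obtain ⟨h0, h1, h2⟩ := hu
  obtain ⟨k0, k1, k2⟩ := hv
  have hU := isBounded_cell x δ
  refine ⟨Xh.add_mem h0 k0, h1.add k1, ?_⟩
  cases bc with
  | essential => exact MemH02.add hU h2 k2
  | natural => exact MemH01.add h2 k2
  | free =>
    simp only [setAverage_eq] at h2 k2 ⊢
    rw [integral_add (integrable_of_memLp_restrict hU h1.1.1)
      (integrable_of_memLp_restrict hU k1.1.1),
      integral_add (integrable_of_memLp_restrict hU h1.1.2.1)
      (integrable_of_memLp_restrict hU k1.1.2.1), smul_add, h2.1, h2.2, k2.1, k2.2]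
    simp
  | periodic =>
    refine ⟨?_, MemH2per.add h2.2 k2.2⟩
    rw [integral_add (integrable_of_memLp_restrict hU h1.1.1)
      (integrable_of_memLp_restrict hU k1.1.1), h2.1, k2.1, add_zero]

lemma MemVh.smul {x : Vec d} {δ : ℝ} {Xh : Submodule ℝ (Vec d → ℝ)} {bc : CellBC}
    {u : Vec d → ℝ} {G : Vec d → Vec d} {D : Fin d → Vec d → Vec d}
    (hu : MemVh x δ Xh bc u G D) (c : ℝ) :
    MemVh x δ Xh bc (fun x => c * u x) (fun x => c • G x) (fun i x => c • D i x) := by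
  obtain ⟨h0, h1, h2⟩ := hu
  refine ⟨Xh.smul_mem c h0, h1.smul c, ?_⟩
  cases bc with
  | essential => exact MemH02.smul h2 c
  | natural => exact MemH01.smul h2 c
  | free =>
    simp only [setAverage_eq] at h2 ⊢
    rw [integral_const_mul, integral_smul, smul_comm, h2.1, h2.2]
    simp
  | periodic => exact ⟨by rw [integral_const_mul, h2.1, mul_zero], MemH2per.smul h2.2 c⟩

lemma memVh_zero (x : Vec d) (δ : ℝ) (Xh : Submodule ℝ (Vec d → ℝ)) (bc : CellBC) :
    MemVh x δ Xh bc (fun _ => 0) (fun _ => 0) (fun _ _ => 0) := by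
  refine ⟨Xh.zero_mem, memH2_zero _, ?_⟩
  have h02 : ∀ n : ℕ, IsTest (cell x δ) ((fun _ _ => 0 : ℕ → Vec d → ℝ) n) := fun n =>
    ⟨contDiff_const, HasCompactSupport.zero, by simp [tsupport]⟩
  cases bc with
  | essential => exact ⟨memH2_zero _, _, h02, convergesH2_zero _⟩
  | natural => exact memH01_zero _
  | free => simp
  | periodic =>
    exact ⟨by simp, memH2_zero _, fun _ _ => 0, fun n => ⟨contDiff_const, by simp⟩,
      convergesH2_zero _⟩

/-! ### The bilinear form of the cell problem and its solvability -/

/-- Square integrable pairs (gradient, Hessian). -/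
def l2Pairs (U : Set (Vec d)) : Submodule ℝ ((Vec d → Vec d) × (Fin d → Vec d → Vec d)) where
  carrier := {p | MemLp p.1 2 (volume.restrict U) ∧ ∀ i, MemLp (p.2 i) 2 (volume.restrict U)}
  add_mem' ha hb := ⟨ha.1.add hb.1, fun i => (ha.2 i).add (hb.2 i)⟩
  zero_mem' := ⟨MemLp.zero, fun _ => MemLp.zero⟩
  smul_mem' c _ ha := ⟨ha.1.const_smul c, fun i => (ha.2 i).const_smul c⟩

lemma integrable_sum_inner {U : Set (Vec d)} {D E : Fin d → Vec d → Vec d}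
    (hD : ∀ i, MemLp (D i) 2 (volume.restrict U)) (hE : ∀ i, MemLp (E i) 2 (volume.restrict U)) :
    Integrable (fun y => ∑ i, inner ℝ (D i y) (E i y)) (volume.restrict U) :=
  integrable_finsetSum _ fun i _ => integrable_inner_of_memLp (hD i) (hE i)

/-- The bilinear form `aCell` on square integrable pairs. -/
def cellForm {U : Set (Vec d)} (ι : ℝ) {A : Vec d → Mat d} (hA : MemLp A ⊤ (volume.restrict U)) :
    l2Pairs U →ₗ[ℝ] l2Pairs U →ₗ[ℝ] ℝ :=
  LinearMap.mk₂ ℝ (fun p q => aCell U ι A p.1.1 p.1.2 q.1.1 q.1.2)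
    (fun p p' q => by
      simp only [aCell, Submodule.coe_add, Prod.fst_add, Prod.snd_add, Pi.add_apply, map_add,
        inner_add_left, Finset.sum_add_distrib]
      rw [integral_add (integrable_inner_of_memLp (memLp_clm_apply hA p.2.1) q.2.1)
        (integrable_inner_of_memLp (memLp_clm_apply hA p'.2.1) q.2.1),
        integral_add (integrable_sum_inner p.2.2 q.2.2) (integrable_sum_inner p'.2.2 q.2.2)]
      ring)
    (fun c p q => by
      simp only [aCell, Submodule.coe_smul, Prod.smul_fst, Prod.smul_snd, Pi.smul_apply, map_smul,
        real_inner_smul_left, ← Finset.mul_sum, integral_const_mul, smul_eq_mul]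
      ring)
    (fun p q q' => by
      simp only [aCell, Submodule.coe_add, Prod.fst_add, Prod.snd_add, Pi.add_apply,
        inner_add_right, Finset.sum_add_distrib]
      rw [integral_add (integrable_inner_of_memLp (memLp_clm_apply hA p.2.1) q.2.1)
        (integrable_inner_of_memLp (memLp_clm_apply hA p.2.1) q'.2.1),
        integral_add (integrable_sum_inner p.2.2 q.2.2) (integrable_sum_inner p.2.2 q'.2.2)]
      ring)
    (fun c p q => by
      simp only [aCell, Submodule.coe_smul, Prod.smul_fst, Prod.smul_snd, Pi.smul_apply,
        real_inner_smul_right, ← Finset.mul_sum, integral_const_mul, smul_eq_mul]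
      ring)

lemma cellForm_apply {U : Set (Vec d)} (ι : ℝ) {A : Vec d → Mat d}
    (hA : MemLp A ⊤ (volume.restrict U)) (p q : l2Pairs U) :
    cellForm ι hA p q = aCell U ι A p.1.1 p.1.2 q.1.1 q.1.2 := rfl

/-- A linear functional on a finite-dimensional space that vanishes where the quadratic form of `B`
does is represented by `B`. -/
lemma exists_forall_bilin_eq {V : Type*} [AddCommGroup V] [Module ℝ V] [FiniteDimensional ℝ V]
    (B : V →ₗ[ℝ] V →ₗ[ℝ] ℝ) (l : V →ₗ[ℝ] ℝ) (h : ∀ v, B v v = 0 → l v = 0) :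
    ∃ w, ∀ v, B w v = l v := by
  suffices hl : l ∈ LinearMap.range B by
    obtain ⟨w, rfl⟩ := hl
    exact ⟨w, fun v => rfl⟩
  by_contra hl
  obtain ⟨f, hf, hle⟩ := Submodule.exists_le_ker_of_notMem hl
  obtain ⟨v, rfl⟩ := (Module.evalEquiv ℝ V).surjective f
  exact hf (h v (hle ⟨v, rfl⟩))

lemma le_aCell_self (U : Set (Vec d)) (A : Vec d → Mat d) (ι : ℝ) (G : Vec d → Vec d)
    (D : Fin d → Vec d → Vec d) :
    ∫ y in U, inner ℝ (A y (G y)) (G y) ≤ aCell U ι A G D G D := by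
  refine le_add_of_nonneg_right (mul_nonneg (sq_nonneg _) (integral_nonneg fun y => ?_))
  exact Finset.sum_nonneg fun i _ => real_inner_self_nonneg

lemma aCell_congr_right {U : Set (Vec d)} (ι : ℝ) (A : Vec d → Mat d) (G : Vec d → Vec d)
    (D : Fin d → Vec d → Vec d) {K K' : Vec d → Vec d} {E E' : Fin d → Vec d → Vec d}
    (hK : K =ᵐ[volume.restrict U] K') (hE : ∀ i, E i =ᵐ[volume.restrict U] E' i) :
    aCell U ι A G D K E = aCell U ι A G D K' E' := by
  unfold aCell
  congr 1
  · exact integral_congr_ae (hK.mono fun y hy => by simp only [hy])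
  · congr 1
    refine integral_congr_ae ?_
    filter_upwards [ae_all_iff.2 hE] with y hy
    simp only [hy]

lemma exists_cellSolution {x : Vec d} {δ : ℝ} {lam Lam : ℝ} (hlam : 0 < lam)
    (ι : ℝ) {A : Vec d → Mat d} (hA : A ∈ CoeffClass lam Lam (cell x δ))
    {Xh : Submodule ℝ (Vec d → ℝ)} [FiniteDimensional ℝ Xh] (bc : CellBC) (ξ : Vec d) :
    ∃ v Gv Dv, IsCellSolution x δ ι A Xh bc 0 ξ v Gv Dv := by
  have hU := isBounded_cell x δ
  let S : Submodule ℝ (Vec d → ℝ) :=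
    { carrier := {z | ∃ G D, MemVh x δ Xh bc z G D}
      add_mem' := fun ⟨G, D, h⟩ ⟨K, E, k⟩ => ⟨_, _, h.add k⟩
      zero_mem' := ⟨_, _, memVh_zero x δ Xh bc⟩
      smul_mem' := fun c _ ⟨G, D, h⟩ => ⟨_, _, h.smul c⟩ }
  have hS : S ≤ Xh := fun z ⟨G, D, h⟩ => h.1
  have : FiniteDimensional ℝ S := Submodule.finiteDimensional_of_le hS
  let b := Module.finBasis ℝ S
  choose G D hGD using fun j => (b j).2
  have hmem : ∀ {z G D}, MemVh x δ Xh bc z G D → (G, D) ∈ l2Pairs (cell x δ) :=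
    fun h => ⟨h.2.1.1.2.1, fun i => (h.2.1.2 i).2.1⟩
  let Φ : S →ₗ[ℝ] l2Pairs (cell x δ) := b.constr ℝ fun j => ⟨(G j, D j), hmem (hGD j)⟩
  have hΦ : ∀ s : S, MemVh x δ Xh bc s (Φ s).1.1 (Φ s).1.2 := by
    intro s
    have hs : s ∈ Submodule.span ℝ (range b) := b.span_eq ▸ Submodule.mem_top
    induction hs using Submodule.span_induction with
    | mem s h =>
      obtain ⟨j, rfl⟩ := h
      simp only [Φ, Module.Basis.constr_basis]
      exact hGD j
    | zero =>
      rw [map_zero]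
      exact memVh_zero x δ Xh bc
    | add s t _ _ hs ht =>
      rw [map_add]
      exact hs.add ht
    | smul c s _ hs =>
      rw [map_smul]
      exact hs.smul c
  let q : l2Pairs (cell x δ) := ⟨(fun _ => ξ, fun _ _ => 0), memLp_const_restrict hU ξ,
    fun _ => memLp_const_restrict hU 0⟩
  obtain ⟨w, hw⟩ := exists_forall_bilin_eq
    ((cellForm ι hA.1).compl₁₂ Φ Φ) (-((cellForm ι hA.1 q).comp Φ)) (by
      intro s hs
      have h1 := le_aCell_self (cell x δ) A ι (Φ s).1.1 (Φ s).1.2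
      have h2 := integral_coeff_ge hA (Φ s).2.1
      rw [LinearMap.compl₁₂_apply, cellForm_apply] at hs
      have h3 : ∫ y in cell x δ, ‖(Φ s).1.1 y‖ ^ 2 = 0 := by
        refine le_antisymm ?_ (integral_norm_sq_nonneg _)
        have h4 : lam * ∫ y in cell x δ, ‖(Φ s).1.1 y‖ ^ 2 ≤ 0 := by linarith
        exact nonpos_of_mul_nonpos_right h4 hlam
      have h5 : (Φ s).1.1 =ᵐ[volume.restrict (cell x δ)] fun _ => 0 := by
        rw [integral_eq_zero_iff_of_nonneg (fun y => by positivity)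
          (integrable_norm_sq (Φ s).2.1)] at h3
        filter_upwards [h3] with y hy
        simpa using hy
      rw [LinearMap.neg_apply, LinearMap.comp_apply, cellForm_apply,
        aCell_congr_right ι A _ _ h5 fun i => EventuallyEq.rfl]
      simp [aCell, q])
  refine ⟨fun y => (0 + inner ℝ ξ (y - x)) + w.1 y, fun y => ξ + (Φ w).1.1 y, (Φ w).1.2, ?_, ?_⟩
  · simpa using hΦ w
  · intro z Gz Dz hz
    have hzS : z ∈ S := ⟨_, _, hz⟩
    have h1 := hΦ ⟨z, hzS⟩
    have hUo := isOpen_cell x δ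
    have e1 : Gz =ᵐ[volume.restrict (cell x δ)] (Φ ⟨z, hzS⟩).1.1 :=
      ae_eq_of_hasWeakGradient hUo hz.2.1.1.2.1 h1.2.1.1.2.1 hz.2.1.1.2.2 h1.2.1.1.2.2
        EventuallyEq.rfl
    have e2 : ∀ i, Dz i =ᵐ[volume.restrict (cell x δ)] (Φ ⟨z, hzS⟩).1.2 i := fun i =>
      ae_eq_of_hasWeakGradient hUo (hz.2.1.2 i).2.1 (h1.2.1.2 i).2.1 (hz.2.1.2 i).2.2
        (h1.2.1.2 i).2.2 (e1.mono fun y hy => by simp only [hy])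
    rw [aCell_congr_right ι A _ _ e1 e2]
    have e3 := hw ⟨z, hzS⟩
    have e4 : cellForm ι hA.1 (q + Φ w) (Φ ⟨z, hzS⟩) = 0 := by
      rw [map_add, LinearMap.add_apply]
      simp only [LinearMap.compl₁₂_apply, LinearMap.neg_apply, LinearMap.comp_apply] at e3
      rw [e3, add_neg_cancel]
    rw [cellForm_apply] at e4
    have e5 : (q + Φ w).1.2 = (Φ w).1.2 := by
      simp only [Submodule.coe_add, Prod.snd_add, q]
      exact zero_add _
    rw [e5] at e4
    exact e4

lemma norm_sq_mul_measure_le {U : Set (Vec d)} (hU : Bornology.IsBounded U) {G : Vec d → Vec d}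
    (hG : MemLp G 2 (volume.restrict U)) {ξ : Vec d}
    (h : ∫ y in U, G y = volume.real U • ξ) :
    volume.real U * ‖ξ‖ ^ 2 ≤ ∫ y in U, ‖G y‖ ^ 2 := by
  have h1 : ∫ y in U, inner ℝ (G y) ξ = volume.real U * ‖ξ‖ ^ 2 := by
    have := integral_inner (𝕜 := ℝ) (integrable_of_memLp_restrict hU hG) ξ
    rw [h, real_inner_smul_right, real_inner_self_eq_norm_sq] at this
    rw [← this]
    simp only [real_inner_comm]
  have hk := memLp_const_restrict hU ξ
  have h2 : ∫ y in U, (2 * inner ℝ (G y) ξ - ‖ξ‖ ^ 2) ≤ ∫ y in U, ‖G y‖ ^ 2 := by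
    refine integral_mono (((integrable_inner_of_memLp hG hk).const_mul 2).sub
      (integrable_norm_sq hk)) (integrable_norm_sq hG) fun y => ?_
    have := norm_sub_sq_real (G y) ξ
    have := sq_nonneg ‖G y - ξ‖
    simp only
    linarith
  rw [integral_sub ((integrable_inner_of_memLp hG hk).const_mul 2) (integrable_norm_sq hk),
    integral_const_mul, h1, setIntegral_const, smul_eq_mul] at h2
  linarith

/-- The numerical effective matrix inherits the bounds of the class `M(λ, Λ)`. -/
lemma IsCellMatrix.bounds {x : Vec d} {δ : ℝ} (hδ : 0 < δ) {lam Lam : ℝ} (hlam : 0 < lam)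
    (hLam : 0 < Lam) {ι : ℝ} {A : Vec d → Mat d} (hA : A ∈ CoeffClass lam Lam (cell x δ))
    {Xh : Submodule ℝ (Vec d → ℝ)} (hXh : IsCellSpace x δ Xh) {bc : CellBC} {B : Mat d}
    (hB : IsCellMatrix x δ ι A Xh bc B) (ξ : Vec d) :
    lam * ‖ξ‖ ^ 2 ≤ inner ℝ ξ (B ξ) ∧ ‖B ξ‖ ≤ Lam * ‖ξ‖ := by
  have := hXh.1
  obtain ⟨v, G, D, hv⟩ := exists_cellSolution hlam ι hA (Xh := Xh) bc ξ
  have hU := isBounded_cell x δ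
  have hm := measure_cell_pos x hδ
  have hBξ := hB _ _ _ _ _ hv
  have hk := memLp_const_restrict hU ξ
  have hG : MemLp G 2 (volume.restrict (cell x δ)) := by
    exact (hv.1.2.1.1.2.1.add hk).ae_eq (ae_of_all _ fun y => by simp)
  have hAG := memLp_clm_apply hA.1 hG
  have hmean : ∫ y in cell x δ, G y = volume.real (cell x δ) • ξ := by
    have := hv.1.integral_gradient_eq_zero hδ
    rw [integral_sub (integrable_of_memLp_restrict hU hG) (integrable_of_memLp_restrict hU hk),
      setIntegral_const, sub_eq_zero] at this
    exact this
  rw [setAverage_eq, hmean, inv_smul_smul₀ hm.ne', setAverage_eq] at hBξ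
  have hflux : ∫ y in cell x δ, A y (G y) = volume.real (cell x δ) • B ξ := by
    rw [hBξ, smul_inv_smul₀ hm.ne']
  have e1 : ∫ y in cell x δ, inner ℝ (A y (G y)) ξ = volume.real (cell x δ) * inner ℝ ξ (B ξ) := by
    have := integral_inner (𝕜 := ℝ) (integrable_of_memLp_restrict hU hAG) ξ
    rw [hflux, real_inner_smul_right] at this
    rw [← this]
    simp only [real_inner_comm]
  have e2 := hv.2 _ _ _ hv.1
  have e3 : ∫ y in cell x δ, inner ℝ (A y (G y)) (G y) ≤
      volume.real (cell x δ) * inner ℝ ξ (B ξ) := by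
    unfold aCell at e2
    simp only [inner_sub_right] at e2
    rw [integral_sub (integrable_inner_of_memLp hAG hG) (integrable_inner_of_memLp hAG hk), e1]
      at e2
    have : 0 ≤ ι ^ 2 * ∫ y in cell x δ, ∑ i, inner ℝ (D i y) (D i y) :=
      mul_nonneg (sq_nonneg _) (integral_nonneg fun y =>
        Finset.sum_nonneg fun i _ => real_inner_self_nonneg)
    linarith
  have e4 := norm_sq_mul_measure_le hU hG hmean
  have e5 := norm_sq_mul_measure_le hU hAG hflux
  have e6 := integral_coeff_ge hA hG
  have e7 := integral_coeff_ge' hA hG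
  constructor
  · refine le_of_mul_le_mul_left ?_ hm
    nlinarith
  · have e8 : ‖B ξ‖ ^ 2 ≤ Lam * inner ℝ ξ (B ξ) := by
      rw [one_div, inv_mul_le_iff₀ hLam] at e7
      refine le_of_mul_le_mul_left ?_ hm
      nlinarith
    have e9 : inner ℝ ξ (B ξ) ≤ ‖ξ‖ * ‖B ξ‖ := real_inner_le_norm _ _
    rcases (norm_nonneg (B ξ)).eq_or_lt with h0 | h0
    · rw [← h0]
      positivity
    · refine le_of_mul_le_mul_right ?_ h0
      nlinarith

/-! ### The Poincaré inequality on convex sets -/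

lemma lintegral_mul_sq_le {α : Type*} [MeasurableSpace α] {μ : Measure α} {f g : α → ENNReal}
    (hf : AEMeasurable f μ) (hg : AEMeasurable g μ) :
    (∫⁻ x, f x * g x ∂μ) ^ 2 ≤ (∫⁻ x, f x ∂μ) * ∫⁻ x, f x * g x ^ 2 ∂μ := by
  have h := ENNReal.lintegral_mul_norm_pow_le hf (hf.mul (hg.pow_const 2)) (p := 1 / 2)
    (q := 1 / 2) (by norm_num) (by norm_num) (by norm_num)
  have e : ∀ x, f x ^ (1 / 2 : ℝ) * (f x * g x ^ 2) ^ (1 / 2 : ℝ) = f x * g x := by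
    intro x
    rw [ENNReal.mul_rpow_of_nonneg _ _ (by norm_num), ← mul_assoc,
      ← ENNReal.rpow_add_of_nonneg _ _ (by norm_num) (by norm_num), ← ENNReal.rpow_natCast,
      ← ENNReal.rpow_mul]
    norm_num
  have h' : (∫⁻ x, f x * g x ∂μ) ≤
      (∫⁻ x, f x ∂μ) ^ (1 / 2 : ℝ) * (∫⁻ x, f x * g x ^ 2 ∂μ) ^ (1 / 2 : ℝ) := by
    simpa only [Pi.mul_apply, Pi.pow_apply, e] using h
  refine (pow_le_pow_left₀ zero_le h' 2).trans_eq ?_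
  rw [mul_pow, ← ENNReal.rpow_natCast, ← ENNReal.rpow_natCast, ← ENNReal.rpow_mul,
    ← ENNReal.rpow_mul]
  norm_num

lemma enorm_sub_sq_le_lintegral {h h' : ℝ → ℝ} (hh : ∀ t, HasDerivAt h (h' t) t)
    (hc : Continuous h') {T : ℝ} (hT : 0 ≤ T) :
    ‖h T - h 0‖ₑ ^ 2 ≤ ENNReal.ofReal T * ∫⁻ t in Ioc 0 T, ‖h' t‖ₑ ^ 2 := by
  have e : h T - h 0 = ∫ t in Ioc 0 T, h' t := by
    rw [← intervalIntegral.integral_of_le hT,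
      intervalIntegral.integral_eq_sub_of_hasDerivAt (fun t _ => hh t) (hc.intervalIntegrable _ _)]
  rw [e]
  have h1 := enorm_integral_le_lintegral_enorm (μ := volume.restrict (Ioc 0 T)) h'
  have h2 := lintegral_mul_sq_le (μ := volume.restrict (Ioc 0 T)) (f := fun _ => 1)
    (g := fun t => ‖h' t‖ₑ) aemeasurable_const hc.measurable.enorm.aemeasurable
  simp only [one_mul, lintegral_const, Measure.restrict_apply_univ, Real.volume_Ioc, sub_zero]
    at h2
  exact (pow_le_pow_left₀ zero_le h1 2).trans h2

lemma hasDerivAt_comp_line {φ : Vec d → ℝ} (hφ : ContDiff ℝ 1 φ) (x v : Vec d) (t : ℝ) :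
    HasDerivAt (fun t : ℝ => φ (x + t • v)) (inner ℝ (gradient φ (x + t • v)) v) t := by
  rw [inner_gradient_left]
  have h1 : HasDerivAt (fun t : ℝ => x + t • v) v t := by
    simpa using ((hasDerivAt_id t).smul_const v).const_add x
  exact (hφ.differentiable (by norm_num) _).hasFDerivAt.comp_hasDerivAt t h1

lemma enorm_inner_sq_le (x y : Vec d) : ‖inner ℝ x y‖ₑ ^ 2 ≤ ‖x‖ₑ ^ 2 * ‖y‖ₑ ^ 2 := by
  rw [← mul_pow]
  refine pow_le_pow_left₀ zero_le ?_ 2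
  rw [← ofReal_norm, ← ofReal_norm, ← ofReal_norm, ← ENNReal.ofReal_mul (norm_nonneg _)]
  exact ENNReal.ofReal_le_ofReal (norm_inner_le_norm x y)

lemma enorm_sub_sq_le_of_contDiff {φ : Vec d → ℝ} (hφ : ContDiff ℝ 1 φ) (x y : Vec d) :
    ‖φ x - φ y‖ₑ ^ 2 ≤
      ‖y - x‖ₑ ^ 2 * ∫⁻ t in Ioc (0 : ℝ) 1, ‖gradient φ (x + t • (y - x))‖ₑ ^ 2 := by
  have hcont : Continuous fun t : ℝ => gradient φ (x + t • (y - x)) :=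
    (continuous_gradient hφ).comp (by fun_prop)
  have h := enorm_sub_sq_le_lintegral (hasDerivAt_comp_line hφ x (y - x))
    (hcont.inner continuous_const) zero_le_one
  simp only [one_smul, zero_smul, add_zero, add_sub_cancel, ENNReal.ofReal_one, one_mul] at h
  rw [← enorm_neg, neg_sub]
  refine h.trans ?_
  rw [← lintegral_const_mul' _ _ (ENNReal.pow_ne_top enorm_ne_top)]
  refine lintegral_mono fun t => ?_
  rw [mul_comm]
  exact enorm_inner_sq_le _ _

lemma lintegral_comp_add_smul {F : Vec d → ENNReal} (hF : Measurable F) (a : Vec d) {t : ℝ}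
    (ht : t ≠ 0) : ∫⁻ y, F (a + t • y) = ENNReal.ofReal |(t ^ d)⁻¹| * ∫⁻ y, F y := by
  have h := Measure.map_addHaar_smul (volume : Measure (Vec d)) ht
  rw [finrank_euclideanSpace, Fintype.card_fin] at h
  have h2 : ∫⁻ y, F (a + t • y) = ∫⁻ z, F (a + z) ∂(Measure.map (t • ·) (volume : Measure (Vec d))) := by
    rw [lintegral_map (by fun_prop) (by fun_prop)]
  rw [h2, h, lintegral_smul_measure, lintegral_add_left_eq_self, smul_eq_mul]

lemma ofReal_abs_inv_pow_le {t : ℝ} (ht : 1 / 2 ≤ t) :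
    ENNReal.ofReal |(t ^ d)⁻¹| ≤ 2 ^ d := by
  have h0 : 0 < t := by linarith
  rw [abs_of_pos (by positivity), ← inv_pow]
  refine (ENNReal.ofReal_le_ofReal (pow_le_pow_left₀ (by positivity)
    ((inv_le_comm₀ h0 (by norm_num : (0 : ℝ) < 2)).2 (by linarith)) d)).trans_eq ?_
  rw [ENNReal.ofReal_pow (by norm_num), ENNReal.ofReal_ofNat]

/-- The Poincaré inequality on a convex set, in terms of differences, for smooth functions. -/
lemma lintegral_sub_sq_le_of_contDiff {φ : Vec d → ℝ} (hφ : ContDiff ℝ 1 φ) {Q : Set (Vec d)}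
    (hQ : MeasurableSet Q) (hc : Convex ℝ Q) {D : ENNReal}
    (hD : ∀ x ∈ Q, ∀ y ∈ Q, ‖y - x‖ₑ ≤ D) :
    ∫⁻ x in Q, ∫⁻ y in Q, ‖φ x - φ y‖ₑ ^ 2 ≤
      D ^ 2 * (2 ^ d * volume Q * ∫⁻ x in Q, ‖gradient φ x‖ₑ ^ 2) := by
  set F : Vec d → ENNReal := Q.indicator fun x => ‖gradient φ x‖ₑ ^ 2 with hFdef
  have hF : Measurable F :=
    ((continuous_gradient hφ).measurable.enorm.pow_const 2).indicator hQ
  have hFint : ∫⁻ x, F x = ∫⁻ x in Q, ‖gradient φ x‖ₑ ^ 2 := lintegral_indicator hQ _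
  have h1 : ∫⁻ x in Q, ∫⁻ y in Q, ‖φ x - φ y‖ₑ ^ 2 ≤
      ∫⁻ x in Q, ∫⁻ y in Q, D ^ 2 * ∫⁻ t in Ioc (0 : ℝ) 1, F (x + t • (y - x)) := by
    refine setLIntegral_mono' hQ fun x hx => setLIntegral_mono' hQ fun y hy => ?_
    refine (enorm_sub_sq_le_of_contDiff hφ x y).trans ?_
    refine mul_le_mul' (pow_le_pow_left₀ zero_le (hD x hx y hy) 2)
      (setLIntegral_mono' measurableSet_Ioc fun t ht => ?_)
    have : x + t • (y - x) ∈ Q := hc.add_smul_sub_mem hx hy ⟨ht.1.le, ht.2⟩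
    rw [hFdef, indicator_of_mem this]
  refine h1.trans ?_
  have hm3 : Measurable fun p : (Vec d × Vec d) × ℝ => F (p.1.1 + p.2 • (p.1.2 - p.1.1)) :=
    hF.comp (by fun_prop)
  have hmt : Measurable fun p : Vec d × Vec d =>
      ∫⁻ t in Ioc (0 : ℝ) 1, F (p.1 + t • (p.2 - p.1)) := hm3.lintegral_prod_right'
  have hin : ∀ x : Vec d, ∫⁻ y in Q, D ^ 2 * ∫⁻ t in Ioc (0 : ℝ) 1, F (x + t • (y - x)) =
      D ^ 2 * ∫⁻ y in Q, ∫⁻ t in Ioc (0 : ℝ) 1, F (x + t • (y - x)) := fun x =>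
    lintegral_const_mul _ (hmt.comp measurable_prodMk_left)
  simp only [hin]
  rw [lintegral_const_mul _ hmt.lintegral_prod_right']
  refine mul_le_mul' le_rfl ?_
  have hsw : ∫⁻ x in Q, ∫⁻ y in Q, ∫⁻ t in Ioc (0 : ℝ) 1, F (x + t • (y - x)) =
      ∫⁻ t in Ioc (0 : ℝ) 1, ∫⁻ x in Q, ∫⁻ y in Q, F (x + t • (y - x)) := by
    have a : ∀ x : Vec d, ∫⁻ y in Q, ∫⁻ t in Ioc (0 : ℝ) 1, F (x + t • (y - x)) =
        ∫⁻ t in Ioc (0 : ℝ) 1, ∫⁻ y in Q, F (x + t • (y - x)) := fun x =>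
      lintegral_lintegral_swap (hF.comp (by fun_prop)).aemeasurable
    simp only [a]
    refine lintegral_lintegral_swap (Measurable.aemeasurable ?_)
    have hm4 : Measurable fun p : (Vec d × ℝ) × Vec d => F (p.1.1 + p.1.2 • (p.2 - p.1.1)) :=
      hF.comp (by fun_prop)
    exact hm4.lintegral_prod_right'
  rw [hsw, ← hFint]
  have hbound : ∀ t ∈ Ioc (0 : ℝ) 1, ∫⁻ x in Q, ∫⁻ y in Q, F (x + t • (y - x)) ≤
      2 ^ d * volume Q * ∫⁻ x, F x := by
    intro t ht
    have hconst : ∫⁻ _ in Q, 2 ^ d * ∫⁻ y, F y = 2 ^ d * volume Q * ∫⁻ x, F x := by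
      rw [lintegral_const, Measure.restrict_apply_univ]
      ring
    rw [← hconst]
    rcases le_total (1 / 2) t with h | h
    · refine lintegral_mono fun x => (lintegral_mono' Measure.restrict_le_self le_rfl).trans ?_
      have e : ∀ y, x + t • (y - x) = (x - t • x) + t • y := fun y => by
        rw [smul_sub]; abel
      simp only [e]
      rw [lintegral_comp_add_smul hF _ ht.1.ne']
      exact mul_le_mul' (ofReal_abs_inv_pow_le h) le_rfl
    · have hmt2 : Measurable fun p : Vec d × Vec d => F (p.1 + t • (p.2 - p.1)) :=
        hF.comp (by fun_prop)
      rw [lintegral_lintegral_swap (f := fun x y => F (x + t • (y - x))) hmt2.aemeasurable]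
      refine lintegral_mono fun y => (lintegral_mono' Measure.restrict_le_self le_rfl).trans ?_
      have e : ∀ x, x + t • (y - x) = t • y + (1 - t) • x := fun x => by
        rw [smul_sub, sub_smul, one_smul]; abel
      simp only [e]
      rw [lintegral_comp_add_smul hF _ (by linarith : (0 : ℝ) < 1 - t).ne']
      exact mul_le_mul' (ofReal_abs_inv_pow_le (by linarith)) le_rfl
  refine (setLIntegral_mono' measurableSet_Ioc hbound).trans_eq ?_
  simp

/-! ### Mollification of weakly differentiable functions -/

/-- A sequence of bump functions with shrinking supports. -/
def bump (d n : ℕ) : ContDiffBump (0 : Vec d) where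
  rIn := 1 / (2 * (n + 1))
  rOut := 1 / (n + 1)
  rIn_pos := by positivity
  rIn_lt_rOut := by
    rw [div_lt_div_iff₀ (by positivity) (by positivity)]
    have : (0 : ℝ) ≤ n := n.cast_nonneg
    linarith

lemma tendsto_bump_rOut (d : ℕ) : Tendsto (fun n => (bump d n).rOut) atTop (𝓝 0) :=
  tendsto_one_div_add_atTop_nhds_zero_nat

lemma bump_rOut_le (d n : ℕ) : (bump d n).rOut ≤ 2 * (bump d n).rIn := by
  simp only [bump]
  refine le_of_eq ?_
  field_simp

/-- The convolution of a function with a normalized bump function. -/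
def mollify (b : ContDiffBump (0 : Vec d)) (w : Vec d → ℝ) : Vec d → ℝ :=
  convolution (b.normed volume) w (ContinuousLinearMap.lsmul ℝ ℝ) volume

lemma contDiff_mollify (b : ContDiffBump (0 : Vec d)) {w : Vec d → ℝ}
    (hw : LocallyIntegrable w) : ContDiff ℝ ∞ (mollify b w) :=
  b.hasCompactSupport_normed.contDiff_convolution_left _ (b.contDiff_normed (n := ⊤)) hw

lemma gradient_comp_sub (φ : Vec d → ℝ) (hφ : Differentiable ℝ φ) (x t : Vec d) (i : Fin d) :
    gradient (fun t => φ (x - t)) t i = - fderiv ℝ φ (x - t) (EuclideanSpace.single i 1) := by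
  rw [gradient_apply_coord]
  have h1 : HasFDerivAt (fun t : Vec d => x - t) (-ContinuousLinearMap.id ℝ (Vec d)) t := by
    simpa using (hasFDerivAt_id t).const_sub x
  have h2 := (hφ (x - t)).hasFDerivAt.comp t h1
  have h3 : fderiv ℝ (fun t => φ (x - t)) t = _ := h2.fderiv
  rw [h3]
  simp

lemma isTest_normed_sub (b : ContDiffBump (0 : Vec d)) {Q : Set (Vec d)} {x : Vec d}
    (hx : Metric.closedBall x b.rOut ⊆ Q) : IsTest Q (fun t => b.normed volume (x - t)) := by
  have hsupp : Function.support (fun t => b.normed volume (x - t)) ⊆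
      Metric.closedBall x b.rOut := by
    intro t ht
    have : x - t ∈ Function.support (b.normed (volume : Measure (Vec d))) := ht
    rw [b.support_normed_eq, Metric.mem_ball, dist_zero_right] at this
    rw [Metric.mem_closedBall, dist_comm, dist_eq_norm]
    exact this.le
  have htsupp : tsupport (fun t => b.normed volume (x - t)) ⊆ Metric.closedBall x b.rOut :=
    closure_minimal hsupp Metric.isClosed_closedBall
  exact ⟨(b.contDiff_normed (n := ⊤)).comp (contDiff_const.sub contDiff_id),
    HasCompactSupport.of_support_subset_isCompact (isCompact_closedBall _ _) hsupp,
    htsupp.trans hx⟩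

lemma gradient_mollify_coord (b : ContDiffBump (0 : Vec d)) {Q : Set (Vec d)} (hQ : MeasurableSet Q)
    {w : Vec d → ℝ} {G : Vec d → Vec d} (h : HasWeakGradient Q w G)
    (hw : LocallyIntegrable (Q.indicator w)) {x : Vec d}
    (hx : Metric.closedBall x b.rOut ⊆ Q) (i : Fin d) :
    gradient (mollify b (Q.indicator w)) x i = ∫ t in Q, G t i * b.normed volume (x - t) := by
  have hc1 : ContDiff ℝ 1 (b.normed (volume : Measure (Vec d))) := b.contDiff_normed (n := 1)
  have h1 := b.hasCompactSupport_normed.hasFDerivAt_convolution_left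
    (ContinuousLinearMap.lsmul ℝ ℝ) hc1 hw x
  rw [gradient_apply_coord]
  have e1 : fderiv ℝ (mollify b (Q.indicator w)) x = _ := h1.fderiv
  rw [e1, convolution_eq_swap]
  have hint : Integrable (fun t => (ContinuousLinearMap.precompL (Vec d)
      (ContinuousLinearMap.lsmul ℝ ℝ)) (fderiv ℝ (b.normed (volume : Measure (Vec d))) (x - t))
      (Q.indicator w t)) := by
    have := ((b.hasCompactSupport_normed (μ := volume)).fderiv ℝ).convolutionExists_left
      (ContinuousLinearMap.precompL (Vec d) (ContinuousLinearMap.lsmul ℝ ℝ (E := ℝ)))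
      (hc1.continuous_fderiv (by norm_num)) hw x
    exact this.integrable_swap
  rw [ContinuousLinearMap.integral_apply hint]
  have e2 : ∀ t, ((ContinuousLinearMap.precompL (Vec d)
      (ContinuousLinearMap.lsmul ℝ ℝ)) (fderiv ℝ (b.normed (volume : Measure (Vec d))) (x - t))
      (Q.indicator w t)) (EuclideanSpace.single i 1) =
      Q.indicator (fun t => - (w t * gradient (fun t => b.normed volume (x - t)) t i)) t := by
    intro t
    by_cases ht : t ∈ Q
    · rw [indicator_of_mem ht, indicator_of_mem ht,
        gradient_comp_sub _ (hc1.differentiable (by norm_num))]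
      simp [mul_comm, ContinuousLinearMap.precompL_apply]
    · simp [ht]
  simp only [e2]
  rw [integral_indicator hQ, integral_neg, h _ (isTest_normed_sub b hx) i, neg_neg]

lemma lintegral_normed (b : ContDiffBump (0 : Vec d)) (x : Vec d) :
    ∫⁻ t, ‖b.normed volume (x - t)‖ₑ = 1 := by
  rw [lintegral_sub_left_eq_self (fun t => ‖b.normed volume t‖ₑ) x]
  have h : ∀ t, ‖b.normed (volume : Measure (Vec d)) t‖ₑ = ENNReal.ofReal (b.normed volume t) :=
    fun t => by rw [← ofReal_norm, Real.norm_of_nonneg (b.nonneg_normed t)]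
  simp only [h]
  rw [← ofReal_integral_eq_lintegral_ofReal b.integrable_normed
    (ae_of_all _ fun t => b.nonneg_normed t), b.integral_normed, ENNReal.ofReal_one]

lemma enorm_gradient_mollify_sq_le (b : ContDiffBump (0 : Vec d)) {Q : Set (Vec d)}
    (hQ : MeasurableSet Q)
    {w : Vec d → ℝ} {G : Vec d → Vec d} (h : HasWeakGradient Q w G)
    (hG : MemLp G 2 (volume.restrict Q))
    (hw : LocallyIntegrable (Q.indicator w)) {x : Vec d}
    (hx : Metric.closedBall x b.rOut ⊆ Q) :
    ‖gradient (mollify b (Q.indicator w)) x‖ₑ ^ 2 ≤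
      ∫⁻ t in Q, ‖b.normed volume (x - t)‖ₑ * ‖G t‖ₑ ^ 2 := by
  have hT := isTest_normed_sub b hx
  have hm : MemLp (fun t => b.normed volume (x - t)) 2 (volume.restrict Q) := hT.memLp 2 _
  have hint : Integrable (fun t => b.normed volume (x - t) • G t) (volume.restrict Q) :=
    (integrable_norm_mul_norm hm hG).mono' (hm.1.smul hG.1) (ae_of_all _ fun t => by
      rw [norm_smul])
  have e : gradient (mollify b (Q.indicator w)) x = ∫ t in Q, b.normed volume (x - t) • G t := by
    ext i
    rw [gradient_mollify_coord b hQ h hw hx]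
    have := (EuclideanSpace.proj (𝕜 := ℝ) (ι := Fin d) i).integral_comp_comm hint
    refine Eq.trans ?_ this
    refine integral_congr_ae (ae_of_all _ fun t => ?_)
    simp [mul_comm]
  have h1 : ‖gradient (mollify b (Q.indicator w)) x‖ₑ ≤
      ∫⁻ t in Q, ‖b.normed volume (x - t)‖ₑ * ‖G t‖ₑ := by
    rw [e]
    refine (enorm_integral_le_lintegral_enorm _).trans_eq ?_
    simp only [enorm_smul]
  refine (pow_le_pow_left₀ zero_le h1 2).trans ((lintegral_mul_sq_le hm.1.enorm hG.1.enorm).trans ?_)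
  refine (mul_le_mul' ?_ le_rfl).trans_eq (one_mul _)
  exact (lintegral_mono' Measure.restrict_le_self le_rfl).trans_eq (lintegral_normed b x)

/-- The points of `Q` with distance larger than `r` to the complement. -/
def shrink (Q : Set (Vec d)) (r : ℝ) : Set (Vec d) := (Metric.cthickening r Qᶜ)ᶜ

lemma isOpen_shrink (Q : Set (Vec d)) (r : ℝ) : IsOpen (shrink Q r) :=
  Metric.isClosed_cthickening.isOpen_compl

lemma mem_shrink_iff {Q : Set (Vec d)} (hQ : IsOpen Q) {r : ℝ} (hr : 0 ≤ r) {x : Vec d} :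
    x ∈ shrink Q r ↔ Metric.closedBall x r ⊆ Q := by
  rw [shrink, hQ.isClosed_compl.cthickening_eq_biUnion_closedBall hr, mem_compl_iff, mem_iUnion₂]
  constructor
  · intro h y hy
    by_contra hn
    exact h ⟨y, hn, by rwa [Metric.mem_closedBall, dist_comm]⟩
  · rintro h ⟨y, hy, hxy⟩
    exact hy (h (by rwa [Metric.mem_closedBall, dist_comm] at hxy))

lemma shrink_subset {Q : Set (Vec d)} (hQ : IsOpen Q) {r : ℝ} (hr : 0 ≤ r) : shrink Q r ⊆ Q :=
  fun _ hx => (mem_shrink_iff hQ hr).1 hx (Metric.mem_closedBall_self hr)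

lemma convex_shrink {Q : Set (Vec d)} (hQ : IsOpen Q) (hc : Convex ℝ Q) {r : ℝ} (hr : 0 ≤ r) :
    Convex ℝ (shrink Q r) := by
  intro x hx y hy a b ha hb hab
  rw [mem_shrink_iff hQ hr] at hx hy ⊢
  intro z hz
  have hz' : ‖z - (a • x + b • y)‖ ≤ r := by rwa [Metric.mem_closedBall, dist_eq_norm] at hz
  have e : z = a • (x + (z - (a • x + b • y))) + b • (y + (z - (a • x + b • y))) := by
    rw [smul_add, smul_add, add_add_add_comm, ← add_smul, hab, one_smul]
    abel
  rw [e]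
  refine hc (hx ?_) (hy ?_) ha hb hab <;> simpa [Metric.mem_closedBall, dist_eq_norm] using hz'

lemma eventually_mem_shrink {Q : Set (Vec d)} (hQ : IsOpen Q) {x : Vec d} (hx : x ∈ Q)
    {r : ℕ → ℝ} (hr : Tendsto r atTop (𝓝 0)) (hr0 : ∀ n, 0 ≤ r n) :
    ∀ᶠ n in atTop, x ∈ shrink Q (r n) := by
  obtain ⟨ε, hε, h⟩ := Metric.isOpen_iff.1 hQ x hx
  filter_upwards [hr.eventually_lt_const hε] with n hn
  exact (mem_shrink_iff hQ (hr0 n)).2 ((Metric.closedBall_subset_ball hn).trans h)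

/-- The Poincaré inequality on a convex set, in terms of differences. -/
lemma MemH1.lintegral_sub_sq_le {Q : Set (Vec d)} (hQ : IsOpen Q) (hc : Convex ℝ Q)
    (hQb : Bornology.IsBounded Q) {w : Vec d → ℝ} {G : Vec d → Vec d} (h : MemH1 Q w G)
    {D : ENNReal} (hD : ∀ x ∈ Q, ∀ y ∈ Q, ‖y - x‖ₑ ≤ D) :
    ∫⁻ p in Q ×ˢ Q, ‖w p.1 - w p.2‖ₑ ^ 2 ∂((volume : Measure (Vec d)).prod volume) ≤
      D ^ 2 * (2 ^ d * volume Q * ∫⁻ x in Q, ‖G x‖ₑ ^ 2) := by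
  set W : Vec d → ℝ := Q.indicator w with hW
  have hWint : Integrable W :=
    (integrable_indicator_iff hQ.measurableSet).2 (integrable_of_memLp_restrict hQb h.1)
  have hWl := hWint.locallyIntegrable
  set f : ℕ → Vec d → ℝ := fun n => mollify (bump d n) W
  have hf : ∀ n, ContDiff ℝ 1 (f n) := fun n =>
    (contDiff_mollify _ hWl).of_le (by exact_mod_cast le_top)
  have hr0 : ∀ n, 0 ≤ (bump d n).rOut := fun n => (bump d n).rOut_pos.le
  set q : ℕ → Set (Vec d) := fun n => shrink Q (bump d n).rOut
  have hqm : ∀ n, MeasurableSet (q n) := fun n => (isOpen_shrink _ _).measurableSet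
  have hqQ : ∀ n, q n ⊆ Q := fun n => shrink_subset hQ (hr0 n)
  set g : ℕ → Vec d × Vec d → ENNReal := fun n =>
    (q n ×ˢ q n).indicator fun p => ‖f n p.1 - f n p.2‖ₑ ^ 2
  have hgm0 : ∀ n, Measurable fun p : Vec d × Vec d => ‖f n p.1 - f n p.2‖ₑ ^ 2 := fun n => by
    have := (hf n).continuous.measurable
    fun_prop
  have hgm : ∀ n, Measurable (g n) := fun n => (hgm0 n).indicator ((hqm n).prod (hqm n))
  have hgrad : ∀ n, ∫⁻ x in q n, ‖gradient (f n) x‖ₑ ^ 2 ≤ ∫⁻ x in Q, ‖G x‖ₑ ^ 2 := by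
    intro n
    have hbm : Continuous ((bump d n).normed (volume : Measure (Vec d))) :=
      (bump d n).continuous_normed
    calc ∫⁻ x in q n, ‖gradient (f n) x‖ₑ ^ 2
        ≤ ∫⁻ x in q n, ∫⁻ t in Q, ‖(bump d n).normed volume (x - t)‖ₑ * ‖G t‖ₑ ^ 2 :=
          setLIntegral_mono' (hqm n) fun x hx => enorm_gradient_mollify_sq_le _ hQ.measurableSet
            h.2.2 h.2.1 hWl ((mem_shrink_iff hQ (hr0 n)).1 hx)
      _ ≤ ∫⁻ x, ∫⁻ t in Q, ‖(bump d n).normed volume (x - t)‖ₑ * ‖G t‖ₑ ^ 2 :=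
          lintegral_mono' Measure.restrict_le_self le_rfl
      _ = ∫⁻ t in Q, ∫⁻ x, ‖(bump d n).normed volume (x - t)‖ₑ * ‖G t‖ₑ ^ 2 := by
          refine lintegral_lintegral_swap ?_
          have m1 : Measurable fun p : Vec d × Vec d =>
              ‖(bump d n).normed volume (p.1 - p.2)‖ₑ :=
            (Continuous.measurable (by fun_prop)).enorm
          exact m1.aemeasurable.mul ((h.2.1.1.enorm.pow_const 2).comp_snd)
      _ = ∫⁻ t in Q, ‖G t‖ₑ ^ 2 := by
          refine lintegral_congr fun t => ?_
          rw [lintegral_mul_const _ (Continuous.measurable (by fun_prop)).enorm]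
          have e : ∫⁻ x, ‖(bump d n).normed volume (x - t)‖ₑ = 1 := by
            rw [← lintegral_normed (bump d n) 0,
              lintegral_sub_right_eq_self (fun x => ‖(bump d n).normed volume x‖ₑ) t,
              lintegral_sub_left_eq_self (fun x => ‖(bump d n).normed volume x‖ₑ) 0]
          rw [e, one_mul]
  have hgle : ∀ n, ∫⁻ p, g n p ∂((volume : Measure (Vec d)).prod volume) ≤
      D ^ 2 * (2 ^ d * volume Q * ∫⁻ x in Q, ‖G x‖ₑ ^ 2) := by
    intro n
    rw [lintegral_indicator ((hqm n).prod (hqm n)), ← Measure.prod_restrict,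
      lintegral_prod _ (hgm0 n).aemeasurable]
    refine (lintegral_sub_sq_le_of_contDiff (hf n) (hqm n) (convex_shrink hQ hc (hr0 n))
      fun x hx y hy => hD x (hqQ n hx) y (hqQ n hy)).trans ?_
    exact mul_le_mul' le_rfl (mul_le_mul' (mul_le_mul' le_rfl (measure_mono (hqQ n))) (hgrad n))
  have hae : ∀ᵐ x, Tendsto (fun n => f n x) atTop (𝓝 (W x)) :=
    ContDiffBump.ae_convolution_tendsto_right_of_locallyIntegrable (tendsto_bump_rOut d)
      (Eventually.of_forall (bump_rOut_le d)) hWl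
  have hlim : ∀ᵐ p ∂((volume : Measure (Vec d)).prod volume),
      p ∈ Q ×ˢ Q → ‖w p.1 - w p.2‖ₑ ^ 2 = liminf (fun n => g n p) atTop := by
    filter_upwards [Measure.quasiMeasurePreserving_fst.ae hae,
      Measure.quasiMeasurePreserving_snd.ae hae] with p h1 h2 hp
    refine (Tendsto.liminf_eq ?_).symm
    have h3 : Tendsto (fun n => ‖f n p.1 - f n p.2‖ₑ ^ 2) atTop (𝓝 (‖W p.1 - W p.2‖ₑ ^ 2)) :=
      (((ENNReal.continuous_pow 2).comp continuous_enorm).tendsto _).comp (h1.sub h2)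
    rw [hW, indicator_of_mem hp.1, indicator_of_mem hp.2] at h3
    refine h3.congr' ?_
    filter_upwards [eventually_mem_shrink hQ hp.1 (tendsto_bump_rOut d) hr0,
      eventually_mem_shrink hQ hp.2 (tendsto_bump_rOut d) hr0] with n a1 a2
    have a3 : p ∈ q n ×ˢ q n := mk_mem_prod a1 a2
    simp only [g, indicator_of_mem a3]
  have hQQ : MeasurableSet (Q ×ˢ Q) := hQ.measurableSet.prod hQ.measurableSet
  rw [setLIntegral_congr_fun_ae hQQ hlim]
  calc _ ≤ ∫⁻ p, liminf (fun n => g n p) atTop ∂((volume : Measure (Vec d)).prod volume) :=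
        lintegral_mono' Measure.restrict_le_self le_rfl
    _ ≤ liminf (fun n => ∫⁻ p, g n p ∂((volume : Measure (Vec d)).prod volume)) atTop :=
        lintegral_liminf_le hgm
    _ ≤ _ := liminf_le_of_le (by isBoundedDefault) fun b hb => by
        obtain ⟨n, hn⟩ := hb.exists
        exact hn.trans (hgle n)

/-- The Poincaré inequality on a convex set. -/
lemma MemH1.exists_integral_sub_sq_le {Q : Set (Vec d)} (hQ : IsOpen Q) (hc : Convex ℝ Q)
    (hQb : Bornology.IsBounded Q) (hne : Q.Nonempty) {w : Vec d → ℝ} {G : Vec d → Vec d}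
    (h : MemH1 Q w G) {D : ℝ} (hD : ∀ x ∈ Q, ∀ y ∈ Q, ‖y - x‖ ≤ D) :
    ∃ a : ℝ, ∫ x in Q, ‖w x - a‖ ^ 2 ≤ 2 ^ d * D ^ 2 * ∫ x in Q, ‖G x‖ ^ 2 := by
  have hD0 : 0 ≤ D := by
    obtain ⟨x, hx⟩ := hne
    exact (norm_nonneg _).trans (hD x hx x hx)
  have h1 := h.lintegral_sub_sq_le hQ hc hQb (D := ENNReal.ofReal D) fun x hx y hy => by
    rw [← ofReal_norm]
    exact ENNReal.ofReal_le_ofReal (hD x hx y hy)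
  have hmw := h.1.1
  have hm : AEMeasurable (fun p : Vec d × Vec d => ‖w p.1 - w p.2‖ₑ ^ 2)
      ((volume.restrict Q).prod (volume.restrict Q)) :=
    ((hmw.comp_fst.sub hmw.comp_snd).enorm).pow_const 2
  rw [← Measure.prod_restrict, lintegral_prod _ hm] at h1
  have hpos : volume Q ≠ 0 := (hQ.measure_pos volume hne).ne'
  have hfin : volume Q ≠ ⊤ := hQb.measure_lt_top.ne
  obtain ⟨x, -, hx⟩ := exists_le_setLAverage hpos hfin (hm.lintegral_prod_right')
  refine ⟨w x, ?_⟩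
  rw [setLAverage_eq] at hx
  have h2 : ∫⁻ y in Q, ‖w x - w y‖ₑ ^ 2 ≤
      ENNReal.ofReal D ^ 2 * (2 ^ d * ∫⁻ x in Q, ‖G x‖ₑ ^ 2) := by
    refine hx.trans ((ENNReal.div_le_div_right h1 _).trans_eq ?_)
    rw [ENNReal.div_eq_inv_mul]
    have : ENNReal.ofReal D ^ 2 * (2 ^ d * volume Q * ∫⁻ x in Q, ‖G x‖ₑ ^ 2) =
      volume Q * (ENNReal.ofReal D ^ 2 * (2 ^ d * ∫⁻ x in Q, ‖G x‖ₑ ^ 2)) := by ring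
    rw [this, ← mul_assoc, ENNReal.inv_mul_cancel hpos hfin, one_mul]
  have hmem : MemLp (fun y => w y - w x) 2 (volume.restrict Q) :=
    h.1.sub (memLp_const_restrict hQb _)
  have e : ∫⁻ y in Q, ‖w x - w y‖ₑ ^ 2 = ∫⁻ y in Q, ‖w y - w x‖ₑ ^ 2 :=
    lintegral_congr fun y => by rw [← enorm_neg, neg_sub]
  have h2d : (2 : ENNReal) ^ d = ENNReal.ofReal (2 ^ d) := by
    rw [ENNReal.ofReal_pow (by norm_num), ENNReal.ofReal_ofNat]
  rw [e, lintegral_enorm_sq hmem, lintegral_enorm_sq h.2.1, ← ENNReal.ofReal_pow hD0,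
    h2d, ← ENNReal.ofReal_mul (by positivity), ← ENNReal.ofReal_mul (by positivity)] at h2
  have h3 := (ENNReal.ofReal_le_ofReal_iff (mul_nonneg (by positivity)
    (mul_nonneg (by positivity) (integral_norm_sq_nonneg _)))).1 h2
  calc _ ≤ _ := h3
    _ = _ := by ring

/-! ### Functions in `H_0^1` near a boundary point of a convex domain -/

/-- The time at which the line `t ↦ y - t v` leaves `Q`. -/
def exitTime (Q : Set (Vec d)) (v y : Vec d) : ℝ :=
  sSup {t : ℝ | 0 ≤ t ∧ y - t • v ∈ Q}

lemma lt_two_of_sub_smul_mem {Ω : Set (Vec d)} (hΩc : Convex ℝ Ω) {p c : Vec d} {s : ℝ}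
    (hp : p ∉ Ω) (hB : Metric.ball c s ⊆ Ω)
    {y : Vec d} (hy : y ∈ Metric.ball c s) {t : ℝ}
    (h : y - t • (c - p) ∈ Ω) : t < 2 := by
  by_contra! h2
  have ht0 : 0 < t := by linarith
  have h3 : y - (2 : ℝ) • (c - p) ∈ Ω := by
    have := hΩc.add_smul_sub_mem (hB hy) h (t := 2 / t) ⟨by positivity, by
      rw [div_le_one ht0]; exact h2⟩
    convert this using 1
    rw [sub_sub_cancel_left, smul_neg, smul_smul, div_mul_cancel₀ _ ht0.ne', sub_eq_add_neg]
  have h4 : (2 : ℝ) • c - y ∈ Ω := by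
    refine hB ?_
    rw [Metric.mem_ball, dist_eq_norm] at hy ⊢
    rw [two_smul, add_sub_right_comm, add_sub_cancel_right, ← norm_neg, neg_sub]
    exact hy
  have h5 := hΩc h3 h4 (a := 1 / 2) (b := 1 / 2) (by norm_num) (by norm_num) (by norm_num)
  apply hp
  convert h5 using 1
  module

lemma bddAbove_exit {Ω : Set (Vec d)} (hΩc : Convex ℝ Ω) {p c : Vec d} {s : ℝ}
    (hp : p ∉ Ω) (hB : Metric.ball c s ⊆ Ω)
    {y : Vec d} (hy : y ∈ Metric.ball c s) :
    BddAbove {t : ℝ | 0 ≤ t ∧ y - t • (c - p) ∈ Ω} :=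
  ⟨2, fun _ ht => (lt_two_of_sub_smul_mem hΩc hp hB hy ht.2).le⟩

lemma zero_mem_exit {Ω : Set (Vec d)} {p c : Vec d} {s : ℝ}
    (hB : Metric.ball c s ⊆ Ω)
    {y : Vec d} (hy : y ∈ Metric.ball c s) :
    (0 : ℝ) ∈ {t : ℝ | 0 ≤ t ∧ y - t • (c - p) ∈ Ω} := ⟨le_rfl, by simpa using hB hy⟩

lemma exitTime_nonneg {Ω : Set (Vec d)} (hΩc : Convex ℝ Ω) {p c : Vec d} {s : ℝ}
    (hp : p ∉ Ω) (hB : Metric.ball c s ⊆ Ω)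
    {y : Vec d} (hy : y ∈ Metric.ball c s) : 0 ≤ exitTime Ω (c - p) y :=
  le_csSup (bddAbove_exit hΩc hp hB hy) (zero_mem_exit hB hy)

lemma exitTime_le_two {Ω : Set (Vec d)} (hΩc : Convex ℝ Ω) {p c : Vec d} {s : ℝ}
    (hp : p ∉ Ω) (hB : Metric.ball c s ⊆ Ω)
    {y : Vec d} (hy : y ∈ Metric.ball c s) : exitTime Ω (c - p) y ≤ 2 :=
  csSup_le ⟨0, zero_mem_exit hB hy⟩
    fun _ ht => (lt_two_of_sub_smul_mem hΩc hp hB hy ht.2).le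

lemma mem_of_lt_exitTime {Ω : Set (Vec d)} (hΩc : Convex ℝ Ω) {p c : Vec d} {s : ℝ}
    (hB : Metric.ball c s ⊆ Ω)
    {y : Vec d} (hy : y ∈ Metric.ball c s) {t : ℝ} (ht : 0 ≤ t)
    (h : t < exitTime Ω (c - p) y) : y - t • (c - p) ∈ Ω := by
  obtain ⟨t', ht', hlt⟩ := exists_lt_of_lt_csSup ⟨0, zero_mem_exit (p := p) hB hy⟩ h
  have ht0 : 0 < t' := ht.trans_lt hlt
  have := hΩc.add_smul_sub_mem (hB hy) ht'.2 (t := t / t') ⟨by positivity, by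
      rw [div_le_one ht0]; exact hlt.le⟩
  convert this using 1
  rw [sub_sub_cancel_left, smul_neg, smul_smul, div_mul_cancel₀ _ ht0.ne', sub_eq_add_neg]

lemma exit_notMem {Ω : Set (Vec d)} (hΩo : IsOpen Ω) (hΩc : Convex ℝ Ω) {p c : Vec d} {s : ℝ}
    (hp : p ∉ Ω) (hB : Metric.ball c s ⊆ Ω)
    {y : Vec d} (hy : y ∈ Metric.ball c s) :
    y - exitTime Ω (c - p) y • (c - p) ∉ Ω := by
  intro h
  have hcont : Continuous fun t : ℝ => y - t • (c - p) := by fun_prop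
  obtain ⟨ε, hε, hsub⟩ := Metric.isOpen_iff.1 (hΩo.preimage hcont) _ h
  have h1 : exitTime Ω (c - p) y + ε / 2 ∈ (fun t : ℝ => y - t • (c - p)) ⁻¹' Ω := hsub (by
    rw [Metric.mem_ball, Real.dist_eq, add_sub_cancel_left, abs_of_pos (by linarith)]
    linarith)
  have h2 := le_csSup (bddAbove_exit hΩc hp hB hy)
    ⟨by have := exitTime_nonneg hΩc hp hB hy; linarith, h1⟩
  have : exitTime Ω (c - p) y + ε / 2 ≤ exitTime Ω (c - p) y := h2
  linarith

lemma exitTime_midpoint {Ω : Set (Vec d)} (hΩc : Convex ℝ Ω) {p c : Vec d} {s : ℝ}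
    (hp : p ∉ Ω) (hB : Metric.ball c s ⊆ Ω)
    {y z : Vec d} (hy : y ∈ Metric.ball c s) (hz : z ∈ Metric.ball c s)
    {m : Vec d} (hm : m ∈ Metric.ball c s) (h : m = (1 / 2 : ℝ) • y + (1 / 2 : ℝ) • z) :
    (exitTime Ω (c - p) y + exitTime Ω (c - p) z) / 2 ≤ exitTime Ω (c - p) m := by
  by_contra! hlt
  set ε := (exitTime Ω (c - p) y + exitTime Ω (c - p) z) / 2 - exitTime Ω (c - p) m
  have hε : 0 < ε := by simp only [ε]; linarith
  obtain ⟨t, ht, h1⟩ := exists_lt_of_lt_csSup ⟨0, zero_mem_exit (p := p) hB hy⟩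
    (sub_lt_self (exitTime Ω (c - p) y) hε)
  obtain ⟨t', ht', h2⟩ := exists_lt_of_lt_csSup ⟨0, zero_mem_exit (p := p) hB hz⟩
    (sub_lt_self (exitTime Ω (c - p) z) hε)
  have h3 := hΩc ht.2 ht'.2 (a := 1 / 2) (b := 1 / 2) (by norm_num) (by norm_num) (by norm_num)
  have h4 : m - ((t + t') / 2) • (c - p) ∈ Ω := by
    convert h3 using 1
    rw [h]
    module
  have h5 : (t + t') / 2 ≤ exitTime Ω (c - p) m :=
    le_csSup (bddAbove_exit hΩc hp hB hm) ⟨by linarith [ht.1, ht'.1], h4⟩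
  simp only [ε] at h1 h2
  linarith

lemma exitTime_center {Ω : Set (Vec d)} (hΩo : IsOpen Ω) (hΩc : Convex ℝ Ω) {p c : Vec d} {s : ℝ}
    (hp : p ∉ Ω) (hB : Metric.ball c s ⊆ Ω)
    (hs : 0 < s) (hpc : p ∈ closure Ω) : exitTime Ω (c - p) c = 1 := by
  have hc : c ∈ Metric.ball c s := Metric.mem_ball_self hs
  refine le_antisymm ?_ ?_
  · by_contra! h
    have := mem_of_lt_exitTime hΩc hB hc zero_le_one h
    rw [one_smul, sub_sub_cancel] at this
    exact hp this
  · refine le_of_forall_lt fun t ht => ?_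
    by_contra! h
    have ht0 := (exitTime_nonneg hΩc hp hB hc).trans h
    refine exit_notMem hΩo hΩc hp hB hc ?_
    set t' := exitTime Ω (c - p) c
    have ht1 : 0 ≤ t' := exitTime_nonneg hΩc hp hB hc
    have : c - t' • (c - p) ∈ interior Ω := by
      have := hΩc.combo_interior_closure_mem_interior (hΩo.interior_eq.symm ▸ hB hc) hpc
        (a := 1 - t') (b := t') (by linarith) ht1 (by ring)
      convert this using 1
      module
    exact interior_subset this

/-- An affine function at a boundary point is controlled by its values at three exit points. -/
lemma abs_le_exit_values {Ω : Set (Vec d)} (hΩo : IsOpen Ω) (hΩc : Convex ℝ Ω) {p c : Vec d} {s : ℝ}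
    (hp : p ∉ Ω) (hB : Metric.ball c s ⊆ Ω)
    (hs : 0 < s) (hpc : p ∈ closure Ω) (a : ℝ) (g : Vec d) {y : Vec d}
    (hy : y ∈ Metric.ball c s) :
    let q : Vec d → ℝ := fun y =>
      a + inner ℝ g (y - exitTime Ω (c - p) y • (c - p) - p)
    |a| ≤ |q y| + |q ((2 : ℝ) • c - y)| + 2 * |q ((1 / 2 : ℝ) • c + (1 / 2 : ℝ) • y)| := by
  intro q
  have hc : c ∈ Metric.ball c s := Metric.mem_ball_self hs
  have hy2 : (2 : ℝ) • c - y ∈ Metric.ball c s := by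
    rw [Metric.mem_ball, dist_eq_norm] at hy ⊢
    rw [two_smul, add_sub_right_comm, add_sub_cancel_right, ← norm_neg, neg_sub]
    exact hy
  have hy3 : (1 / 2 : ℝ) • c + (1 / 2 : ℝ) • y ∈ Metric.ball c s :=
    convex_ball c s hc hy (by norm_num) (by norm_num) (by norm_num)
  have e := exitTime_center hΩo hΩc hp hB hs hpc
  have h1 := exitTime_midpoint hΩc hp hB hy hy2 hc (by module)
  have h2 := exitTime_midpoint hΩc hp hB hc hy hy3 rfl
  rw [e] at h1 h2
  have hq : ∀ z, q z = a + inner ℝ g (z - p) - exitTime Ω (c - p) z * inner ℝ g (c - p) := by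
    intro z
    simp only [q]
    rw [sub_right_comm, inner_sub_right, real_inner_smul_right]
    ring
  rw [hq, hq, hq]
  have e2 : inner ℝ g ((2 : ℝ) • c - y - p) = 2 * inner ℝ g (c - p) - inner ℝ g (y - p) := by
    rw [← real_inner_smul_right, ← inner_sub_right]
    congr 1
    module
  have e3 : inner ℝ g ((1 / 2 : ℝ) • c + (1 / 2 : ℝ) • y - p) =
      1 / 2 * inner ℝ g (c - p) + 1 / 2 * inner ℝ g (y - p) := by
    rw [← real_inner_smul_right, ← real_inner_smul_right, ← inner_add_right]
    congr 1
    module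
  rw [e2, e3]
  set k := inner ℝ g (c - p)
  set l := inner ℝ g (y - p)
  set t1 := exitTime Ω (c - p) y
  set t2 := exitTime Ω (c - p) ((2 : ℝ) • c - y)
  set t3 := exitTime Ω (c - p) ((1 / 2 : ℝ) • c + (1 / 2 : ℝ) • y)
  have b1 := neg_abs_le (a + l - t1 * k)
  have b2 := le_abs_self (a + l - t1 * k)
  have b3 := neg_abs_le (a + (2 * k - l) - t2 * k)
  have b4 := le_abs_self (a + (2 * k - l) - t2 * k)
  have b5 := neg_abs_le (a + (1 / 2 * k + 1 / 2 * l) - t3 * k)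
  have b6 := le_abs_self (a + (1 / 2 * k + 1 / 2 * l) - t3 * k)
  have n1 := abs_nonneg (a + l - t1 * k)
  have n2 := abs_nonneg (a + (2 * k - l) - t2 * k)
  have n3 := abs_nonneg (a + (1 / 2 * k + 1 / 2 * l) - t3 * k)
  rcases le_total 0 k with hk | hk
  · have c1 := mul_nonneg (sub_nonneg.2 h1) hk
    have c2 := mul_nonneg (sub_nonneg.2 h2) hk
    rw [abs_le]
    constructor <;> linarith
  · have c1 := mul_nonneg (sub_nonneg.2 h1) (neg_nonneg.2 hk)
    have c2 := mul_nonneg (sub_nonneg.2 h2) (neg_nonneg.2 hk)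
    rw [abs_le]
    constructor <;> linarith

lemma enorm_add_sq_le (a b : ℝ) : ‖a + b‖ₑ ^ 2 ≤ 2 * ‖a‖ₑ ^ 2 + 2 * ‖b‖ₑ ^ 2 := by
  simp only [← ofReal_norm, Real.norm_eq_abs]
  rw [← ENNReal.ofReal_ofNat, ← ENNReal.ofReal_pow (abs_nonneg _),
    ← ENNReal.ofReal_pow (abs_nonneg _), ← ENNReal.ofReal_pow (abs_nonneg _),
    ← ENNReal.ofReal_mul (by norm_num), ← ENNReal.ofReal_mul (by norm_num),
    ← ENNReal.ofReal_add (by positivity) (by positivity)]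
  refine ENNReal.ofReal_le_ofReal ?_
  simp only [sq_abs]
  nlinarith [sq_nonneg (a - b)]

lemma enorm_sq_le_of_abs_le {a x y z : ℝ} (h : |a| ≤ |x| + |y| + 2 * |z|) :
    ‖a‖ₑ ^ 2 ≤ 3 * ‖x‖ₑ ^ 2 + 3 * ‖y‖ₑ ^ 2 + 12 * ‖z‖ₑ ^ 2 := by
  simp only [← ofReal_norm, Real.norm_eq_abs]
  rw [← ENNReal.ofReal_ofNat 3, ← ENNReal.ofReal_ofNat 12, ← ENNReal.ofReal_pow (abs_nonneg _),
    ← ENNReal.ofReal_pow (abs_nonneg _), ← ENNReal.ofReal_pow (abs_nonneg _),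
    ← ENNReal.ofReal_pow (abs_nonneg _),
    ← ENNReal.ofReal_mul (by norm_num), ← ENNReal.ofReal_mul (by norm_num),
    ← ENNReal.ofReal_mul (by norm_num),
    ← ENNReal.ofReal_add (by positivity) (by positivity),
    ← ENNReal.ofReal_add (by positivity) (by positivity)]
  refine ENNReal.ofReal_le_ofReal ?_
  have h0 := abs_nonneg a
  have h2 : |a| ^ 2 ≤ (|x| + |y| + 2 * |z|) ^ 2 := pow_le_pow_left₀ h0 h 2
  nlinarith [sq_nonneg (|x| - |y|), sq_nonneg (|x| - 2 * |z|), sq_nonneg (|y| - 2 * |z|)]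

lemma setLIntegral_comp_add_smul_le {F : Vec d → ENNReal} (hF : Measurable F) {B : Set (Vec d)}
    (hB : MeasurableSet B) (a : Vec d) {t : ℝ} (ht : t ≠ 0) (hmaps : ∀ y ∈ B, a + t • y ∈ B) :
    ∫⁻ y in B, F (a + t • y) ≤ ENNReal.ofReal |(t ^ d)⁻¹| * ∫⁻ y in B, F y := by
  rw [← lintegral_indicator hB F, ← lintegral_comp_add_smul (hF.indicator hB) a ht]
  refine le_trans (setLIntegral_mono' hB fun y hy => ?_)
    (lintegral_mono' (Measure.restrict_le_self (s := B)) le_rfl)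
  rw [indicator_of_mem (hmaps y hy)]

/-- An affine function that approximates a test function near a boundary point is small at this
point. -/
lemma IsTest.boundary_value_le {Ω : Set (Vec d)} (hΩo : IsOpen Ω) (hΩc : Convex ℝ Ω)
    {p c : Vec d} {s r : ℝ} (hs : 0 < s) (hp : p ∉ Ω) (hpc : p ∈ closure Ω)
    (hB : Metric.ball c s ⊆ Ω ∩ Metric.ball p r) {φ : Vec d → ℝ} (hφ : IsTest Ω φ)
    (a : ℝ) (g : Vec d) :
    a ^ 2 * volume.real (Metric.ball c s) ≤ (6 + 12 * 2 ^ d) *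
      (2 * (∫ x in Ω ∩ Metric.ball p r, ‖φ x - (a + inner ℝ g (x - p))‖ ^ 2)
        + 8 * r ^ 2 * ∫ x in Ω ∩ Metric.ball p r, ‖gradient φ x - g‖ ^ 2) := by
  set Q := Ω ∩ Metric.ball p r with hQdef
  set B := Metric.ball c s with hBdef
  have hQo : IsOpen Q := hΩo.inter Metric.isOpen_ball
  have hQb : Bornology.IsBounded Q := Metric.isBounded_ball.subset inter_subset_right
  have hBΩ : B ⊆ Ω := hB.trans inter_subset_left
  have hBm : MeasurableSet B := measurableSet_ball
  set v := c - p with hv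
  have hvr : ‖v‖ ≤ r := by
    have := (hB (Metric.mem_ball_self hs)).2
    rw [Metric.mem_ball, dist_eq_norm] at this
    exact this.le
  have hr : 0 ≤ r := (norm_nonneg _).trans hvr
  set ψ : Vec d → ℝ := fun x => φ x - (a + inner ℝ g (x - p)) with hψdef
  have hψ : ContDiff ℝ 1 ψ := hφ.contDiff_one.sub (contDiff_affine a g p)
  have hgψ : ∀ x, gradient ψ x = gradient φ x - g := by
    intro x
    refine HasGradientAt.gradient ?_
    have h1 := (hφ.differentiable x).hasGradientAt
    have h2 := hasGradientAt_affine a g p x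
    rw [hasGradientAt_iff_hasFDerivAt] at h1 h2 ⊢
    rw [map_sub]
    exact h1.sub h2
  have hF0m : Measurable (Q.indicator fun x => ‖ψ x‖ₑ ^ 2) :=
    (hψ.continuous.measurable.enorm.pow_const 2).indicator hQo.measurableSet
  have hF1m : Measurable (Q.indicator fun x => ‖gradient ψ x‖ₑ ^ 2) :=
    ((continuous_gradient hψ).measurable.enorm.pow_const 2).indicator hQo.measurableSet
  set F0 := Q.indicator fun x => ‖ψ x‖ₑ ^ 2 with hF0
  set F1 := Q.indicator fun x => ‖gradient ψ x‖ₑ ^ 2 with hF1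
  have hF0i : ∫⁻ x, F0 x = ∫⁻ x in Q, ‖ψ x‖ₑ ^ 2 := lintegral_indicator hQo.measurableSet _
  have hF1i : ∫⁻ x, F1 x = ∫⁻ x in Q, ‖gradient ψ x‖ₑ ^ 2 :=
    lintegral_indicator hQo.measurableSet _
  have hline : Measurable fun x : Vec d × ℝ => F1 (x.1 + x.2 • (-v)) :=
    hF1m.comp (by fun_prop)
  set N : Vec d → ENNReal := fun y =>
    2 * F0 y + 2 * (2 * (‖v‖ₑ ^ 2 * ∫⁻ t in Ioc (0 : ℝ) 2, F1 (y + t • (-v)))) with hN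
  have hlm : Measurable fun y : Vec d => ∫⁻ t in Ioc (0 : ℝ) 2, F1 (y + t • (-v)) :=
    hline.lintegral_prod_right'
  have hNm : Measurable N := by fun_prop
  have hpath : ∀ y ∈ B, ‖a + inner ℝ g (y - exitTime Ω (c - p) y • (c - p) - p)‖ₑ ^ 2 ≤ N y := by
    intro y hy
    set τ := exitTime Ω (c - p) y
    have hτ0 : 0 ≤ τ := exitTime_nonneg hΩc hp hBΩ hy
    have hτ2 : τ ≤ 2 := exitTime_le_two hΩc hp hBΩ hy
    have hcont : Continuous fun t : ℝ => gradient ψ (y + t • (-v)) :=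
      (continuous_gradient hψ).comp (by fun_prop)
    have h1 := enorm_sub_sq_le_lintegral (hasDerivAt_comp_line hψ y (-v))
      (hcont.inner continuous_const) hτ0
    simp only [zero_smul, add_zero] at h1
    have h2 : ψ (y + τ • (-v)) = - (a + inner ℝ g (y - τ • (c - p) - p)) := by
      have hex : y - τ • (c - p) ∉ Ω := exit_notMem hΩo hΩc hp hBΩ hy
      have e : y + τ • (-v) = y - τ • (c - p) := by rw [smul_neg, sub_eq_add_neg]
      simp only [hψdef]
      rw [e, image_eq_zero_of_notMem_tsupport fun hn => hex (hφ.2.2 hn), zero_sub]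
    have h3 : ‖a + inner ℝ g (y - τ • (c - p) - p)‖ₑ ^ 2 =
        ‖ψ y + (ψ (y + τ • (-v)) - ψ y)‖ₑ ^ 2 := by
      rw [add_sub_cancel, h2, enorm_neg]
    rw [h3]
    refine (enorm_add_sq_le _ _).trans ?_
    have hyF : ‖ψ y‖ₑ ^ 2 = F0 y := by rw [hF0, indicator_of_mem (hB hy)]
    rw [hyF]
    refine add_le_add le_rfl (mul_le_mul' le_rfl (h1.trans ?_))
    refine mul_le_mul' ((ENNReal.ofReal_le_ofReal hτ2).trans_eq (by simp)) ?_
    rw [← lintegral_const_mul' _ _ (ENNReal.pow_ne_top enorm_ne_top)]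
    rw [← setLIntegral_congr (Ioo_ae_eq_Ioc (a := (0 : ℝ)) (b := τ))]
    refine le_trans (setLIntegral_mono' measurableSet_Ioo fun t ht => ?_)
      (lintegral_mono_set (fun t ht => (⟨ht.1, ht.2.le.trans hτ2⟩ : t ∈ Ioc (0 : ℝ) 2)))
    have hmem : y + t • (-v) ∈ Q := by
      have e : y + t • (-v) = y - t • (c - p) := by rw [smul_neg, sub_eq_add_neg]
      refine ⟨e ▸ mem_of_lt_exitTime hΩc hBΩ hy ht.1.le ht.2, ?_⟩
      have m1 : y ∈ Metric.ball p r := (hB hy).2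
      have hy2 : (2 : ℝ) • c - y ∈ B := by
        rw [hBdef, Metric.mem_ball, dist_eq_norm] at hy ⊢
        rw [two_smul, add_sub_right_comm, add_sub_cancel_right, ← norm_neg, neg_sub]
        exact hy
      have m2 : y + (2 : ℝ) • (-v) ∈ Metric.ball p r := by
        have := (hB hy2).2
        rw [Metric.mem_ball, dist_eq_norm] at this ⊢
        have e3 : -(y + (2 : ℝ) • (-v) - p) = (2 : ℝ) • c - y - p := by
          rw [hv]
          module
        rw [← norm_neg, e3]
        exact this
      have m3 := (convex_ball p r).add_smul_sub_mem m1 m2 (t := t / 2)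
        ⟨by linarith [ht.1], by linarith [ht.2]⟩
      convert m3 using 1
      module
    rw [hF1, indicator_of_mem hmem, mul_comm]
    refine (enorm_inner_sq_le _ _).trans_eq ?_
    rw [enorm_neg]
  have hmaps2 : ∀ y ∈ B, (2 : ℝ) • c + (-1 : ℝ) • y ∈ B := by
    intro y hy
    rw [hBdef, Metric.mem_ball, dist_eq_norm] at hy ⊢
    have e : -((2 : ℝ) • c + (-1 : ℝ) • y - c) = y - c := by module
    rw [← norm_neg, e]
    exact hy
  have hmaps3 : ∀ y ∈ B, (1 / 2 : ℝ) • c + (1 / 2 : ℝ) • y ∈ B := fun y hy =>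
    convex_ball c s (Metric.mem_ball_self hs) hy (by norm_num) (by norm_num) (by norm_num)
  have hpt : ∀ y ∈ B, ‖a‖ₑ ^ 2 ≤ 3 * N y + 3 * N ((2 : ℝ) • c + (-1 : ℝ) • y) +
      12 * N ((1 / 2 : ℝ) • c + (1 / 2 : ℝ) • y) := by
    intro y hy
    have h1 := enorm_sq_le_of_abs_le (abs_le_exit_values hΩo hΩc hp hBΩ hs hpc a g hy)
    have e : (2 : ℝ) • c - y = (2 : ℝ) • c + (-1 : ℝ) • y := by module
    rw [e] at h1
    refine h1.trans ?_
    gcongr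
    · exact hpath y hy
    · exact hpath _ (hmaps2 y hy)
    · exact hpath _ (hmaps3 y hy)
  have hNint : ∫⁻ y in B, N y ≤ 2 * (∫⁻ x in Q, ‖ψ x‖ₑ ^ 2)
      + 8 * (‖v‖ₑ ^ 2 * ∫⁻ x in Q, ‖gradient ψ x‖ₑ ^ 2) := by
    rw [← hF0i, ← hF1i]
    refine (lintegral_mono' Measure.restrict_le_self le_rfl).trans ?_
    simp only [hN]
    rw [lintegral_add_left (by fun_prop), lintegral_const_mul _ hF0m,
      lintegral_const_mul _ (by fun_prop), lintegral_const_mul _ (by fun_prop),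
      lintegral_const_mul _ hlm,
      lintegral_lintegral_swap (f := fun (y : Vec d) (t : ℝ) => F1 (y + t • (-v)))
        hline.aemeasurable]
    refine add_le_add le_rfl ?_
    have e : ∀ t : ℝ, ∫⁻ y, F1 (y + t • (-v)) = ∫⁻ y, F1 y := fun t =>
      lintegral_add_right_eq_self F1 _
    simp only [e, lintegral_const, Measure.restrict_apply_univ, Real.volume_Ioc, sub_zero,
      ENNReal.ofReal_ofNat]
    refine le_of_eq ?_
    ring
  have hE : ‖a‖ₑ ^ 2 * volume B ≤ (6 + 12 * 2 ^ d) * ∫⁻ y in B, N y := by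
    have h1 : ∫⁻ _ in B, ‖a‖ₑ ^ 2 = ‖a‖ₑ ^ 2 * volume B := by
      rw [lintegral_const, Measure.restrict_apply_univ]
    rw [← h1]
    refine (setLIntegral_mono' hBm hpt).trans ?_
    have n2 := setLIntegral_comp_add_smul_le hNm hBm ((2 : ℝ) • c) (by norm_num) hmaps2
    have n3 := setLIntegral_comp_add_smul_le hNm hBm ((1 / 2 : ℝ) • c) (by norm_num) hmaps3
    have a2 : ENNReal.ofReal |((-1 : ℝ) ^ d)⁻¹| = 1 := by simp [abs_inv, abs_pow]
    have a3 : ENNReal.ofReal |((1 / 2 : ℝ) ^ d)⁻¹| ≤ 2 ^ d := ofReal_abs_inv_pow_le le_rfl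
    rw [a2, one_mul] at n2
    have n3' := n3.trans (mul_le_mul' a3 le_rfl)
    have hm2 : Measurable fun y : Vec d => N ((2 : ℝ) • c + (-1 : ℝ) • y) :=
      hNm.comp (by fun_prop)
    have hm3 : Measurable fun y : Vec d => N ((1 / 2 : ℝ) • c + (1 / 2 : ℝ) • y) :=
      hNm.comp (by fun_prop)
    rw [lintegral_add_left (by fun_prop), lintegral_add_left (by fun_prop),
      lintegral_const_mul _ hNm, lintegral_const_mul _ hm2, lintegral_const_mul _ hm3]
    calc _ ≤ 3 * (∫⁻ y in B, N y) + 3 * (∫⁻ y in B, N y) + 12 * (2 ^ d * ∫⁻ y in B, N y) := by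
          gcongr
      _ = _ := by ring
  have hfinal := hE.trans (mul_le_mul' le_rfl hNint)
  have mψ : MemLp ψ 2 (volume.restrict Q) := memLp_of_continuous hQb hψ.continuous
  have mg : MemLp (fun x => gradient ψ x) 2 (volume.restrict Q) :=
    memLp_of_continuous hQb (continuous_gradient hψ)
  have hI0 := integral_norm_sq_nonneg (μ := volume.restrict Q) ψ
  have hI1 := integral_norm_sq_nonneg (μ := volume.restrict Q) (gradient ψ)
  have hvol : volume B = ENNReal.ofReal (volume.real B) :=
    (ENNReal.ofReal_toReal (measure_ball_lt_top.ne)).symm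
  have h2d : (2 : ENNReal) ^ d = ENNReal.ofReal (2 ^ d) := by
    rw [ENNReal.ofReal_pow (by norm_num), ENNReal.ofReal_ofNat]
  have h6 : (6 + 12 * 2 ^ d : ENNReal) = ENNReal.ofReal (6 + 12 * 2 ^ d) := by
    rw [h2d, ENNReal.ofReal_add (by norm_num) (by positivity), ENNReal.ofReal_mul (by norm_num)]
    simp
  have h2' : (2 : ENNReal) = ENNReal.ofReal 2 := by simp
  have h8' : (8 : ENNReal) = ENNReal.ofReal 8 := by simp
  rw [lintegral_enorm_sq mψ, lintegral_enorm_sq mg, h6, hvol, ← ofReal_norm, ← ofReal_norm,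
    ← ENNReal.ofReal_pow (norm_nonneg _), ← ENNReal.ofReal_pow (norm_nonneg _),
    ← ENNReal.ofReal_mul (by positivity), ← ENNReal.ofReal_mul (by positivity), h8',
    ← ENNReal.ofReal_mul (by positivity)] at hfinal
  have h22 : (2 : ENNReal) * ENNReal.ofReal (∫ x in Q, ‖ψ x‖ ^ 2) =
      ENNReal.ofReal (2 * ∫ x in Q, ‖ψ x‖ ^ 2) := by
    rw [ENNReal.ofReal_mul (by norm_num), ENNReal.ofReal_ofNat]
  rw [h22, ← ENNReal.ofReal_add (by positivity) (by positivity),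
    ← ENNReal.ofReal_mul (by positivity), ENNReal.ofReal_le_ofReal_iff (by positivity)] at hfinal
  simp only [hgψ] at hfinal hI1
  rw [Real.norm_eq_abs, sq_abs] at hfinal
  refine hfinal.trans ?_
  have : ‖v‖ ^ 2 ≤ r ^ 2 := pow_le_pow_left₀ (norm_nonneg _) hvr 2
  rw [← mul_assoc]
  gcongr

/-- An affine function that approximates a function in `H_0^1` near a boundary point is small at
this point. -/
lemma MemH01.boundary_value_le {Ω : Set (Vec d)} (hΩo : IsOpen Ω) (hΩc : Convex ℝ Ω)
    {p c : Vec d} {s r : ℝ} (hs : 0 < s) (hp : p ∉ Ω) (hpc : p ∈ closure Ω)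
    (hB : Metric.ball c s ⊆ Ω ∩ Metric.ball p r) {u : Vec d → ℝ} {G : Vec d → Vec d}
    (hu : MemH01 Ω u G) (a : ℝ) (g : Vec d) :
    a ^ 2 * volume.real (Metric.ball c s) ≤ (6 + 12 * 2 ^ d) *
      (2 * (∫ x in Ω ∩ Metric.ball p r, ‖u x - (a + inner ℝ g (x - p))‖ ^ 2)
        + 8 * r ^ 2 * ∫ x in Ω ∩ Metric.ball p r, ‖G x - g‖ ^ 2) := by
  set Q := Ω ∩ Metric.ball p r
  have hQΩ : Q ⊆ Ω := inter_subset_left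
  have hQb : Bornology.IsBounded Q := Metric.isBounded_ball.subset inter_subset_right
  obtain ⟨φ, hφ, h1, h2⟩ := hu.exists_tendsto
  have hu' := hu.1.mono hQΩ
  have hres : volume.restrict Q ≤ volume.restrict Ω := Measure.restrict_mono hQΩ le_rfl
  have haff := (memH1_affine hQb a g p).1
  have hcst := memLp_const_restrict hQb g
  have m1 : ∀ n, MemLp (fun x => φ n x - (a + inner ℝ g (x - p))) 2 (volume.restrict Q) :=
    fun n => ((hφ n).memLp 2 _).sub haff
  have m2 : ∀ n, MemLp (fun x => gradient (φ n) x - g) 2 (volume.restrict Q) :=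
    fun n => ((hφ n).memLp_gradient 2 _).sub hcst
  have l1 := tendsto_integral_norm_sq (g := fun x => u x - (a + inner ℝ g (x - p))) m1
    (hu'.1.sub haff) (by
      refine squeeze_zero (fun n => integral_norm_sq_nonneg _) (fun n => ?_) h1
      simp only [sub_sub_sub_cancel_right]
      exact integral_mono_measure hres (ae_of_all _ fun x => by positivity)
        (integrable_norm_sq (((hφ n).memLp 2 _).sub hu.1.1)))
  have l2 := tendsto_integral_norm_sq (g := fun x => G x - g) m2 (hu'.2.1.sub hcst) (by
      refine squeeze_zero (fun n => integral_norm_sq_nonneg _) (fun n => ?_) h2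
      simp only [sub_sub_sub_cancel_right]
      exact integral_mono_measure hres (ae_of_all _ fun x => by positivity)
        (integrable_norm_sq (((hφ n).memLp_gradient 2 _).sub hu.1.2.1)))
  exact ge_of_tendsto' (((l1.const_mul 2).add (l2.const_mul (8 * r ^ 2))).const_mul _)
    fun n => (hφ n).boundary_value_le hΩo hΩc hs hp hpc hB a g

/-! ### Local approximation by affine functions -/

lemma measureReal_ball (x : Vec d) {r : ℝ} (hr : 0 < r) :
    volume.real (Metric.ball x r) = r ^ d * volume.real (Metric.ball (0 : Vec d) 1) := by
  rw [Measure.real, Measure.addHaar_ball_of_pos _ _ hr, finrank_euclideanSpace, Fintype.card_fin,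
    ENNReal.toReal_mul, ENNReal.toReal_ofReal (by positivity)]
  rfl

lemma measureReal_unitBall_pos : 0 < volume.real (Metric.ball (0 : Vec d) 1) :=
  ENNReal.toReal_pos (Metric.measure_ball_pos volume 0 one_pos).ne' measure_ball_lt_top.ne

lemma integral_norm_sq_coord {μ : Measure (Vec d)} {G : Vec d → Vec d} (hG : MemLp G 2 μ) :
    ∫ x, ‖G x‖ ^ 2 ∂μ = ∑ i, ∫ x, ‖G x i‖ ^ 2 ∂μ := by
  rw [← integral_finsetSum _ fun i _ => integrable_norm_sq (memLp_coord hG i)]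
  refine integral_congr_ae (ae_of_all _ fun x => ?_)
  simp only [EuclideanSpace.norm_sq_eq]

/-- The constant in the local approximation by affine functions. -/
def approxConst (d : ℕ) (κ : ℝ) : ℝ :=
  2 ^ d * 4 + 2 * (2 ^ d * 4) ^ 2 +
    2 * (((6 + 12 * 2 ^ d) * (2 * (2 ^ d * 4) ^ 2 + 8 * (2 ^ d * 4))) * (κ ^ d)⁻¹)

/-- Near a point `p` of the closure of a convex domain, a function in `H² ∩ H_0^1` is
approximated by an affine function, that vanishes at `p` if `p` is on the boundary. -/
lemma exists_affine_approx {Ω : Set (Vec d)} (hΩo : IsOpen Ω) (hΩc : Convex ℝ Ω)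
    {p c : Vec d} {s r κ : ℝ} (hκ : 0 < κ) (hr : 0 < r) (hκs : κ * r ≤ s) (hpc : p ∈ closure Ω)
    (hB : Metric.ball c s ⊆ Ω ∩ Metric.ball p r) {u : Vec d → ℝ} {G : Vec d → Vec d}
    {D : Fin d → Vec d → Vec d} (hu : MemH01 Ω u G) (hu2 : MemH2 Ω u G D) :
    ∃ (a : ℝ) (g : Vec d), (p ∉ Ω → a = 0) ∧
      (∫ x in Ω ∩ Metric.ball p r, ‖u x - (a + inner ℝ g (x - p))‖ ^ 2) ≤
        approxConst d κ * r ^ 4 * ∑ i, ∫ x in Ω ∩ Metric.ball p r, ‖D i x‖ ^ 2 ∧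
      (∫ x in Ω ∩ Metric.ball p r, ‖G x - g‖ ^ 2) ≤
        approxConst d κ * r ^ 2 * ∑ i, ∫ x in Ω ∩ Metric.ball p r, ‖D i x‖ ^ 2 := by
  set Q := Ω ∩ Metric.ball p r with hQdef
  have hs : 0 < s := lt_of_lt_of_le (by positivity) hκs
  have hQΩ : Q ⊆ Ω := inter_subset_left
  have hQo : IsOpen Q := hΩo.inter Metric.isOpen_ball
  have hQb : Bornology.IsBounded Q := Metric.isBounded_ball.subset inter_subset_right
  have hQc : Convex ℝ Q := hΩc.inter (convex_ball p r)
  have hQn : Q.Nonempty := ⟨c, hB (Metric.mem_ball_self hs)⟩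
  have hdiam : ∀ x ∈ Q, ∀ y ∈ Q, ‖y - x‖ ≤ 2 * r := by
    intro x hx y hy
    have h1 := hx.2
    have h2 := hy.2
    rw [Metric.mem_ball, dist_eq_norm] at h1 h2
    have := norm_sub_le (y - p) (x - p)
    rw [sub_sub_sub_cancel_right] at this
    linarith
  have hQ2 := hu2.mono hQΩ
  set E := ∑ i, ∫ x in Q, ‖D i x‖ ^ 2 with hE
  have hE0 : 0 ≤ E := Finset.sum_nonneg fun i _ => integral_norm_sq_nonneg _
  set C1 : ℝ := 2 ^ d * 4 with hC1
  have hC10 : 0 < C1 := by positivity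
  choose g₀ hg₀ using fun i => (hQ2.2 i).exists_integral_sub_sq_le hQo hQc hQb hQn hdiam
  set g : Vec d := WithLp.toLp 2 g₀
  have hGg : MemLp (fun x => G x - g) 2 (volume.restrict Q) :=
    hQ2.1.2.1.sub (memLp_const_restrict hQb g)
  have e1 : ∫ x in Q, ‖G x - g‖ ^ 2 ≤ C1 * r ^ 2 * E := by
    rw [integral_norm_sq_coord hGg, hE, Finset.mul_sum]
    refine Finset.sum_le_sum fun i _ => (hg₀ i).trans_eq ?_
    rw [hC1]
    ring
  have hw : MemH1 Q (fun x => u x - (0 + inner ℝ g (x - p))) (fun x => G x - g) :=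
    hQ2.1.sub (memH1_affine hQb 0 g p)
  obtain ⟨a, ha⟩ := hw.exists_integral_sub_sq_le hQo hQc hQb hQn hdiam
  have e2 : ∫ x in Q, ‖u x - (a + inner ℝ g (x - p))‖ ^ 2 ≤ C1 ^ 2 * r ^ 4 * E := by
    have e : ∀ x, u x - (0 + inner ℝ g (x - p)) - a = u x - (a + inner ℝ g (x - p)) :=
      fun x => by ring
    simp only [e] at ha
    refine ha.trans ?_
    calc 2 ^ d * (2 * r) ^ 2 * ∫ x in Q, ‖G x - g‖ ^ 2
        ≤ 2 ^ d * (2 * r) ^ 2 * (C1 * r ^ 2 * E) := by gcongr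
      _ = C1 ^ 2 * r ^ 4 * E := by rw [hC1]; ring
  set K : ℝ := 6 + 12 * 2 ^ d with hK
  have hK0 : 0 < K := by positivity
  have hconst : approxConst d κ = C1 + 2 * C1 ^ 2 +
      2 * ((K * (2 * C1 ^ 2 + 8 * C1)) * (κ ^ d)⁻¹) := rfl
  have hlast : 0 ≤ 2 * ((K * (2 * C1 ^ 2 + 8 * C1)) * (κ ^ d)⁻¹) := by positivity
  have hc1 : C1 ≤ approxConst d κ := by
    rw [hconst]
    nlinarith [sq_nonneg C1]
  have hc2 : C1 ^ 2 ≤ approxConst d κ := by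
    rw [hconst]
    nlinarith [sq_nonneg C1]
  by_cases hp : p ∈ Ω
  · exact ⟨a, g, fun h => absurd hp h, e2.trans (by gcongr), e1.trans (by gcongr)⟩
  · refine ⟨0, g, fun _ => rfl, ?_, e1.trans (by gcongr)⟩
    have hb := hu.boundary_value_le hΩo hΩc hs hp hpc hB a g
    have hb2 : a ^ 2 * volume.real (Metric.ball c s) ≤ K * (2 * C1 ^ 2 + 8 * C1) * r ^ 4 * E := by
      refine hb.trans ?_
      calc K * (2 * (∫ x in Q, ‖u x - (a + inner ℝ g (x - p))‖ ^ 2) +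
            8 * r ^ 2 * ∫ x in Q, ‖G x - g‖ ^ 2)
          ≤ K * (2 * (C1 ^ 2 * r ^ 4 * E) + 8 * r ^ 2 * (C1 * r ^ 2 * E)) := by gcongr
        _ = _ := by ring
    have hvol : volume.real Q ≤ (κ ^ d)⁻¹ * volume.real (Metric.ball c s) := by
      have h1 : volume.real Q ≤ volume.real (Metric.ball p r) :=
        measureReal_mono inter_subset_right measure_ball_lt_top.ne
      refine h1.trans ?_
      rw [measureReal_ball p hr, measureReal_ball c hs, ← mul_assoc]
      refine mul_le_mul_of_nonneg_right ?_ measureReal_unitBall_pos.le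
      rw [inv_mul_eq_div, le_div_iff₀ (by positivity), ← mul_pow, mul_comm]
      gcongr
    have hm : MemLp (fun x => u x - (a + inner ℝ g (x - p))) 2 (volume.restrict Q) :=
      hQ2.1.1.sub (memH1_affine hQb a g p).1
    have h3 := integral_norm_add_sq_le hm (memLp_const_restrict hQb a)
    have e : ∀ x, u x - (a + inner ℝ g (x - p)) + a = u x - (0 + inner ℝ g (x - p)) :=
      fun x => by ring
    simp only [e, setIntegral_const, smul_eq_mul, Real.norm_eq_abs, sq_abs] at h3
    simp only [Real.norm_eq_abs, sq_abs] at e2 ⊢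
    refine h3.trans ?_
    have h4 : volume.real Q * a ^ 2 ≤ (K * (2 * C1 ^ 2 + 8 * C1)) * (κ ^ d)⁻¹ * r ^ 4 * E := by
      calc volume.real Q * a ^ 2
          ≤ (κ ^ d)⁻¹ * volume.real (Metric.ball c s) * a ^ 2 := by gcongr
        _ = (κ ^ d)⁻¹ * (a ^ 2 * volume.real (Metric.ball c s)) := by ring
        _ ≤ (κ ^ d)⁻¹ * (K * (2 * C1 ^ 2 + 8 * C1) * r ^ 4 * E) := by gcongr
        _ = _ := by ring
    have h5 : 0 ≤ C1 * r ^ 4 * E := by positivity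
    rw [hconst]
    nlinarith

/-! ### Geometry of the triangulation -/

lemma isCompact_simplex (K : Finset (Vec d)) : IsCompact (simplex K) :=
  K.finite_toSet.isCompact_convexHull ℝ

lemma isClosed_simplex (K : Finset (Vec d)) : IsClosed (simplex K) :=
  (isCompact_simplex K).isClosed

lemma measurableSet_simplex (K : Finset (Vec d)) : MeasurableSet (simplex K) :=
  (isClosed_simplex K).measurableSet

lemma convex_simplex (K : Finset (Vec d)) : Convex ℝ (simplex K) := convex_convexHull ℝ _

lemma mem_simplex {K : Finset (Vec d)} {p : Vec d} (hp : p ∈ K) : p ∈ simplex K :=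
  subset_convexHull ℝ _ hp

lemma measure_simplex_ne_top (K : Finset (Vec d)) : volume (simplex K) ≠ ⊤ :=
  (isCompact_simplex K).measure_lt_top.ne

lemma affine_le_of_mem_convexHull {s : Set (Vec d)} {c b : ℝ} {g : Vec d}
    (h : ∀ p ∈ s, c + inner ℝ g p ≤ b) {x : Vec d} (hx : x ∈ convexHull ℝ s) :
    c + inner ℝ g x ≤ b := by
  have hc : Convex ℝ {y : Vec d | inner ℝ g y ≤ b - c} :=
    convex_halfSpace_le (innerₗ (Vec d) g).isLinear _
  have hsub : s ⊆ {y : Vec d | inner ℝ g y ≤ b - c} := fun p hp => by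
    have := h p hp
    simp only [mem_ofPred_eq]
    linarith
  have h1 : inner ℝ g x ≤ b - c := convexHull_min hsub hc hx
  linarith

lemma abs_affine_le_of_mem_convexHull {s : Set (Vec d)} {c b : ℝ} {g : Vec d}
    (h : ∀ p ∈ s, |c + inner ℝ g p| ≤ b) {x : Vec d} (hx : x ∈ convexHull ℝ s) :
    |c + inner ℝ g x| ≤ b := by
  refine abs_le.2 ⟨?_, affine_le_of_mem_convexHull (fun p hp => (abs_le.1 (h p hp)).2) hx⟩
  have h1 : (-c) + inner ℝ (-g) x ≤ b := by
    refine affine_le_of_mem_convexHull (fun p hp => ?_) hx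
    rw [inner_neg_left]
    linarith [(abs_le.1 (h p hp)).1]
  rw [inner_neg_left] at h1
  linarith

lemma affine_eq_of_mem_convexHull {s : Set (Vec d)} {c c' : ℝ} {g g' : Vec d}
    (h : ∀ p ∈ s, c + inner ℝ g p = c' + inner ℝ g' p) {x : Vec d} (hx : x ∈ convexHull ℝ s) :
    c + inner ℝ g x = c' + inner ℝ g' x := by
  have h1 : |(c - c') + inner ℝ (g - g') x| ≤ 0 := by
    refine abs_affine_le_of_mem_convexHull (fun p hp => ?_) hx
    have := h p hp
    rw [abs_nonpos_iff, inner_sub_left]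
    linarith
  rw [abs_nonpos_iff, inner_sub_left] at h1
  linarith

variable {Ω : Set (Vec d)} {T : Finset (Finset (Vec d))}

lemma IsTriangulation.affineSpan_eq_top (hT : IsTriangulation Ω T) {K : Finset (Vec d)}
    (hK : K ∈ T) : affineSpan ℝ (K : Set (Vec d)) = ⊤ := by
  have h := (hT.affineIndependent K hK).affineSpan_eq_top_iff_card_eq_finrank_add_one
  have e : Set.range (fun p : K => (p : Vec d)) = (K : Set (Vec d)) := by
    ext x
    simp
  rw [e] at h
  rw [h, Fintype.card_coe, hT.card_eq K hK, finrank_euclideanSpace, Fintype.card_fin]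

lemma IsTriangulation.exists_interpolant (hT : IsTriangulation Ω T) {K : Finset (Vec d)}
    (hK : K ∈ T) (a : Vec d → ℝ) : ∃ (c : ℝ) (g : Vec d), ∀ p ∈ K, c + inner ℝ g p = a p := by
  classical
  have hspan : affineSpan ℝ (Set.range (fun p : K => (p : Vec d))) = ⊤ := by
    have e : Set.range (fun p : K => (p : Vec d)) = (K : Set (Vec d)) := by
      ext x
      simp
    rw [e]
    exact hT.affineSpan_eq_top hK
  let b : AffineBasis K ℝ (Vec d) := ⟨fun p : K => (p : Vec d), hT.affineIndependent K hK, hspan⟩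
  let F : Vec d →ᵃ[ℝ] ℝ := ∑ q : K, a q • b.coord q
  have hF : ∀ x, F x = ∑ q : K, a q * b.coord q x := by
    intro x
    have : ∀ s : Finset K, (∑ q ∈ s, a q • b.coord q : Vec d →ᵃ[ℝ] ℝ) x
        = ∑ q ∈ s, a q * b.coord q x := by
      intro s
      induction s using Finset.induction_on with
      | empty => simp
      | insert q s hq ih => rw [Finset.sum_insert hq, Finset.sum_insert hq, ← ih]; rfl
    exact this _
  refine ⟨F 0, (InnerProductSpace.toDual ℝ (Vec d)).symm F.linear.toContinuousLinearMap,
    fun p hp => ?_⟩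
  rw [InnerProductSpace.toDual_symm_apply, LinearMap.coe_toContinuousLinearMap']
  have h1 : F p = F.linear p + F 0 := congrFun F.decomp p
  rw [add_comm, ← h1, hF, Finset.sum_eq_single (⟨p, hp⟩ : K)]
  · have : b.coord ⟨p, hp⟩ p = 1 := b.coord_apply_eq ⟨p, hp⟩
    rw [this, mul_one]
  · intro q _ hq
    have : b.coord q p = 0 := b.coord_apply_ne (j := (⟨p, hp⟩ : K)) hq
    rw [this, mul_zero]
  · exact fun h => absurd (Finset.mem_univ _) h

lemma IsTriangulation.interior_nonempty (hT : IsTriangulation Ω T) {K : Finset (Vec d)}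
    (hK : K ∈ T) : (interior (simplex K)).Nonempty :=
  interior_convexHull_nonempty_iff_affineSpan_eq_top.2 (hT.affineSpan_eq_top hK)

lemma IsTriangulation.measureReal_pos (hT : IsTriangulation Ω T) {K : Finset (Vec d)}
    (hK : K ∈ T) : 0 < volume.real (simplex K) :=
  ENNReal.toReal_pos (Measure.measure_pos_of_nonempty_interior _ (hT.interior_nonempty hK)).ne'
    (measure_simplex_ne_top K)

lemma IsTriangulation.measure_inter_eq_zero (hT : IsTriangulation Ω T) {K K' : Finset (Vec d)}
    (hK : K ∈ T) (hK' : K' ∈ T) (hne : K ≠ K') : volume (simplex K ∩ simplex K') = 0 := by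
  classical
  rw [hT.inter K hK K' hK', ← Finset.coe_inter]
  refine measure_mono_null (convexHull_subset_affineSpan _)
    (Measure.addHaar_affineSubspace volume _ fun htop => ?_)
  have hind : AffineIndependent ℝ (fun p : ↥(K ∩ K') => (p : Vec d)) :=
    (hT.affineIndependent K hK).mono
      (show ((K ∩ K' : Finset (Vec d)) : Set (Vec d)) ⊆ (K : Set (Vec d)) from
        Finset.coe_subset.2 Finset.inter_subset_left)
  have h := hind.affineSpan_eq_top_iff_card_eq_finrank_add_one
  have e : Set.range (fun p : ↥(K ∩ K') => (p : Vec d)) = ((K ∩ K' : Finset (Vec d)) : Set _) := by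
    ext x
    simp
  rw [e, Fintype.card_coe, finrank_euclideanSpace, Fintype.card_fin] at h
  have hcard := h.1 htop
  have e1 : K ∩ K' = K := Finset.eq_of_subset_of_card_le Finset.inter_subset_left
    (by rw [hcard, hT.card_eq K hK])
  have e2 : K ∩ K' = K' := Finset.eq_of_subset_of_card_le Finset.inter_subset_right
    (by rw [hcard, hT.card_eq K' hK'])
  exact hne (e1.symm.trans e2)

lemma IsTriangulation.disjoint_interior (hT : IsTriangulation Ω T) {K K' : Finset (Vec d)}
    (hK : K ∈ T) (hK' : K' ∈ T) (hne : K ≠ K') :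
    Disjoint (interior (simplex K)) (interior (simplex K')) := by
  rw [disjoint_iff_inter_eq_empty]
  refine (isOpen_interior.inter isOpen_interior).measure_eq_zero_iff volume |>.1 ?_
  exact measure_mono_null (inter_subset_inter interior_subset interior_subset)
    (hT.measure_inter_eq_zero hK hK' hne)

lemma IsTriangulation.simplex_subset (hT : IsTriangulation Ω T) {K : Finset (Vec d)}
    (hK : K ∈ T) : simplex K ⊆ closure Ω := by
  rw [← hT.cover]
  exact subset_biUnion_of_mem (u := fun K => simplex K) hK

lemma interior_closure_of_convex (hΩo : IsOpen Ω) (hΩc : Convex ℝ Ω) (hΩn : Ω.Nonempty) :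
    interior (closure Ω) = Ω := by
  rw [hΩc.interior_closure_eq_interior_of_nonempty_interior (by rwa [hΩo.interior_eq]),
    hΩo.interior_eq]

lemma IsTriangulation.interior_simplex_subset (hT : IsTriangulation Ω T) (hΩo : IsOpen Ω)
    (hΩc : Convex ℝ Ω) (hΩn : Ω.Nonempty) {K : Finset (Vec d)} (hK : K ∈ T) :
    interior (simplex K) ⊆ Ω := by
  rw [← interior_closure_of_convex hΩo hΩc hΩn]
  exact interior_mono (hT.simplex_subset hK)

lemma IsTriangulation.restrict_eq (hT : IsTriangulation Ω T) (hΩc : Convex ℝ Ω) :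
    volume.restrict Ω = ∑ K ∈ T, volume.restrict (simplex K) := by
  have h1 : (volume.restrict Ω : Measure (Vec d)) = volume.restrict (closure Ω) :=
    Measure.restrict_congr_set (hΩc.addHaar_frontier volume |> fun h =>
      (ae_eq_set.2 ⟨by rw [sdiff_eq_empty.2 subset_closure, measure_empty],
        measure_mono_null (sdiff_subset_sdiff_right interior_subset) h⟩))
  have h2 : closure Ω = ⋃ K : T, simplex (K : Finset (Vec d)) := by
    rw [← hT.cover, iUnion_subtype (fun K => K ∈ T) (fun K => simplex (K : Finset (Vec d)))]
  rw [h1, h2, Measure.restrict_iUnion_ae, Measure.sum_fintype, ← Finset.sum_coe_sort T]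
  · intro K K' hne
    exact hT.measure_inter_eq_zero K.2 K'.2 fun h => hne (Subtype.ext h)
  · exact fun K => (measurableSet_simplex _).nullMeasurableSet

lemma IsTriangulation.restrict_le (hT : IsTriangulation Ω T) (hΩc : Convex ℝ Ω)
    {K : Finset (Vec d)} (hK : K ∈ T) :
    (volume.restrict (simplex K) : Measure (Vec d)) ≤ volume.restrict Ω := by
  rw [hT.restrict_eq hΩc]
  exact Finset.single_le_sum (f := fun K => (volume.restrict (simplex K) : Measure (Vec d)))
    (fun _ _ => Measure.zero_le _) hK

lemma IsTriangulation.setIntegral_eq (hT : IsTriangulation Ω T) (hΩc : Convex ℝ Ω)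
    {f : Vec d → ℝ} (hf : Integrable f (volume.restrict Ω)) :
    ∫ x in Ω, f x = ∑ K ∈ T, ∫ x in simplex K, f x := by
  rw [hT.restrict_eq hΩc,
    integral_finsetSum_measure fun K hK => hf.mono_measure (hT.restrict_le hΩc hK)]

lemma restrict_interior_simplex (K : Finset (Vec d)) :
    (volume.restrict (interior (simplex K)) : Measure (Vec d)) = volume.restrict (simplex K) :=
  Measure.restrict_congr_set ((convex_simplex K).addHaar_frontier volume |> fun h =>
      (ae_eq_set.2 ⟨by rw [sdiff_eq_empty.2 interior_subset, measure_empty],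
        measure_mono_null (sdiff_subset_sdiff_left subset_closure) h⟩))

lemma diamK_le_meshSize {K : Finset (Vec d)} (hK : K ∈ T) : diamK K ≤ meshSize T :=
  le_csSup (T.finite_toSet.image _).bddAbove (mem_image_of_mem _ hK)

lemma norm_sub_le_diamK {K : Finset (Vec d)} {x y : Vec d} (hx : x ∈ simplex K)
    (hy : y ∈ simplex K) : ‖x - y‖ ≤ diamK K := by
  rw [← dist_eq_norm]
  exact Metric.dist_le_diam_of_mem (isCompact_simplex K).isBounded hx hy

lemma IsTriangulation.diamK_pos (hd : 0 < d) (hT : IsTriangulation Ω T) {K : Finset (Vec d)}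
    (hK : K ∈ T) : 0 < diamK K := by
  obtain ⟨p, hp, q, hq, hne⟩ := Finset.one_lt_card.1
    (show 1 < K.card by rw [hT.card_eq K hK]; omega)
  exact (norm_pos_iff.2 (sub_ne_zero.2 hne)).trans_le
    (norm_sub_le_diamK (mem_simplex hp) (mem_simplex hq))

lemma meshSize_nonneg : 0 ≤ meshSize T := by
  refine Real.sSup_nonneg ?_
  rintro _ ⟨K, -, rfl⟩
  exact Metric.diam_nonneg

lemma IsTriangulation.meshSize_pos (hd : 0 < d) (hT : IsTriangulation Ω T) {K : Finset (Vec d)}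
    (hK : K ∈ T) : 0 < meshSize T :=
  (hT.diamK_pos hd hK).trans_le (diamK_le_meshSize hK)

/-- Each simplex contains a ball of radius comparable to the mesh size. -/
lemma IsTriangulation.exists_ball_subset (hd : 0 < d) (hT : IsTriangulation Ω T) {σ τ : ℝ}
    (hσ : ShapeRegular σ T) (hτ : InverseAssumption τ T) {K : Finset (Vec d)} (hK : K ∈ T) :
    0 < σ ∧ 0 < τ ∧ ∃ c, Metric.ball c ((4 * σ * τ)⁻¹ * meshSize T) ⊆ simplex K := by
  have hD := hT.diamK_pos hd hK
  have hH := hT.meshSize_pos hd hK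
  have hτ0 : 0 < τ := by
    by_contra! h
    nlinarith [hτ K hK]
  set S : Set ℝ := {r : ℝ | 0 ≤ r ∧ ∃ c, Metric.ball c r ⊆ simplex K} with hS
  have hS0 : 0 ≤ sSup S := Real.sSup_nonneg fun r hr => hr.1
  have h1 : diamK K ≤ σ * (2 * sSup S) := hσ K hK
  have hσ0 : 0 < σ := by
    by_contra! h
    nlinarith
  refine ⟨hσ0, hτ0, ?_⟩
  have hlt : (4 * σ * τ)⁻¹ * meshSize T < sSup S := by
    rw [inv_mul_eq_div, div_lt_iff₀ (by positivity)]
    calc meshSize T ≤ τ * diamK K := hτ K hK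
      _ < τ * (2 * diamK K) := by gcongr; linarith
      _ ≤ τ * (2 * (σ * (2 * sSup S))) := by gcongr
      _ = sSup S * (4 * σ * τ) := by ring
  obtain ⟨r, hr, hlr⟩ := exists_lt_of_lt_csSup (show S.Nonempty from ⟨0, le_rfl, 0, by simp⟩) hlt
  obtain ⟨c, hc⟩ := hr.2
  exact ⟨c, (Metric.ball_subset_ball hlr.le).trans hc⟩

/-- The number of simplices in a ball is bounded. -/
lemma IsTriangulation.card_mul_pow_le (hT : IsTriangulation Ω T) {ρ r : ℝ} (hρ : 0 < ρ)
    (hr : 0 < r) (hball : ∀ K ∈ T, ∃ c, Metric.ball c ρ ⊆ simplex K) {s : Finset (Finset (Vec d))}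
    (hs : s ⊆ T) {x : Vec d} (hsx : ∀ K ∈ s, simplex K ⊆ Metric.ball x r) :
    (s.card : ℝ) * ρ ^ d ≤ r ^ d := by
  have h0 := measureReal_unitBall_pos (d := d)
  have h1 : ∑ K ∈ s, volume.real (simplex K) ≤ volume.real (Metric.ball x r) := by
    have e : volume (⋃ K ∈ s, simplex K) = ∑ K ∈ s, volume (simplex K) :=
      measure_biUnion_finset₀ (fun K hK K' hK' hne =>
        hT.measure_inter_eq_zero (hs hK) (hs hK') hne)
        fun K _ => (measurableSet_simplex K).nullMeasurableSet
    rw [show ∑ K ∈ s, volume.real (simplex K) = (∑ K ∈ s, volume (simplex K)).toReal from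
      (ENNReal.toReal_sum fun K _ => measure_simplex_ne_top K).symm, ← e]
    exact measureReal_mono (iUnion₂_subset hsx) measure_ball_lt_top.ne
  have h2 : ∀ K ∈ s, ρ ^ d * volume.real (Metric.ball (0 : Vec d) 1) ≤ volume.real (simplex K) := by
    intro K hK
    obtain ⟨c, hc⟩ := hball K (hs hK)
    rw [← measureReal_ball c hρ]
    exact measureReal_mono hc (measure_simplex_ne_top K)
  have h3 := (Finset.card_nsmul_le_sum s _ _ h2).trans h1
  rw [measureReal_ball x hr, nsmul_eq_mul, ← mul_assoc] at h3
  exact le_of_mul_le_mul_right h3 h0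

/-! ### Lipschitz functions that are locally affine almost everywhere -/

lemma abs_sub_le_of_eventually {V : Vec d → ℝ} {M : ℝ}
    (h : ∀ x, ∀ᶠ y in 𝓝 x, |V y - V x| ≤ M * ‖y - x‖) (x y : Vec d) :
    |V y - V x| ≤ M * ‖y - x‖ := by
  have hcont : Continuous V := by
    rw [continuous_iff_continuousAt]
    intro z
    rw [ContinuousAt, tendsto_iff_dist_tendsto_zero]
    have h0 : Tendsto (fun y => M * ‖y - z‖) (𝓝 z) (𝓝 0) := by
      have : Continuous fun y => M * ‖y - z‖ := by fun_prop
      simpa using this.tendsto z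
    exact squeeze_zero' (Eventually.of_forall fun _ => dist_nonneg) (h z) h0
  set ℓ : ℝ → Vec d := fun t => x + t • (y - x) with hℓ
  have hℓc : Continuous ℓ := by fun_prop
  have key : ∀ ε > 0, |V y - V x| ≤ M * ‖y - x‖ + ε := by
    intro ε hε
    have := image_norm_le_of_liminf_right_slope_norm_lt_deriv_boundary
      (f := fun t => V (ℓ t) - V x) (f' := fun _ => M * ‖y - x‖) (a := 0) (b := 1)
      (B := fun t => (M * ‖y - x‖ + ε) * t) (B' := fun _ => M * ‖y - x‖ + ε)
      (by fun_prop) ?_ (by simp [hℓ]) (by fun_prop)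
      (fun t _ => by simpa using ((hasDerivAt_id t).const_mul (M * ‖y - x‖ + ε)).hasDerivWithinAt)
      (fun t _ _ => by linarith) (right_mem_Icc.2 zero_le_one)
    · simpa [hℓ] using this
    · intro t _ r hr
      refine Eventually.frequently ?_
      have h1 : ∀ᶠ s in 𝓝[>] t, |V (ℓ s) - V (ℓ t)| ≤ M * ‖ℓ s - ℓ t‖ :=
        ((hℓc.tendsto t).eventually (h (ℓ t))).filter_mono nhdsWithin_le_nhds
      filter_upwards [h1, self_mem_nhdsWithin] with s hs hts
      have hts' : 0 < s - t := sub_pos.2 hts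
      have e : ℓ s - ℓ t = (s - t) • (y - x) := by
        simp only [hℓ]
        module
      rw [e, norm_smul, Real.norm_of_nonneg hts'.le] at hs
      refine lt_of_le_of_lt ?_ hr
      rw [slope_def_field, div_le_iff₀ hts']
      simp only [Function.comp_apply]
      calc ‖V (ℓ s) - V x‖ - ‖V (ℓ t) - V x‖ ≤ ‖(V (ℓ s) - V x) - (V (ℓ t) - V x)‖ :=
            norm_sub_norm_le _ _
        _ = |V (ℓ s) - V (ℓ t)| := by rw [sub_sub_sub_cancel_right, Real.norm_eq_abs]
        _ ≤ M * ‖y - x‖ * (s - t) := by linarith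
  exact le_of_forall_pos_le_add key

lemma integrable_normed_mul (b : ContDiffBump (0 : Vec d)) {F : Vec d → ℝ} (hF : Continuous F) :
    Integrable fun t => b.normed volume t * F t :=
  (b.continuous_normed.mul hF).integrable_of_hasCompactSupport
    b.hasCompactSupport_normed.mul_right

lemma abs_integral_normed_mul_le (b : ContDiffBump (0 : Vec d)) {F : Vec d → ℝ} {B : ℝ}
    (h : ∀ t ∈ Metric.ball (0 : Vec d) b.rOut, |F t| ≤ B) :
    |∫ t, b.normed volume t * F t| ≤ B := by
  have h1 : |∫ t, b.normed volume t * F t| ≤ ∫ t, b.normed volume t * B := by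
    rw [← Real.norm_eq_abs]
    refine norm_integral_le_of_norm_le (integrable_normed_mul b continuous_const)
      (ae_of_all _ fun t => ?_)
    rw [norm_mul, Real.norm_of_nonneg (b.nonneg_normed t)]
    by_cases ht : t ∈ Metric.ball (0 : Vec d) b.rOut
    · exact mul_le_mul_of_nonneg_left (h t ht) (b.nonneg_normed t)
    · have : b.normed (volume : Measure (Vec d)) t = 0 := by
        rw [← Function.notMem_support, b.support_normed_eq]
        exact ht
      rw [this, zero_mul, zero_mul]
  rwa [integral_mul_const, b.integral_normed, one_mul] at h1

lemma mollify_apply (b : ContDiffBump (0 : Vec d)) (W : Vec d → ℝ) (x : Vec d) :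
    mollify b W x = ∫ t, b.normed volume t * W (x - t) := rfl

lemma abs_mollify_sub_le (b : ContDiffBump (0 : Vec d)) {W : Vec d → ℝ} (hW : Continuous W)
    {x : Vec d} {k B : ℝ} (h : ∀ t ∈ Metric.ball (0 : Vec d) b.rOut, |W (x - t) - k| ≤ B) :
    |mollify b W x - k| ≤ B := by
  have e : mollify b W x - k = ∫ t, b.normed volume t * (W (x - t) - k) := by
    simp only [mul_sub]
    rw [integral_sub (integrable_normed_mul b (by fun_prop))
      (integrable_normed_mul b continuous_const), integral_mul_const, b.integral_normed, one_mul,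
      mollify_apply]
  rw [e]
  exact abs_integral_normed_mul_le b h

lemma abs_mollify_sub_mollify_sub_le (b : ContDiffBump (0 : Vec d)) {W : Vec d → ℝ}
    (hW : Continuous W) {x y : Vec d} {k B : ℝ}
    (h : ∀ t ∈ Metric.ball (0 : Vec d) b.rOut, |W (y - t) - W (x - t) - k| ≤ B) :
    |mollify b W y - mollify b W x - k| ≤ B := by
  have e : mollify b W y - mollify b W x - k =
      ∫ t, b.normed volume t * (W (y - t) - W (x - t) - k) := by
    have hy : Continuous fun t => W (y - t) := by fun_prop
    have hx : Continuous fun t => W (x - t) := by fun_prop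
    have h1 := integral_sub (integrable_normed_mul b (hy.sub hx))
      (integrable_normed_mul b (continuous_const (y := k)))
    simp only [← mul_sub, Pi.sub_apply] at h1
    rw [h1]
    simp only [mul_sub]
    rw [integral_sub (integrable_normed_mul b hy) (integrable_normed_mul b hx),
      integral_mul_const, b.integral_normed, one_mul, mollify_apply, mollify_apply]
  rw [e]
  exact abs_integral_normed_mul_le b h

/-- A convex domain can be shrunk into itself. -/
lemma exists_isCompact_dilation {Ω : Set (Vec d)} (hΩo : IsOpen Ω) (hΩb : Bornology.IsBounded Ω)
    (hΩc : Convex ℝ Ω) {x₀ : Vec d} (hx₀ : x₀ ∈ Ω) {θ : ℝ} (hθ : 0 < θ) :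
    ∃ K, IsCompact K ∧ K ⊆ Ω ∧ ∀ x, x₀ + (1 + θ) • (x - x₀) ∈ Ω → x ∈ K := by
  refine ⟨(fun y => x₀ + (1 + θ)⁻¹ • (y - x₀)) '' closure Ω,
    hΩb.isCompact_closure.image (by fun_prop), ?_, fun x hx => ⟨_, subset_closure hx, ?_⟩⟩
  · rintro _ ⟨y, hy, rfl⟩
    have h1 : (1 + θ)⁻¹ < 1 := inv_lt_one_of_one_lt₀ (by linarith)
    have h2 : (0 : ℝ) ≤ (1 + θ)⁻¹ := by positivity
    have := hΩc.combo_interior_closure_mem_interior (hΩo.interior_eq.symm ▸ hx₀) hy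
      (a := 1 - (1 + θ)⁻¹) (b := (1 + θ)⁻¹) (by linarith) h2 (by ring)
    rw [hΩo.interior_eq] at this
    convert this using 1
    module
  · have : (1 + θ) ≠ 0 := by positivity
    simp only [add_sub_cancel_left, smul_smul, inv_mul_cancel₀ this, one_smul, add_sub_cancel]

theorem memH01_of_lipschitz {Ω : Set (Vec d)} (hΩo : IsOpen Ω) (hΩb : Bornology.IsBounded Ω)
    (hΩc : Convex ℝ Ω) (hΩn : Ω.Nonempty) {V : Vec d → ℝ} {G : Vec d → Vec d} {M : ℝ}
    (hM : 0 ≤ M) (hV : ∀ x y, |V y - V x| ≤ M * ‖y - x‖) (hV0 : ∀ x ∉ Ω, V x = 0)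
    (hG : MemLp G 2 (volume.restrict Ω))
    (hloc : ∀ᵐ x ∂(volume.restrict Ω), ∀ᶠ y in 𝓝 x, V y = V x + inner ℝ (G x) (y - x)) :
    MemH01 Ω V G := by
  obtain ⟨x₀, hx₀⟩ := hΩn
  obtain ⟨R, hR⟩ := hΩb.subset_ball x₀
  have hfin : IsFiniteMeasure (volume.restrict Ω : Measure (Vec d)) :=
    ⟨by rw [Measure.restrict_apply_univ]; exact hΩb.measure_lt_top⟩
  have hVc : Continuous V := by
    refine (LipschitzWith.of_dist_le_mul (K := ⟨M, hM⟩) fun x y => ?_).continuous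
    rw [dist_comm x y, dist_comm (V x), dist_eq_norm, dist_eq_norm]
    exact hV x y
  set θ : ℕ → ℝ := fun n => 1 / (n + 1) with hθ
  have hθ0 : ∀ n, 0 < θ n := fun n => by simp only [hθ]; positivity
  have hθ1 : ∀ n, θ n ≤ 1 := fun n => by
    simp only [hθ]
    rw [div_le_one (by positivity)]
    linarith [(n.cast_nonneg : (0 : ℝ) ≤ n)]
  have hθt : Tendsto θ atTop (𝓝 0) := tendsto_one_div_add_atTop_nhds_zero_nat
  set S : ℕ → Vec d → Vec d := fun n x => x₀ + (1 + θ n) • (x - x₀) with hS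
  have hSc : ∀ n, Continuous (S n) := fun n => by fun_prop
  have hSsub : ∀ n x y, S n y - S n x = (1 + θ n) • (y - x) := fun n x y => by
    simp only [hS]
    module
  set W : ℕ → Vec d → ℝ := fun n x => V (S n x) with hW
  have hWc : ∀ n, Continuous (W n) := fun n => hVc.comp (hSc n)
  have hWlip : ∀ n x y, |W n y - W n x| ≤ 2 * M * ‖y - x‖ := by
    intro n x y
    refine (hV _ _).trans ?_
    rw [hSsub, norm_smul, Real.norm_of_nonneg (by linarith [hθ0 n])]
    have h2 : 1 + θ n ≤ 2 := by linarith [hθ1 n]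
    calc M * ((1 + θ n) * ‖y - x‖) ≤ M * (2 * ‖y - x‖) := by gcongr
      _ = _ := by ring
  choose K hKc hKΩ hK using fun n => exists_isCompact_dilation hΩo hΩb hΩc hx₀ (hθ0 n)
  choose δ hδ0 hδ using fun n => (hKc n).exists_cthickening_subset_open hΩo (hKΩ n)
  set b : ℕ → ContDiffBump (0 : Vec d) := fun n =>
    ⟨min (δ n) (θ n) / 2, min (δ n) (θ n), half_pos (lt_min (hδ0 n) (hθ0 n)),
      half_lt_self (lt_min (hδ0 n) (hθ0 n))⟩ with hb
  have hbδ : ∀ n, (b n).rOut ≤ δ n := fun n => min_le_left _ _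
  have hbθ : ∀ n, (b n).rOut ≤ θ n := fun n => min_le_right _ _
  set φ : ℕ → Vec d → ℝ := fun n => mollify (b n) (W n) with hφ
  have hφs : ∀ n, ContDiff ℝ ∞ (φ n) := fun n =>
    contDiff_mollify (b n) (hWc n).locallyIntegrable
  have hsupp : ∀ n, Function.support (φ n) ⊆ Metric.cthickening (δ n) (K n) := by
    intro n x hx
    by_contra hn
    refine hx ?_
    have : |φ n x - 0| ≤ 0 := by
      refine abs_mollify_sub_le (b n) (hWc n) fun t ht => ?_
      rw [sub_zero, abs_nonpos_iff]
      refine hV0 _ fun hmem => hn ?_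
      refine Metric.mem_cthickening_of_dist_le x (x - t) _ _ (hK n _ hmem) ?_
      rw [dist_eq_norm, sub_sub_cancel, ← dist_zero_right]
      exact (Metric.mem_ball.1 ht).le.trans (hbδ n)
    rwa [sub_zero, abs_nonpos_iff] at this
  have htest : ∀ n, IsTest Ω (φ n) := fun n =>
    ⟨hφs n, HasCompactSupport.of_support_subset_isCompact (hKc n).cthickening (hsupp n),
      (closure_minimal (hsupp n) Metric.isClosed_cthickening).trans (hδ n)⟩
  have hgrad : ∀ n x, ‖gradient (φ n) x‖ ≤ 2 * M := by
    intro n x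
    rw [norm_gradient]
    refine norm_fderiv_le_of_lip' ℝ (by positivity) (Eventually.of_forall fun y => ?_)
    have := abs_mollify_sub_mollify_sub_le (b n) (hWc n) (x := x) (y := y) (k := 0)
      (B := 2 * M * ‖y - x‖) fun t _ => by
        have := hWlip n (x - t) (y - t)
        rwa [sub_sub_sub_cancel_right, ← sub_zero (W n (y - t) - W n (x - t))] at this
    rwa [sub_zero] at this
  have hR0 : 0 < R := Metric.nonempty_ball.1 ⟨x₀, hR hx₀⟩
  have hclose : ∀ n, ∀ x ∈ Ω, |φ n x - V x| ≤ (2 * M + M * R) * θ n := by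
    intro n x hx
    have h1 : |φ n x - W n x| ≤ 2 * M * θ n := by
      refine abs_mollify_sub_le (b n) (hWc n) fun t ht => (hWlip n _ _).trans ?_
      rw [sub_sub_cancel_left, norm_neg, ← dist_zero_right]
      have := (Metric.mem_ball.1 ht).le.trans (hbθ n)
      gcongr
    have h2 : |W n x - V x| ≤ M * R * θ n := by
      refine (hV _ _).trans ?_
      have e : S n x - x = θ n • (x - x₀) := by
        simp only [hS]
        module
      have h3 := (Metric.mem_ball.1 (hR hx)).le
      rw [dist_eq_norm] at h3
      rw [e, norm_smul, Real.norm_of_nonneg (hθ0 n).le]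
      calc M * (θ n * ‖x - x₀‖) ≤ M * (θ n * R) := by
            have := (hθ0 n).le
            gcongr
        _ = _ := by ring
    have := abs_sub_le (φ n x) (W n x) (V x)
    linarith
  have hVmem : MemLp V 2 (volume.restrict Ω) := memLp_of_continuous hΩb hVc
  have hgradlim : ∀ᵐ x ∂(volume.restrict Ω), Tendsto (fun n => gradient (φ n) x) atTop (𝓝 (G x)) := by
    filter_upwards [hloc] with x hx
    obtain ⟨η, hη, hxη⟩ := Metric.eventually_nhds_iff_ball.1 hx
    have hsmall : ∀ᶠ n in atTop, ‖S n x - x‖ + 2 * θ n < η / 2 := by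
      have h0 : Tendsto (fun n => ‖S n x - x‖ + 2 * θ n) atTop (𝓝 0) := by
        have e : ∀ n, S n x - x = θ n • (x - x₀) := fun n => by
          simp only [hS]
          module
        simp only [e]
        simpa using ((hθt.smul_const (x - x₀)).norm).add (hθt.const_mul 2)
      exact h0.eventually_lt_const (by positivity)
    have heq : ∀ᶠ n in atTop, (1 + θ n) • G x = gradient (φ n) x := by
      filter_upwards [hsmall] with n hn
      have hpt : ∀ y ∈ Metric.ball x (η / 4), ∀ t ∈ Metric.ball (0 : Vec d) (b n).rOut,
          S n (y - t) ∈ Metric.ball x η := by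
        intro y hy t ht
        rw [Metric.mem_ball, dist_eq_norm] at hy ⊢
        have ht' : ‖t‖ ≤ θ n := by
          rw [← dist_zero_right]
          exact (Metric.mem_ball.1 ht).le.trans (hbθ n)
        have e : S n (y - t) - x = (S n x - x) + (1 + θ n) • ((y - x) - t) := by
          simp only [hS]
          module
        rw [e]
        refine (norm_add_le _ _).trans_lt ?_
        rw [norm_smul, Real.norm_of_nonneg (by linarith [hθ0 n])]
        have h1 := norm_sub_le (y - x) t
        have h2 : (1 + θ n) * ‖(y - x) - t‖ ≤ 2 * (‖y - x‖ + ‖t‖) := by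
          have := hθ1 n
          have := (hθ0 n).le
          gcongr
          linarith
        linarith
      have haff : ∀ᶠ y in 𝓝 x, φ n y = φ n x + inner ℝ ((1 + θ n) • G x) (y - x) := by
        filter_upwards [Metric.ball_mem_nhds x (by positivity : 0 < η / 4)] with y hy
        have := abs_mollify_sub_mollify_sub_le (b n) (hWc n) (x := x) (y := y)
          (k := inner ℝ ((1 + θ n) • G x) (y - x)) (B := 0) fun t ht => by
            rw [abs_nonpos_iff]
            simp only [hW]
            rw [hxη _ (hpt y hy t ht), hxη _ (hpt x (Metric.mem_ball_self (by positivity)) t ht),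
              add_sub_add_left_eq_sub, ← inner_sub_right, sub_sub_sub_cancel_right, hSsub,
              sub_sub_sub_cancel_right, inner_smul_right, inner_smul_left]
            simp
        rw [abs_nonpos_iff] at this
        simp only [hφ]
        linarith
      have hg := hasGradientAt_affine (φ n x) ((1 + θ n) • G x) x x
      exact ((hg.congr_of_eventuallyEq haff).gradient).symm
    have h1 : Tendsto (fun n => (1 + θ n) • G x) atTop (𝓝 (G x)) := by
      have := (hθt.const_add 1).smul_const (G x)
      simpa using this
    exact h1.congr' heq
  refine memH01_of_tendsto hVmem hG htest ?_ ?_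
  · have h0 : Tendsto (fun n => ∫ _ in Ω, ((2 * M + M * R) * θ n) ^ 2) atTop (𝓝 0) := by
      simp only [setIntegral_const, smul_eq_mul]
      simpa using (((hθt.const_mul (2 * M + M * R)).pow 2).const_mul (volume.real Ω))
    refine squeeze_zero (fun n => integral_norm_sq_nonneg _) (fun n => ?_) h0
    refine setIntegral_mono_on (integrable_norm_sq (((htest n).memLp 2 _).sub hVmem))
      (integrable_const _) hΩo.measurableSet fun x hx => ?_
    rw [Real.norm_eq_abs]
    exact pow_le_pow_left₀ (abs_nonneg _) (hclose n x hx) 2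
  · have h0 : (0 : ℝ) = ∫ x in Ω, (0 : ℝ) := by simp
    rw [h0]
    refine tendsto_integral_of_dominated_convergence
      (fun x => 2 * (2 * M) ^ 2 + 2 * ‖G x‖ ^ 2)
      (fun n => (integrable_norm_sq (((htest n).memLp_gradient 2 _).sub hG)).aestronglyMeasurable)
      ((integrable_const _).add ((integrable_norm_sq hG).const_mul 2)) (fun n => ?_) ?_
    · refine ae_of_all _ fun x => ?_
      rw [Real.norm_of_nonneg (by positivity)]
      have h1 := norm_sub_le (gradient (φ n) x) (G x)
      have h2 := hgrad n x
      have h3 : ‖gradient (φ n) x - G x‖ ^ 2 ≤ (2 * M + ‖G x‖) ^ 2 :=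
        pow_le_pow_left₀ (norm_nonneg _) (by linarith) 2
      nlinarith [sq_nonneg (2 * M - ‖G x‖)]
    · filter_upwards [hgradlim] with x hx
      have := ((hx.sub_const (G x)).norm).pow 2
      simpa using this

/-! ### Piecewise affine functions with given nodal values -/

/-- The function that is `c K + ⟨g K, x⟩` on each simplex `K`, and zero elsewhere. -/
def piecewiseAffine (T : Finset (Finset (Vec d))) (c : Finset (Vec d) → ℝ)
    (g : Finset (Vec d) → Vec d) (x : Vec d) : ℝ :=
  open Classical in
  if h : ∃ K ∈ T, x ∈ simplex K then c h.choose + inner ℝ (g h.choose) x else 0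

/-- The function that is `g K` on the interior of each simplex `K`, and zero elsewhere. -/
def piecewiseConst (T : Finset (Finset (Vec d))) (g : Finset (Vec d) → Vec d)
    (x : Vec d) : Vec d :=
  ∑ K ∈ T, (interior (simplex K)).indicator (fun _ => g K) x

variable {Ω : Set (Vec d)} {T : Finset (Finset (Vec d))} {c : Finset (Vec d) → ℝ}
  {g : Finset (Vec d) → Vec d} {a : Vec d → ℝ}

lemma piecewiseAffine_eq (hT : IsTriangulation Ω T)
    (ha : ∀ K ∈ T, ∀ p ∈ K, c K + inner ℝ (g K) p = a p) {K : Finset (Vec d)} (hK : K ∈ T)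
    {x : Vec d} (hx : x ∈ simplex K) : piecewiseAffine T c g x = c K + inner ℝ (g K) x := by
  have h : ∃ K ∈ T, x ∈ simplex K := ⟨K, hK, hx⟩
  rw [piecewiseAffine, dif_pos h]
  have hmem : x ∈ simplex h.choose ∩ simplex K := ⟨h.choose_spec.2, hx⟩
  rw [hT.inter _ h.choose_spec.1 K hK] at hmem
  refine affine_eq_of_mem_convexHull (fun p hp => ?_) hmem
  rw [ha _ h.choose_spec.1 p hp.1, ha K hK p hp.2]

lemma piecewiseConst_eq (hT : IsTriangulation Ω T) {K : Finset (Vec d)} (hK : K ∈ T)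
    {x : Vec d} (hx : x ∈ interior (simplex K)) : piecewiseConst T g x = g K := by
  rw [piecewiseConst, Finset.sum_eq_single K, indicator_of_mem hx]
  · intro K' hK' hne
    exact indicator_of_notMem
      (fun hx' => Set.disjoint_left.1 (hT.disjoint_interior hK hK' hne.symm) hx hx') _
  · exact fun h => absurd hK h

lemma ae_restrict_simplex_iff {K : Finset (Vec d)} {P : Vec d → Prop} :
    (∀ᵐ x ∂(volume.restrict (simplex K)), P x) ↔
      ∀ᵐ x ∂volume, x ∈ interior (simplex K) → P x := by
  rw [← restrict_interior_simplex, ae_restrict_iff' measurableSet_interior]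

lemma IsTriangulation.ae_restrict_iff (hT : IsTriangulation Ω T) (hΩc : Convex ℝ Ω)
    {P : Vec d → Prop} : (∀ᵐ x ∂(volume.restrict Ω), P x) ↔
      ∀ K ∈ T, ∀ᵐ x ∂volume, x ∈ interior (simplex K) → P x := by
  refine Iff.trans ?_ (forall₂_congr fun K _ => ae_restrict_simplex_iff)
  rw [hT.restrict_eq hΩc]
  simp only [ae_iff, Measure.finsetSum_apply, Finset.sum_eq_zero_iff]

lemma IsTriangulation.vertex_mem_closure (hT : IsTriangulation Ω T) {K : Finset (Vec d)}
    (hK : K ∈ T) {p : Vec d} (hp : p ∈ K) : p ∈ closure Ω :=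
  hT.simplex_subset hK (mem_simplex hp)

/-- An affine function on a simplex is at most zero at a point outside of the domain, if it is at
most zero at the vertices outside of the domain. -/
lemma IsTriangulation.affine_nonpos (hT : IsTriangulation Ω T) (hΩo : IsOpen Ω) (hΩc : Convex ℝ Ω)
    {K : Finset (Vec d)} (hK : K ∈ T) {c₀ : ℝ} {g₀ : Vec d}
    (ha : ∀ p ∈ K, p ∉ Ω → c₀ + inner ℝ g₀ p ≤ 0) {x : Vec d} (hx : x ∈ simplex K) (hxΩ : x ∉ Ω) :
    c₀ + inner ℝ g₀ x ≤ 0 := by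
  obtain ⟨f, hf⟩ := geometric_hahn_banach_open_point hΩc hΩo hxΩ
  have hfc : ∀ y ∈ closure Ω, f y ≤ f x := fun y hy =>
    closure_minimal (fun z hz => (hf z hz).le) (isClosed_le f.continuous continuous_const) hy
  set N : ℝ := ∑ p ∈ K, |c₀ + inner ℝ g₀ p| / (f x - f p) with hN
  have hterm : ∀ p ∈ K, 0 ≤ |c₀ + inner ℝ g₀ p| / (f x - f p) := fun p hp =>
    div_nonneg (abs_nonneg _) (sub_nonneg.2 (hfc p (hT.vertex_mem_closure hK hp)))
  have hN0 : 0 ≤ N := Finset.sum_nonneg hterm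
  set w := (InnerProductSpace.toDual ℝ (Vec d)).symm f with hw
  have hwf : ∀ y, inner ℝ w y = f y := fun y => InnerProductSpace.toDual_symm_apply
  have hvert : ∀ p ∈ K, c₀ + inner ℝ (g₀ + N • w) p ≤ N * f x := by
    intro p hp
    rw [inner_add_left, real_inner_smul_left, hwf]
    by_cases hpΩ : p ∈ Ω
    · have h1 : 0 < f x - f p := sub_pos.2 (hf p hpΩ)
      have h2 : |c₀ + inner ℝ g₀ p| / (f x - f p) ≤ N := Finset.single_le_sum hterm hp
      rw [div_le_iff₀ h1] at h2
      linarith [le_abs_self (c₀ + inner ℝ g₀ p)]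
    · have h1 := ha p hp hpΩ
      have h2 := mul_le_mul_of_nonneg_left (hfc p (hT.vertex_mem_closure hK hp)) hN0
      linarith
  have := affine_le_of_mem_convexHull hvert hx
  rw [inner_add_left, real_inner_smul_left, hwf] at this
  linarith

lemma piecewiseAffine_eq_zero (hT : IsTriangulation Ω T) (hΩo : IsOpen Ω) (hΩc : Convex ℝ Ω)
    (ha : ∀ K ∈ T, ∀ p ∈ K, c K + inner ℝ (g K) p = a p) (ha0 : ∀ p ∉ Ω, a p = 0)
    {x : Vec d} (hx : x ∉ Ω) : piecewiseAffine T c g x = 0 := by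
  by_cases h : ∃ K ∈ T, x ∈ simplex K
  · obtain ⟨K, hK, hxK⟩ := h
    rw [piecewiseAffine_eq hT ha hK hxK]
    have h0 : ∀ p ∈ K, p ∉ Ω → c K + inner ℝ (g K) p = 0 := fun p hp hpΩ => by
      rw [ha K hK p hp, ha0 p hpΩ]
    refine le_antisymm (hT.affine_nonpos hΩo hΩc hK (fun p hp hpΩ => (h0 p hp hpΩ).le) hxK hx) ?_
    have h1 := hT.affine_nonpos hΩo hΩc hK (c₀ := -c K) (g₀ := -g K) (fun p hp hpΩ => by
      rw [inner_neg_left]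
      linarith [h0 p hp hpΩ]) hxK hx
    rw [inner_neg_left] at h1
    linarith
  · rw [piecewiseAffine, dif_neg h]

lemma piecewiseAffine_eventually (hT : IsTriangulation Ω T) (hΩo : IsOpen Ω) (hΩc : Convex ℝ Ω)
    (ha : ∀ K ∈ T, ∀ p ∈ K, c K + inner ℝ (g K) p = a p) (ha0 : ∀ p ∉ Ω, a p = 0) (x : Vec d) :
    ∀ᶠ y in 𝓝 x, |piecewiseAffine T c g y - piecewiseAffine T c g x| ≤
      (∑ K ∈ T, ‖g K‖) * ‖y - x‖ := by
  have h1 : ∀ᶠ y in 𝓝 x, ∀ K ∈ T, y ∈ simplex K → x ∈ simplex K := by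
    refine (Finset.eventually_all T).2 fun K _ => ?_
    by_cases hx : x ∈ simplex K
    · exact Eventually.of_forall fun _ _ => hx
    · filter_upwards [(isClosed_simplex K).isOpen_compl.mem_nhds hx] with y hy h
      exact absurd h hy
  have h2 : ∀ᶠ y in 𝓝 x, x ∈ Ω → y ∈ Ω := by
    by_cases hx : x ∈ Ω
    · filter_upwards [hΩo.mem_nhds hx] with y hy _ using hy
    · exact Eventually.of_forall fun _ h => absurd h hx
  filter_upwards [h1, h2] with y hy1 hy2
  by_cases hy : ∃ K ∈ T, y ∈ simplex K
  · obtain ⟨K, hK, hyK⟩ := hy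
    rw [piecewiseAffine_eq hT ha hK hyK, piecewiseAffine_eq hT ha hK (hy1 K hK hyK),
      add_sub_add_left_eq_sub, ← inner_sub_right]
    refine (abs_real_inner_le_norm _ _).trans ?_
    have := Finset.single_le_sum (f := fun K => ‖g K‖) (fun _ _ => norm_nonneg _) hK
    gcongr
  · have hyΩ : y ∉ Ω := by
      intro h
      have h3 : y ∈ ⋃ K ∈ T, simplex K := by
        rw [hT.cover]
        exact subset_closure h
      simp only [mem_iUnion] at h3
      obtain ⟨K, hK, h4⟩ := h3
      exact hy ⟨K, hK, h4⟩
    rw [piecewiseAffine_eq_zero hT hΩo hΩc ha ha0 hyΩ,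
      piecewiseAffine_eq_zero hT hΩo hΩc ha ha0 fun h => hyΩ (hy2 h), sub_zero, abs_zero]
    have : 0 ≤ ∑ K ∈ T, ‖g K‖ := Finset.sum_nonneg fun _ _ => norm_nonneg _
    positivity

lemma memLp_piecewiseConst (hΩb : Bornology.IsBounded Ω) :
    MemLp (piecewiseConst T g) 2 (volume.restrict Ω) := by
  have : piecewiseConst T g = ∑ K ∈ T, (interior (simplex K)).indicator (fun _ => g K) := by
    ext1 x
    rw [piecewiseConst, Finset.sum_apply]
  rw [this]
  exact memLp_finsetSum' T fun K _ => (memLp_const_restrict hΩb (g K)).indicator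
    measurableSet_interior

/-- Nodal values that vanish on the boundary define a finite element function. -/
theorem memXH_piecewiseAffine (hT : IsTriangulation Ω T) (hΩo : IsOpen Ω)
    (hΩb : Bornology.IsBounded Ω) (hΩc : Convex ℝ Ω) (hΩn : Ω.Nonempty)
    (ha : ∀ K ∈ T, ∀ p ∈ K, c K + inner ℝ (g K) p = a p) (ha0 : ∀ p ∉ Ω, a p = 0) :
    MemXH Ω T (piecewiseAffine T c g) (piecewiseConst T g) g := by
  refine ⟨memH01_of_lipschitz hΩo hΩb hΩc hΩn (Finset.sum_nonneg fun K _ => norm_nonneg (g K))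
    (abs_sub_le_of_eventually (piecewiseAffine_eventually hT hΩo hΩc ha ha0))
    (fun x hx => piecewiseAffine_eq_zero hT hΩo hΩc ha ha0 hx) (memLp_piecewiseConst hΩb) ?_,
    fun K hK => ⟨c K, ?_⟩⟩
  · rw [hT.ae_restrict_iff hΩc]
    refine fun K hK => ae_of_all _ fun x hx => ?_
    filter_upwards [isOpen_interior.mem_nhds hx] with y hy
    rw [piecewiseAffine_eq hT ha hK (interior_subset hy),
      piecewiseAffine_eq hT ha hK (interior_subset hx), piecewiseConst_eq hT hK hx, inner_sub_right]
    ring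
  · exact ae_restrict_simplex_iff.2 (ae_of_all _ fun x hx =>
      piecewiseAffine_eq hT ha hK (interior_subset hx))

/-- The weak gradient of a finite element function is constant on each simplex. -/
lemma MemXH.ae_eq (hT : IsTriangulation Ω T) (hΩo : IsOpen Ω) (hΩc : Convex ℝ Ω)
    (hΩn : Ω.Nonempty) {Z : Vec d → ℝ} {G : Vec d → Vec d} (h : MemXH Ω T Z G g)
    {K : Finset (Vec d)} (hK : K ∈ T) : ∀ᵐ x ∂(volume.restrict (simplex K)), G x = g K := by
  obtain ⟨c₀, hc₀⟩ := h.2 K hK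
  have hsub := hT.interior_simplex_subset hΩo hΩc hΩn hK
  have h1 := h.1.1.mono hsub
  have h2 := memH1_affine ((isCompact_simplex K).isBounded.subset
    (interior_subset (s := simplex K))) c₀ (g K) 0
  rw [← restrict_interior_simplex] at hc₀ ⊢
  refine ae_eq_of_hasWeakGradient isOpen_interior h1.2.1 h2.2.1 h1.2.2 h2.2.2 ?_
  filter_upwards [hc₀] with x hx
  rw [hx, sub_zero]

/-! ### Interpolation by finite element functions -/

/-- The square of the `L²(U)`-norm of the Hessian `D`. -/
def hessianSq (D : Fin d → Vec d → Vec d) (U : Set (Vec d)) : ℝ :=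
  ∑ i, ∫ x in U, ‖D i x‖ ^ 2

lemma hessianSq_nonneg (D : Fin d → Vec d → Vec d) (U : Set (Vec d)) : 0 ≤ hessianSq D U :=
  Finset.sum_nonneg fun _ _ => integral_norm_sq_nonneg _

lemma setIntegral_norm_sq_mono {E : Type*} [NormedAddCommGroup E] {f : Vec d → E}
    {U U' : Set (Vec d)} (hf : MemLp f 2 (volume.restrict U')) (h : U ⊆ U') :
    ∫ x in U, ‖f x‖ ^ 2 ≤ ∫ x in U', ‖f x‖ ^ 2 :=
  setIntegral_mono_set (integrable_norm_sq hf) (ae_of_all _ fun _ => by positivity)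
    (LE.le.eventuallyLE h)

lemma hessianSq_mono {D : Fin d → Vec d → Vec d} {U U' : Set (Vec d)}
    (hD : ∀ i, MemLp (D i) 2 (volume.restrict U')) (h : U ⊆ U') :
    hessianSq D U ≤ hessianSq D U' :=
  Finset.sum_le_sum fun i _ => setIntegral_norm_sq_mono (hD i) h

lemma mul_norm_le_of_abs_affine_le {c g : Vec d} {ρ b m : ℝ} (hρ : 0 < ρ)
    (h : ∀ x ∈ Metric.ball c ρ, |b + inner ℝ g x| ≤ m) : ρ * ‖g‖ ≤ 2 * m := by
  rcases eq_or_ne g 0 with rfl | hg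
  · have := (abs_nonneg _).trans (h c (Metric.mem_ball_self hρ))
    simpa using this
  · have hg' : 0 < ‖g‖ := norm_pos_iff.2 hg
    set v := (ρ / 2 * ‖g‖⁻¹) • g with hv
    have hvn : ‖v‖ = ρ / 2 := by
      rw [hv, norm_smul, Real.norm_of_nonneg (by positivity)]
      field_simp
    have hgv : inner ℝ g v = ρ / 2 * ‖g‖ := by
      rw [hv, inner_smul_right, real_inner_self_eq_norm_sq]
      field_simp
    have h1 := h (c + v) (by rw [Metric.mem_ball, dist_eq_norm, add_sub_cancel_left, hvn]; linarith)
    have h2 := h (c - v) (by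
      rw [Metric.mem_ball, dist_eq_norm, sub_sub_cancel_left, norm_neg, hvn]; linarith)
    rw [inner_add_right, hgv] at h1
    rw [inner_sub_right, hgv] at h2
    linarith [(abs_le.1 h1).2, (abs_le.1 h2).1]

variable {Ω : Set (Vec d)} {T : Finset (Finset (Vec d))}

/-- The local interpolation constant. -/
def localInterpConst (d : ℕ) (κ : ℝ) : ℝ :=
  approxConst d (κ / 2) * (8 + 1280 * ((2 / κ) ^ d * (κ ^ 2)⁻¹))

lemma approxConst_nonneg {κ : ℝ} (hκ : 0 < κ) : 0 ≤ approxConst d κ := by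
  unfold approxConst
  positivity

lemma localInterpConst_nonneg {κ : ℝ} (hκ : 0 < κ) : 0 ≤ localInterpConst d κ := by
  have := approxConst_nonneg (d := d) (half_pos hκ)
  unfold localInterpConst
  positivity

/-- If `u` is approximated by affine functions around the vertices of `K`, then the affine function
with the corresponding nodal values approximates `u` on `K`. -/
lemma IsTriangulation.local_interpolation (hT : IsTriangulation Ω T) (hΩo : IsOpen Ω)
    (hΩb : Bornology.IsBounded Ω) (hΩc : Convex ℝ Ω) (hΩn : Ω.Nonempty) {κ H : ℝ} (hκ : 0 < κ)
    (hH : 0 < H) {K : Finset (Vec d)} (hK : K ∈ T) (hKH : diamK K ≤ H) {c : Vec d}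
    (hc : Metric.ball c (κ * H) ⊆ simplex K) {u : Vec d → ℝ} {G : Vec d → Vec d}
    {D : Fin d → Vec d → Vec d} (hu2 : MemH2 Ω u G D) {a : Vec d → ℝ} {gv : Vec d → Vec d}
    (h1 : ∀ p ∈ K, (∫ x in Ω ∩ Metric.ball p (2 * H), ‖u x - (a p + inner ℝ (gv p) (x - p))‖ ^ 2) ≤
      approxConst d (κ / 2) * (2 * H) ^ 4 * hessianSq D (Ω ∩ Metric.ball p (2 * H)))
    (h2 : ∀ p ∈ K, (∫ x in Ω ∩ Metric.ball p (2 * H), ‖G x - gv p‖ ^ 2) ≤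
      approxConst d (κ / 2) * (2 * H) ^ 2 * hessianSq D (Ω ∩ Metric.ball p (2 * H)))
    {p₀ : Vec d} (hp₀ : p₀ ∈ K) {c₀ : ℝ} {g₀ : Vec d} (hg₀ : ∀ p ∈ K, c₀ + inner ℝ g₀ p = a p) :
    ∫ x in simplex K, ‖G x - g₀‖ ^ 2 ≤
      localInterpConst d κ * H ^ 2 * hessianSq D (Ω ∩ Metric.ball p₀ (4 * H)) := by
  set A := approxConst d (κ / 2) with hA
  have hA0 : 0 ≤ A := approxConst_nonneg (half_pos hκ)
  set E := hessianSq D (Ω ∩ Metric.ball p₀ (4 * H)) with hE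
  have hE0 : 0 ≤ E := hessianSq_nonneg _ _
  have hρ : 0 < κ * H := by positivity
  set B := Metric.ball c (κ * H) with hB
  have hBint : B ⊆ interior (simplex K) := interior_maximal hc Metric.isOpen_ball
  have hintΩ := hT.interior_simplex_subset hΩo hΩc hΩn hK
  have hdist : ∀ x ∈ simplex K, ∀ y ∈ simplex K, ‖x - y‖ ≤ H := fun x hx y hy =>
    (norm_sub_le_diamK hx hy).trans hKH
  have hKball : ∀ p ∈ K, simplex K ⊆ Metric.ball p (2 * H) := fun p hp x hx => by
    rw [Metric.mem_ball, dist_eq_norm]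
    linarith [hdist x hx p (mem_simplex hp)]
  have hKω : ∀ p ∈ K, interior (simplex K) ⊆ Ω ∩ Metric.ball p (2 * H) := fun p hp x hx =>
    ⟨hintΩ hx, hKball p hp (interior_subset hx)⟩
  have hωE : ∀ p ∈ K, hessianSq D (Ω ∩ Metric.ball p (2 * H)) ≤ E := by
    intro p hp
    refine hessianSq_mono (fun i => ((hu2.mono inter_subset_left).2 i).2.1) ?_
    refine inter_subset_inter_right _ fun x hx => ?_
    rw [Metric.mem_ball, dist_eq_norm] at hx ⊢
    have := norm_add_le (x - p) (p - p₀)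
    rw [sub_add_sub_cancel] at this
    linarith [hdist p (mem_simplex hp) p₀ (mem_simplex hp₀)]
  have hm1 : ∀ p ∈ K, MemLp (fun x => u x - (a p + inner ℝ (gv p) (x - p))) 2
      (volume.restrict (Ω ∩ Metric.ball p (2 * H))) := fun p _ =>
    ((hu2.mono inter_subset_left).1.1).sub
      (memH1_affine (hΩb.subset inter_subset_left) (a p) (gv p) p).1
  have hm2 : ∀ p ∈ K, MemLp (fun x => G x - gv p) 2
      (volume.restrict (Ω ∩ Metric.ball p (2 * H))) := fun p _ =>
    ((hu2.mono inter_subset_left).1.2.1).sub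
      (memLp_const_restrict (hΩb.subset inter_subset_left) (gv p))
  have hb1 : ∀ p ∈ K, ∫ x in B, ‖u x - (a p + inner ℝ (gv p) (x - p))‖ ^ 2 ≤ 16 * A * H ^ 4 * E := by
    intro p hp
    refine ((setIntegral_norm_sq_mono (hm1 p hp) (hBint.trans (hKω p hp))).trans (h1 p hp)).trans ?_
    calc A * (2 * H) ^ 4 * hessianSq D (Ω ∩ Metric.ball p (2 * H)) ≤ A * (2 * H) ^ 4 * E := by
          have := hωE p hp
          gcongr
      _ = _ := by ring
  have hb2 : ∀ p ∈ K, ∀ U ⊆ interior (simplex K),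
      ∫ x in U, ‖G x - gv p‖ ^ 2 ≤ 4 * A * H ^ 2 * E := by
    intro p hp U hU
    refine ((setIntegral_norm_sq_mono (hm2 p hp) (hU.trans (hKω p hp))).trans (h2 p hp)).trans ?_
    calc A * (2 * H) ^ 2 * hessianSq D (Ω ∩ Metric.ball p (2 * H)) ≤ A * (2 * H) ^ 2 * E := by
          have := hωE p hp
          gcongr
      _ = _ := by ring
  have hm1B : ∀ p ∈ K, MemLp (fun x => u x - (a p + inner ℝ (gv p) (x - p))) 2
      (volume.restrict B) := fun p hp =>
    (hm1 p hp).mono_measure (Measure.restrict_mono (hBint.trans (hKω p hp)) le_rfl)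
  have hm2B : ∀ p ∈ K, MemLp (fun x => G x - gv p) 2 (volume.restrict B) := fun p hp =>
    (hm2 p hp).mono_measure (Measure.restrict_mono (hBint.trans (hKω p hp)) le_rfl)
  set vB := volume.real B with hvB
  have hvB0 : 0 < vB := by
    rw [hvB, hB, measureReal_ball c hρ]
    have := measureReal_unitBall_pos (d := d)
    positivity
  have hstep_g : ∀ p ∈ K, vB * ‖gv p - gv p₀‖ ^ 2 ≤ 16 * A * H ^ 2 * E := by
    intro p hp
    have h3 := integral_norm_sub_sq_le (hm2B p₀ hp₀) (hm2B p hp)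
    simp only [sub_sub_sub_cancel_left, setIntegral_const, smul_eq_mul] at h3
    linarith [hb2 p₀ hp₀ B hBint, hb2 p hp B hBint]
  have hstep_v : ∀ p ∈ K, vB * (a p - (a p₀ + inner ℝ (gv p₀) (p - p₀))) ^ 2 ≤
      160 * A * H ^ 4 * E := by
    intro p hp
    have h3 := integral_norm_sub_sq_le (hm1B p₀ hp₀) (hm1B p hp)
    simp only [sub_sub_sub_cancel_left] at h3
    have hint := integrable_norm_sq ((hm1B p₀ hp₀).sub (hm1B p hp))
    simp only [Pi.sub_apply, sub_sub_sub_cancel_left] at hint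
    have h4 : ∫ _ in B, (a p - (a p₀ + inner ℝ (gv p₀) (p - p₀))) ^ 2 ≤
        ∫ x in B, (2 * ‖a p + inner ℝ (gv p) (x - p) - (a p₀ + inner ℝ (gv p₀) (x - p₀))‖ ^ 2 +
          2 * H ^ 2 * ‖gv p - gv p₀‖ ^ 2) := by
      have hcst : ∀ k : ℝ, IntegrableOn (fun _ => k) B := fun k =>
        integrableOn_const measure_ball_lt_top.ne
      refine setIntegral_mono_on (hcst _) ((hint.const_mul 2).add (hcst _))
        Metric.isOpen_ball.measurableSet fun x hx => ?_
      set ℓ := a p + inner ℝ (gv p) (x - p) - (a p₀ + inner ℝ (gv p₀) (x - p₀)) with hℓ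
      have e : a p - (a p₀ + inner ℝ (gv p₀) (p - p₀)) = ℓ + inner ℝ (gv p - gv p₀) (p - x) := by
        rw [hℓ]
        simp only [inner_sub_left, inner_sub_right]
        ring
      have h5 : |inner ℝ (gv p - gv p₀) (p - x)| ≤ ‖gv p - gv p₀‖ * H :=
        (abs_real_inner_le_norm _ _).trans
          (mul_le_mul_of_nonneg_left (hdist p (mem_simplex hp) x (hc hx)) (norm_nonneg _))
      have h6 := sq_le_sq' (abs_le.1 h5).1 (abs_le.1 h5).2
      rw [e, Real.norm_eq_abs, sq_abs]
      nlinarith [sq_nonneg (ℓ - inner ℝ (gv p - gv p₀) (p - x))]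
    rw [setIntegral_const, smul_eq_mul, integral_add (hint.const_mul 2)
      (integrableOn_const measure_ball_lt_top.ne), integral_const_mul, setIntegral_const,
      smul_eq_mul] at h4
    have h7 := mul_le_mul_of_nonneg_left (hstep_g p hp) (by positivity : 0 ≤ 2 * H ^ 2)
    have h8 := hb1 p hp
    have h9 := hb1 p₀ hp₀
    have e2 : vB * (2 * H ^ 2 * ‖gv p - gv p₀‖ ^ 2) = 2 * H ^ 2 * (vB * ‖gv p - gv p₀‖ ^ 2) := by
      ring
    rw [e2] at h4
    linarith
  set γ := g₀ - gv p₀ with hγ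
  have hγm : κ * H * ‖γ‖ ≤ 2 * √(160 * A * H ^ 4 * E / vB) := by
    refine mul_norm_le_of_abs_affine_le hρ (c := c) (b := c₀ - (a p₀ - inner ℝ (gv p₀) p₀))
      fun x hx => ?_
    refine abs_affine_le_of_mem_convexHull (fun p hp => ?_) (hc hx)
    refine Real.abs_le_sqrt ?_
    rw [le_div_iff₀ hvB0]
    have h3 := hstep_v p hp
    have e : c₀ - (a p₀ - inner ℝ (gv p₀) p₀) + inner ℝ γ p =
        a p - (a p₀ + inner ℝ (gv p₀) (p - p₀)) := by
      rw [← hg₀ p hp, hγ, inner_sub_left, inner_sub_right]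
      ring
    rw [e, mul_comm]
    exact h3
  have hγ2 : κ ^ 2 * ‖γ‖ ^ 2 * vB ≤ 640 * A * H ^ 2 * E := by
    have h3 := pow_le_pow_left₀ (by positivity) hγm 2
    rw [mul_pow, mul_pow 2, Real.sq_sqrt (by positivity), ← mul_div_assoc, le_div_iff₀ hvB0] at h3
    have hH2 : 0 < H ^ 2 := by positivity
    refine le_of_mul_le_mul_left ?_ hH2
    calc H ^ 2 * (κ ^ 2 * ‖γ‖ ^ 2 * vB) = (κ * H) ^ 2 * ‖γ‖ ^ 2 * vB := by ring
      _ ≤ 2 ^ 2 * (160 * A * H ^ 4 * E) := h3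
      _ = _ := by ring
  have hvol : volume.real (simplex K) ≤ (2 / κ) ^ d * vB := by
    have h3 : volume.real (simplex K) ≤ volume.real (Metric.ball p₀ (2 * H)) :=
      measureReal_mono (hKball p₀ hp₀) measure_ball_lt_top.ne
    refine h3.trans_eq ?_
    rw [hvB, hB, measureReal_ball c hρ, measureReal_ball p₀ (by positivity : 0 < 2 * H),
      ← mul_assoc, ← mul_pow]
    congr 2
    field_simp
  have hint : volume.real (simplex K) * ‖γ‖ ^ 2 ≤
      640 * ((2 / κ) ^ d * (κ ^ 2)⁻¹) * A * H ^ 2 * E := by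
    calc volume.real (simplex K) * ‖γ‖ ^ 2 ≤ (2 / κ) ^ d * vB * ‖γ‖ ^ 2 := by gcongr
      _ = (2 / κ) ^ d * (κ ^ 2)⁻¹ * (κ ^ 2 * ‖γ‖ ^ 2 * vB) := by field_simp
      _ ≤ (2 / κ) ^ d * (κ ^ 2)⁻¹ * (640 * A * H ^ 2 * E) := by gcongr
      _ = _ := by ring
  have hmK : MemLp (fun x => G x - gv p₀) 2 (volume.restrict (simplex K)) := by
    rw [← restrict_interior_simplex]
    exact (hm2 p₀ hp₀).mono_measure (Measure.restrict_mono (hKω p₀ hp₀) le_rfl)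
  have h3 := integral_norm_sub_sq_le hmK
    (memLp_const_restrict (isCompact_simplex K).isBounded γ)
  have e : ∀ x, G x - gv p₀ - γ = G x - g₀ := fun x => by rw [hγ]; abel
  simp only [e, setIntegral_const, smul_eq_mul] at h3
  have h4 := hb2 p₀ hp₀ _ subset_rfl
  rw [restrict_interior_simplex] at h4
  refine h3.trans ?_
  rw [localInterpConst, ← hA]
  nlinarith

/-- The patches around the simplices have finite overlap. -/
lemma IsTriangulation.sum_patch_le (hT : IsTriangulation Ω T) {κ H : ℝ}
    (hκ : 0 < κ) (hH : 0 < H) (hKH : ∀ K ∈ T, diamK K ≤ H)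
    (hball : ∀ K ∈ T, ∃ c, Metric.ball c (κ * H) ⊆ simplex K) {p₀ : Finset (Vec d) → Vec d}
    (hp₀ : ∀ K ∈ T, p₀ K ∈ K) {F : Vec d → ℝ} (hF : Integrable F (volume.restrict Ω))
    (hF0 : ∀ x, 0 ≤ F x) :
    ∑ K ∈ T, ∫ x in Ω ∩ Metric.ball (p₀ K) (4 * H), F x ≤ (6 / κ) ^ d * ∫ x in Ω, F x := by
  classical
  have hm : ∀ K, MeasurableSet (Metric.ball (p₀ K) (4 * H)) := fun K =>
    Metric.isOpen_ball.measurableSet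
  have e : ∀ K, ∫ x in Ω ∩ Metric.ball (p₀ K) (4 * H), F x =
      ∫ x in Ω, (Metric.ball (p₀ K) (4 * H)).indicator F x := fun K =>
    (setIntegral_indicator (hm K)).symm
  simp only [e]
  rw [← integral_finsetSum _ fun K _ => hF.indicator (hm K), ← integral_const_mul]
  refine integral_mono (integrable_finsetSum _ fun K _ => hF.indicator (hm K)) (hF.const_mul _)
    fun x => ?_
  simp only [indicator_apply]
  rw [← Finset.sum_filter, Finset.sum_const, nsmul_eq_mul]
  refine mul_le_mul_of_nonneg_right ?_ (hF0 x)
  have h := hT.card_mul_pow_le (by positivity : 0 < κ * H) (by positivity : 0 < 6 * H) hball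
    (Finset.filter_subset (fun K => x ∈ Metric.ball (p₀ K) (4 * H)) T) (x := x) fun K hK y hy => by
      rw [Finset.mem_filter] at hK
      have h1 := hK.2
      rw [Metric.mem_ball, dist_comm, dist_eq_norm] at h1
      rw [Metric.mem_ball, dist_eq_norm]
      have h2 := (norm_sub_le_diamK hy (mem_simplex (hp₀ K hK.1))).trans (hKH K hK.1)
      have h3 := norm_add_le (y - p₀ K) (p₀ K - x)
      rw [sub_add_sub_cancel] at h3
      linarith
  rw [← le_div_iff₀ (by positivity), ← div_pow, mul_div_mul_right _ _ hH.ne'] at h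
  exact h

/-- The interpolation constant. -/
def interpConst (d : ℕ) (κ : ℝ) : ℝ := localInterpConst d κ * (6 / κ) ^ d

/-- Functions in `H² ∩ H_0^1` are approximated by finite element functions. -/
theorem IsTriangulation.exists_memXH_approx (hd : 0 < d) (hT : IsTriangulation Ω T)
    (hΩo : IsOpen Ω) (hΩb : Bornology.IsBounded Ω) (hΩc : Convex ℝ Ω) (hΩn : Ω.Nonempty)
    {κ : ℝ} (hκ : 0 < κ) (hball : ∀ K ∈ T, ∃ c, Metric.ball c (κ * meshSize T) ⊆ simplex K)
    {u : Vec d → ℝ} {G : Vec d → Vec d} {D : Fin d → Vec d → Vec d} (hu : MemH01 Ω u G)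
    (hu2 : MemH2 Ω u G D) : ∃ V GV gV, MemXH Ω T V GV gV ∧
      ∫ x in Ω, ‖G x - GV x‖ ^ 2 ≤ interpConst d κ * meshSize T ^ 2 * hessianSq D Ω := by
  set H := meshSize T with hHdef
  have happ : ∀ p, ∃ (a : ℝ) (g : Vec d), (p ∉ Ω → a = 0) ∧ ∀ K ∈ T, p ∈ K →
      (∫ x in Ω ∩ Metric.ball p (2 * H), ‖u x - (a + inner ℝ g (x - p))‖ ^ 2) ≤
        approxConst d (κ / 2) * (2 * H) ^ 4 * hessianSq D (Ω ∩ Metric.ball p (2 * H)) ∧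
      (∫ x in Ω ∩ Metric.ball p (2 * H), ‖G x - g‖ ^ 2) ≤
        approxConst d (κ / 2) * (2 * H) ^ 2 * hessianSq D (Ω ∩ Metric.ball p (2 * H)) := by
    intro p
    by_cases hp : ∃ K ∈ T, p ∈ K
    · obtain ⟨K, hK, hpK⟩ := hp
      have hH : 0 < H := hT.meshSize_pos hd hK
      obtain ⟨c, hc⟩ := hball K hK
      obtain ⟨a, g, h0, h1, h2⟩ := exists_affine_approx hΩo hΩc (half_pos hκ)
        (by positivity : 0 < 2 * H) (s := κ * H) (by linarith)
        (hT.vertex_mem_closure hK hpK) (c := c) (fun x hx =>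
          ⟨hT.interior_simplex_subset hΩo hΩc hΩn hK (interior_maximal hc Metric.isOpen_ball hx), by
            rw [Metric.mem_ball, dist_eq_norm]
            have := (norm_sub_le_diamK (hc hx) (mem_simplex hpK)).trans (diamK_le_meshSize hK)
            linarith⟩) hu hu2
      exact ⟨a, g, h0, fun _ _ _ => ⟨h1, h2⟩⟩
    · exact ⟨0, 0, fun _ => rfl, fun K hK hpK => absurd ⟨K, hK, hpK⟩ hp⟩
  choose a gv ha0 hagv using happ
  have hex : ∀ K : Finset (Vec d), ∃ (c : ℝ) (g : Vec d), K ∈ T → ∀ p ∈ K, c + inner ℝ g p = a p := by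
    intro K
    by_cases hK : K ∈ T
    · obtain ⟨c, g, h⟩ := hT.exists_interpolant hK a
      exact ⟨c, g, fun _ => h⟩
    · exact ⟨0, 0, fun h => absurd h hK⟩
  choose c g hcg using hex
  have hV := memXH_piecewiseAffine hT hΩo hΩb hΩc hΩn hcg ha0
  refine ⟨_, _, _, hV, ?_⟩
  rw [hT.setIntegral_eq hΩc (f := fun x => ‖G x - piecewiseConst T g x‖ ^ 2)
    (integrable_norm_sq (hu.1.2.1.sub hV.1.1.2.1))]
  have hp : ∀ K : Finset (Vec d), ∃ p, K ∈ T → p ∈ K := by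
    intro K
    by_cases hK : K ∈ T
    · obtain ⟨p, hp⟩ := Finset.card_pos.1 (show 0 < K.card by rw [hT.card_eq K hK]; omega)
      exact ⟨p, fun _ => hp⟩
    · exact ⟨0, fun h => absurd h hK⟩
  choose p₀ hp₀ using hp
  rcases T.eq_empty_or_nonempty with hTe | ⟨K₀, hK₀⟩
  · simp only [hTe, Finset.sum_empty]
    have := localInterpConst_nonneg (d := d) hκ
    have := hessianSq_nonneg D Ω
    unfold interpConst
    positivity
  have hH : 0 < H := hT.meshSize_pos hd hK₀
  have hloc : ∀ K ∈ T, ∫ x in simplex K, ‖G x - piecewiseConst T g x‖ ^ 2 ≤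
      localInterpConst d κ * H ^ 2 * hessianSq D (Ω ∩ Metric.ball (p₀ K) (4 * H)) := by
    intro K hK
    obtain ⟨c', hc'⟩ := hball K hK
    refine (le_of_eq ?_).trans (hT.local_interpolation hΩo hΩb hΩc hΩn hκ hH hK
      (diamK_le_meshSize hK) hc' hu2 (fun p hp => (hagv p K hK hp).1)
      (fun p hp => (hagv p K hK hp).2) (hp₀ K hK) (hcg K hK))
    refine integral_congr_ae ?_
    filter_upwards [hV.ae_eq hT hΩo hΩc hΩn hK] with x hx
    rw [hx]
  refine (Finset.sum_le_sum hloc).trans ?_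
  rw [← Finset.mul_sum]
  have hsum : ∑ K ∈ T, hessianSq D (Ω ∩ Metric.ball (p₀ K) (4 * H)) ≤
      (6 / κ) ^ d * hessianSq D Ω := by
    simp only [hessianSq]
    rw [Finset.sum_comm, Finset.mul_sum]
    exact Finset.sum_le_sum fun i _ => hT.sum_patch_le hκ hH
      (fun K hK => diamK_le_meshSize hK) hball hp₀ (integrable_norm_sq (hu2.2 i).2.1)
      fun x => by positivity
  have := localInterpConst_nonneg (d := d) hκ
  calc localInterpConst d κ * H ^ 2 * ∑ K ∈ T, hessianSq D (Ω ∩ Metric.ball (p₀ K) (4 * H))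
      ≤ localInterpConst d κ * H ^ 2 * ((6 / κ) ^ d * hessianSq D Ω) := by gcongr
    _ = _ := by rw [interpConst]; ring

/-! ### The error of the macroscopic solver -/

variable {Ω : Set (Vec d)} {T : Finset (Finset (Vec d))} {L : ℕ}
  {wt : Finset (Vec d) → Fin L → ℝ} {x : Finset (Vec d) → Fin L → Vec d}

lemma MemXH.sub {V Z : Vec d → ℝ} {GV GZ : Vec d → Vec d} {gV gZ : Finset (Vec d) → Vec d}
    (hV : MemXH Ω T V GV gV) (hZ : MemXH Ω T Z GZ gZ) :
    MemXH Ω T (fun y => V y - Z y) (fun y => GV y - GZ y) (fun K => gV K - gZ K) := by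
  refine ⟨hV.1.sub hZ.1, fun K hK => ?_⟩
  obtain ⟨c, hc⟩ := hV.2 K hK
  obtain ⟨c', hc'⟩ := hZ.2 K hK
  refine ⟨c - c', ?_⟩
  filter_upwards [hc, hc'] with y h1 h2
  rw [h1, h2, inner_sub_left]
  ring

lemma aH_sub_left (AH : Finset (Vec d) → Fin L → Mat d) (gV gW gZ : Finset (Vec d) → Vec d) :
    aH T wt AH (fun K => gV K - gW K) gZ = aH T wt AH gV gZ - aH T wt AH gW gZ := by
  simp only [aH, map_sub, inner_sub_right, mul_sub, Finset.sum_sub_distrib]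

lemma IsQuadrature.sum_weights (hq : IsQuadrature T wt x) (hT : IsTriangulation Ω T)
    {K : Finset (Vec d)} (hK : K ∈ T) : ∑ l, wt K l = 1 := by
  have h := hq.exact_linear K hK 1 0
  simp only [inner_zero_left, add_zero, mul_one, setIntegral_const, smul_eq_mul] at h
  exact mul_left_cancel₀ (hT.measureReal_pos hK).ne' (h.trans (mul_one _).symm)

lemma MemXH.integral_norm_sq (hT : IsTriangulation Ω T) (hΩo : IsOpen Ω) (hΩc : Convex ℝ Ω)
    (hΩn : Ω.Nonempty) {Z : Vec d → ℝ} {GZ : Vec d → Vec d} {gZ : Finset (Vec d) → Vec d}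
    (hZ : MemXH Ω T Z GZ gZ) :
    ∫ y in Ω, ‖GZ y‖ ^ 2 = ∑ K ∈ T, volume.real (simplex K) * ‖gZ K‖ ^ 2 := by
  rw [hT.setIntegral_eq hΩc (integrable_norm_sq hZ.1.1.2.1)]
  refine Finset.sum_congr rfl fun K hK => ?_
  rw [← smul_eq_mul, ← setIntegral_const]
  refine integral_congr_ae ?_
  filter_upwards [hZ.ae_eq hT hΩo hΩc hΩn hK] with y hy
  rw [hy]

lemma le_aH_self (hT : IsTriangulation Ω T) (hΩo : IsOpen Ω) (hΩc : Convex ℝ Ω)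
    (hΩn : Ω.Nonempty) (hq : IsQuadrature T wt x) {lam : ℝ} {AH : Finset (Vec d) → Fin L → Mat d}
    (hAH : ∀ K ∈ T, ∀ l, ∀ ξ : Vec d, lam * ‖ξ‖ ^ 2 ≤ inner ℝ ξ (AH K l ξ)) {Z : Vec d → ℝ}
    {GZ : Vec d → Vec d} {gZ : Finset (Vec d) → Vec d} (hZ : MemXH Ω T Z GZ gZ) :
    lam * ∫ y in Ω, ‖GZ y‖ ^ 2 ≤ aH T wt AH gZ gZ := by
  rw [hZ.integral_norm_sq hT hΩo hΩc hΩn, Finset.mul_sum, aH]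
  refine Finset.sum_le_sum fun K hK => ?_
  calc lam * (volume.real (simplex K) * ‖gZ K‖ ^ 2)
      = volume.real (simplex K) * ∑ l, wt K l * (lam * ‖gZ K‖ ^ 2) := by
        rw [← Finset.sum_mul, hq.sum_weights hT hK]
        ring
    _ ≤ _ := by
        refine mul_le_mul_of_nonneg_left (Finset.sum_le_sum fun l _ => ?_) measureReal_nonneg
        exact mul_le_mul_of_nonneg_left (hAH K hK l _) (hq.weight_nonneg K hK l)

/-- The consistency error of the quadrature on one simplex. -/
lemma IsTriangulation.consistency_error_le (hT : IsTriangulation Ω T) (hΩc : Convex ℝ Ω)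
    (hq : IsQuadrature T wt x) {M : NNReal} {e : ℝ} {Abar : Vec d → Mat d}
    (hAm : MemLp Abar ⊤ (volume.restrict Ω)) (hAb : ∀ y ∈ closure Ω, ‖Abar y‖ ≤ M)
    (hAl : LipschitzOnWith M Abar (closure Ω)) {AH : Finset (Vec d) → Fin L → Mat d}
    (he : ∀ K ∈ T, ∀ l, ‖Abar (x K l) - AH K l‖ ≤ e) {Gu : Vec d → Vec d}
    (hGu : MemLp Gu 2 (volume.restrict Ω)) {K : Finset (Vec d)} (hK : K ∈ T) (v z : Vec d) :
    (∫ y in simplex K, inner ℝ (Abar y (Gu y)) z) -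
        volume.real (simplex K) * ∑ l, wt K l * inner ℝ z (AH K l v) ≤
      ∫ y in simplex K, (M * (‖Gu y - v‖ * ‖z‖) + (M * meshSize T + e) * (‖v‖ * ‖z‖)) := by
  have hle := hT.restrict_le hΩc hK
  have hb := (isCompact_simplex K).isBounded
  have hGK := hGu.mono_measure hle
  have hi1 : Integrable (fun y => inner ℝ (Abar y (Gu y)) z) (volume.restrict (simplex K)) :=
    integrable_inner_of_memLp (memLp_clm_apply (hAm.mono_measure hle) hGK)
      (memLp_const_restrict hb z)
  have hcst : ∀ k : ℝ, Integrable (fun _ : Vec d => k) (volume.restrict (simplex K)) := fun k =>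
    integrableOn_const (measure_simplex_ne_top K)
  have hi2 : Integrable (fun y => M * (‖Gu y - v‖ * ‖z‖) + (M * meshSize T + e) * (‖v‖ * ‖z‖))
      (volume.restrict (simplex K)) :=
    ((integrable_norm_mul_norm (hGK.sub (memLp_const_restrict hb v))
      (memLp_const_restrict hb z)).const_mul _).add (hcst _)
  have hl : ∀ l, (∫ y in simplex K, inner ℝ (Abar y (Gu y)) z) -
        volume.real (simplex K) * inner ℝ z (AH K l v) ≤
      ∫ y in simplex K, (M * (‖Gu y - v‖ * ‖z‖) + (M * meshSize T + e) * (‖v‖ * ‖z‖)) := by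
    intro l
    rw [← smul_eq_mul, ← setIntegral_const, ← integral_sub hi1 (hcst _)]
    refine setIntegral_mono_on (hi1.sub (hcst _)) hi2 (measurableSet_simplex K) fun y hy => ?_
    have hyΩ := hT.simplex_subset hK hy
    have hxΩ := hT.simplex_subset hK (hq.node_mem K hK l)
    have h1 : ‖Abar y - Abar (x K l)‖ ≤ M * meshSize T := by
      rw [← dist_eq_norm]
      refine (hAl.dist_le_mul y hyΩ _ hxΩ).trans ?_
      rw [dist_eq_norm]
      have := (norm_sub_le_diamK hy (hq.node_mem K hK l)).trans (diamK_le_meshSize hK)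
      gcongr
    have h2 : Abar y (Gu y) - AH K l v = Abar y (Gu y - v) + (Abar y - Abar (x K l)) v +
        (Abar (x K l) - AH K l) v := by
      simp only [map_sub, sub_apply]
      abel
    have h3 : ‖Abar y (Gu y) - AH K l v‖ ≤ M * ‖Gu y - v‖ + (M * meshSize T + e) * ‖v‖ := by
      rw [h2]
      refine (norm_add₃_le).trans ?_
      have a1 := (Abar y).le_of_opNorm_le (hAb y hyΩ) (Gu y - v)
      have a2 := (Abar y - Abar (x K l)).le_of_opNorm_le h1 v
      have a3 := (Abar (x K l) - AH K l).le_of_opNorm_le (he K hK l) v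
      linarith
    rw [real_inner_comm (AH K l v) z, ← inner_sub_left]
    refine (real_inner_le_norm _ _).trans ((mul_le_mul_of_nonneg_right h3 (norm_nonneg _)).trans ?_)
    apply le_of_eq
    ring
  set P := ∫ y in simplex K, inner ℝ (Abar y (Gu y)) z
  set Q := ∫ y in simplex K, (M * (‖Gu y - v‖ * ‖z‖) + (M * meshSize T + e) * (‖v‖ * ‖z‖))
  have hw := hq.sum_weights hT hK
  calc P - volume.real (simplex K) * ∑ l, wt K l * inner ℝ z (AH K l v)
      = ∑ l, wt K l * (P - volume.real (simplex K) * inner ℝ z (AH K l v)) := by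
        simp only [mul_sub, Finset.sum_sub_distrib, ← Finset.sum_mul, hw, one_mul, Finset.mul_sum]
        congr 1
        exact Finset.sum_congr rfl fun l _ => by ring
    _ ≤ ∑ l, wt K l * Q :=
        Finset.sum_le_sum fun l _ => mul_le_mul_of_nonneg_left (hl l) (hq.weight_nonneg K hK l)
    _ = Q := by rw [← Finset.sum_mul, hw, one_mul]

/-- The Strang lemma: the distance of the HMM solution from a finite element function. -/
theorem IsMacroSolution.norm_gradient_sub_le (hT : IsTriangulation Ω T) (hΩo : IsOpen Ω)
    (hΩc : Convex ℝ Ω) (hΩn : Ω.Nonempty) (hq : IsQuadrature T wt x) {lam : ℝ} {M : NNReal} {e : ℝ}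
    {Abar : Vec d → Mat d} (hAm : MemLp Abar ⊤ (volume.restrict Ω))
    (hAb : ∀ y ∈ closure Ω, ‖Abar y‖ ≤ M) (hAl : LipschitzOnWith M Abar (closure Ω))
    {AH : Finset (Vec d) → Fin L → Mat d}
    (hAH : ∀ K ∈ T, ∀ l, ∀ ξ : Vec d, lam * ‖ξ‖ ^ 2 ≤ inner ℝ ξ (AH K l ξ))
    (he : ∀ K ∈ T, ∀ l, ‖Abar (x K l) - AH K l‖ ≤ e) (he0 : 0 ≤ e) {f u uH V : Vec d → ℝ}
    {Gu GH GV : Vec d → Vec d} {gH gV : Finset (Vec d) → Vec d}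
    (hu : IsEllipticSolution Ω Abar f u Gu) (huH : IsMacroSolution Ω T wt AH f uH GH gH)
    (hV : MemXH Ω T V GV gV) :
    lam * normL2 Ω (fun y => GH y - GV y) ≤
      M * normL2 Ω (fun y => Gu y - GV y) + (M * meshSize T + e) * normL2 Ω GV := by
  have hZ := huH.1.sub hV
  set GZ : Vec d → Vec d := fun y => GH y - GV y with hGZ
  set gZ : Finset (Vec d) → Vec d := fun K => gH K - gV K with hgZ
  have hGum := hu.1.1.2.1
  have hGVm := hV.1.1.2.1
  have hGZm := hZ.1.1.2.1
  have h1 : lam * ∫ y in Ω, ‖GZ y‖ ^ 2 ≤ aH T wt AH gZ gZ :=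
    le_aH_self hT hΩo hΩc hΩn hq hAH hZ
  have h2 : aH T wt AH gZ gZ = (∫ y in Ω, inner ℝ (Abar y (Gu y)) (GZ y)) - aH T wt AH gV gZ := by
    rw [hgZ, aH_sub_left, huH.2 _ _ _ hZ, hu.2 _ _ hZ.1]
  have hi1 : Integrable (fun y => ‖Gu y - GV y‖ * ‖GZ y‖) (volume.restrict Ω) :=
    integrable_norm_mul_norm (hGum.sub hGVm) hGZm
  have hi2 : Integrable (fun y => ‖GV y‖ * ‖GZ y‖) (volume.restrict Ω) :=
    integrable_norm_mul_norm hGVm hGZm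
  have h3 : (∫ y in Ω, inner ℝ (Abar y (Gu y)) (GZ y)) - aH T wt AH gV gZ ≤
      ∫ y in Ω, (M * (‖Gu y - GV y‖ * ‖GZ y‖) + (M * meshSize T + e) * (‖GV y‖ * ‖GZ y‖)) := by
    rw [hT.setIntegral_eq hΩc (integrable_inner_of_memLp (memLp_clm_apply hAm hGum) hGZm),
      hT.setIntegral_eq hΩc (f := fun y => M * (‖Gu y - GV y‖ * ‖GZ y‖) +
        (M * meshSize T + e) * (‖GV y‖ * ‖GZ y‖)) ((hi1.const_mul _).add (hi2.const_mul _)),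
      aH, ← Finset.sum_sub_distrib]
    refine Finset.sum_le_sum fun K hK => ?_
    have hZK := hZ.ae_eq hT hΩo hΩc hΩn hK
    have hVK := hV.ae_eq hT hΩo hΩc hΩn hK
    have e1 : ∫ y in simplex K, inner ℝ (Abar y (Gu y)) (GZ y) =
        ∫ y in simplex K, inner ℝ (Abar y (Gu y)) (gZ K) := by
      refine integral_congr_ae ?_
      filter_upwards [hZK] with y hy
      rw [hy]
    have e2 : ∫ y in simplex K, (M * (‖Gu y - GV y‖ * ‖GZ y‖) +
          (M * meshSize T + e) * (‖GV y‖ * ‖GZ y‖)) =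
        ∫ y in simplex K, (M * (‖Gu y - gV K‖ * ‖gZ K‖) +
          (M * meshSize T + e) * (‖gV K‖ * ‖gZ K‖)) := by
      refine integral_congr_ae ?_
      filter_upwards [hZK, hVK] with y hy1 hy2
      rw [hy1, hy2]
    refine (le_of_eq ?_).trans ((hT.consistency_error_le hΩc hq hAm hAb hAl he hGum hK (gV K)
      (gZ K)).trans_eq e2.symm)
    rw [← e1]
  rw [integral_add (hi1.const_mul _) (hi2.const_mul _), integral_const_mul, integral_const_mul] at h3
  have h4 : ∫ y in Ω, ‖Gu y - GV y‖ * ‖GZ y‖ ≤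
      normL2 Ω (fun y => Gu y - GV y) * normL2 Ω GZ :=
    integral_norm_mul_norm_le (hGum.sub hGVm) hGZm
  have h5 : ∫ y in Ω, ‖GV y‖ * ‖GZ y‖ ≤ normL2 Ω GV * normL2 Ω GZ :=
    integral_norm_mul_norm_le hGVm hGZm
  have hN0 : 0 ≤ normL2 Ω GZ := Real.sqrt_nonneg _
  have h6 : ∫ y in Ω, ‖GZ y‖ ^ 2 = normL2 Ω GZ ^ 2 :=
    (Real.sq_sqrt (integral_norm_sq_nonneg _)).symm
  have hc : 0 ≤ M * meshSize T + e := add_nonneg (mul_nonneg M.2 meshSize_nonneg) he0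
  have h7 := mul_le_mul_of_nonneg_left h4 M.2
  have h8 := mul_le_mul_of_nonneg_left h5 hc
  rw [h6] at h1
  have h9 : lam * normL2 Ω GZ * normL2 Ω GZ ≤ (M * normL2 Ω (fun y => Gu y - GV y) +
      (M * meshSize T + e) * normL2 Ω GV) * normL2 Ω GZ := by
    have h10 : (M : ℝ) * ∫ y in Ω, ‖Gu y - GV y‖ * ‖GZ y‖ ≤
      M * (normL2 Ω (fun y => Gu y - GV y) * normL2 Ω GZ) := h7
    linarith
  rcases hN0.eq_or_lt with h0 | h0
  · rw [← h0, mul_zero]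
    have a1 : 0 ≤ normL2 Ω (fun y => Gu y - GV y) := Real.sqrt_nonneg _
    have a2 : 0 ≤ normL2 Ω GV := Real.sqrt_nonneg _
    exact add_nonneg (mul_nonneg M.2 a1) (mul_nonneg hc a2)
  · exact le_of_mul_le_mul_right h9 h0

lemma normL2_le_normH2 {u : Vec d → ℝ} {G : Vec d → Vec d} {D : Fin d → Vec d → Vec d} :
    normL2 Ω G ≤ normH2 Ω u G D ∧ √(hessianSq D Ω) ≤ normH2 Ω u G D := by
  have h1 : 0 ≤ ∫ y in Ω, (u y) ^ 2 := integral_nonneg fun y => sq_nonneg _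
  have h2 := integral_norm_sq_nonneg (μ := volume.restrict Ω) G
  have h3 := hessianSq_nonneg D Ω
  unfold hessianSq at *
  constructor <;> · unfold normH2; refine Real.sqrt_le_sqrt ?_; linarith

lemma normL2_le_normL2_add {F G : Vec d → Vec d} (hF : MemLp F 2 (volume.restrict Ω))
    (hG : MemLp G 2 (volume.restrict Ω)) :
    normL2 Ω F ≤ normL2 Ω G + normL2 Ω (fun y => F y - G y) := by
  have h := sqrt_integral_norm_add_sq_le hG (hF.sub hG)
  simpa [normL2] using h

lemma normL2_sub_comm (F G : Vec d → Vec d) :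
    normL2 Ω (fun y => F y - G y) = normL2 Ω (fun y => G y - F y) := by
  simp only [normL2, norm_sub_rev]

lemma eHMM_nonneg (x : Finset (Vec d) → Fin L → Vec d) (Abar : Vec d → Mat d)
    (AH : Finset (Vec d) → Fin L → Mat d) : 0 ≤ eHMM T x Abar AH := by
  refine Real.sSup_nonneg ?_
  rintro _ ⟨K, -, l, rfl⟩
  exact norm_nonneg _

lemma le_eHMM {x : Finset (Vec d) → Fin L → Vec d} {Abar : Vec d → Mat d}
    {AH : Finset (Vec d) → Fin L → Mat d} {b : ℝ}
    (hb : ∀ K ∈ T, ∀ l, ‖Abar (x K l) - AH K l‖ ≤ b) {K : Finset (Vec d)} (hK : K ∈ T) (l : Fin L) :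
    ‖Abar (x K l) - AH K l‖ ≤ eHMM T x Abar AH :=
  le_csSup ⟨b, by rintro _ ⟨K, hK, l, rfl⟩; exact hb K hK l⟩ ⟨K, hK, l, rfl⟩

lemma IsTriangulation.meshSize_le (hT : IsTriangulation Ω T) {R : ℝ} (hR : 0 ≤ R)
    (hΩ : ∀ y ∈ Ω, ‖y‖ ≤ R) : meshSize T ≤ 2 * R := by
  refine Real.sSup_le ?_ (by positivity)
  rintro _ ⟨K, hK, rfl⟩
  refine Metric.diam_le_of_forall_dist_le (by positivity) fun y hy z hz => ?_
  have hcl : ∀ y ∈ closure Ω, ‖y‖ ≤ R := fun y hy =>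
    closure_minimal hΩ (isClosed_le continuous_norm continuous_const) hy
  have h1 := hcl y (hT.simplex_subset hK hy)
  have h2 := hcl z (hT.simplex_subset hK hz)
  rw [dist_eq_norm]
  linarith [norm_sub_le y z]

end HMM

end

theorem lemma2 {d : ℕ} (hd : 0 < d) (Ω : Set (HMM.Vec d))
    (hΩo : IsOpen Ω) (hΩb : Bornology.IsBounded Ω) (hΩc : Convex ℝ Ω) (hΩn : Ω.Nonempty)
    -- the bounds on the coefficients, on the effective matrix, and on the regularity of the mesh
    (lam Lam : ℝ) (hlam : 0 < lam) (hLam : 0 < Lam) (M : NNReal) (σ τ : ℝ) :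
    ∃ C : ℝ, 0 ≤ C ∧
      -- the family of singularly perturbed problems
      ∀ (S : Set ℝ) (ι : ℝ → ℝ) (A : ℝ → HMM.Vec d → HMM.Mat d),
      S ⊆ Ioi 0 → 0 ∈ closure S → (∀ ε ∈ S, 0 < ι ε) → Tendsto ι (𝓝[S] 0) (𝓝 0) →
      (∀ ε ∈ S, A ε ∈ HMM.CoeffClass lam Lam Ω) →
      -- its effective matrix, bounded and Lipschitz continuous
      ∀ Abar : HMM.Vec d → HMM.Mat d, HMM.IsEffectiveMatrix Ω S ι A Abar →
      (∀ x ∈ closure Ω, ‖Abar x‖ ≤ M) → LipschitzOnWith M Abar (closure Ω) →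
      -- the homogenized solution
      ∀ (f : HMM.Vec d → ℝ), MemLp f 2 (volume.restrict Ω) →
      ∀ (u : HMM.Vec d → ℝ) (Gu : HMM.Vec d → HMM.Vec d)
        (Du : Fin d → HMM.Vec d → HMM.Vec d),
      HMM.IsEllipticSolution Ω Abar f u Gu → HMM.MemH2 Ω u Gu Du →
      -- the macroscopic mesh and the quadrature
      ∀ T : Finset (Finset (HMM.Vec d)), HMM.IsTriangulation Ω T →
      HMM.ShapeRegular σ T → HMM.InverseAssumption τ T →
      ∀ (L : ℕ) (wt : Finset (HMM.Vec d) → Fin L → ℝ)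
        (x : Finset (HMM.Vec d) → Fin L → HMM.Vec d), HMM.IsQuadrature T wt x →
      -- the cell problems and the numerical effective matrix
      ∀ ε ∈ S, ∀ δ : ℝ, 0 < δ →
      (∀ K ∈ T, ∀ l, A ε ∈ HMM.CoeffClass lam Lam (HMM.cell (x K l) δ)) →
      ∀ (bc : HMM.CellBC) (Xh : Finset (HMM.Vec d) → Fin L → Submodule ℝ (HMM.Vec d → ℝ)),
      (∀ K ∈ T, ∀ l, HMM.IsCellSpace (x K l) δ (Xh K l)) →
      ∀ AH : Finset (HMM.Vec d) → Fin L → HMM.Mat d,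
      (∀ K ∈ T, ∀ l, HMM.IsCellMatrix (x K l) δ (ι ε) (A ε) (Xh K l) bc (AH K l)) →
      ∀ (uH : HMM.Vec d → ℝ) (GH : HMM.Vec d → HMM.Vec d) (gH : Finset (HMM.Vec d) → HMM.Vec d),
      HMM.IsMacroSolution Ω T wt AH f uH GH gH →
      HMM.normL2 Ω (fun y => Gu y - GH y)
        ≤ C * (HMM.meshSize T * HMM.normH2 Ω u Gu Du
          + HMM.eHMM T x Abar AH * HMM.normHneg1 Ω f) := by
  obtain ⟨R₀, hR₀⟩ := hΩb.exists_norm_le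
  set R := max R₀ 0 with hRdef
  have hR : 0 ≤ R := le_max_right _ _
  have hΩR : ∀ y ∈ Ω, ‖y‖ ≤ R := fun y hy => (hR₀ y hy).trans (le_max_left _ _)
  set CI : ℝ := √(HMM.interpConst d (4 * σ * τ)⁻¹) with hCI
  have hCI0 : 0 ≤ CI := Real.sqrt_nonneg _
  set CP : ℝ := √(4 * R ^ 2 + 1) / lam with hCP
  have hCP0 : 0 ≤ CP := by positivity
  have hM0 : (0 : ℝ) ≤ M := M.2
  set C₁ : ℝ := CI + (M * CI + M * (1 + 2 * R * CI) + (M + Lam) * CI) / lam with hC₁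
  have hC₁0 : 0 ≤ C₁ := by positivity
  have hC₂0 : 0 ≤ CP / lam := by positivity
  refine ⟨C₁ + CP / lam, by positivity, ?_⟩
  intro S ι A _ hS _ _ hA Abar hAbar hAb hAl f hf u Gu Du hu hu2 T hT hσ hτ L wt x hq ε _ δ hδ
    hAcell bc Xh hXh AH hAH uH GH gH huH
  obtain ⟨K₀, hK₀⟩ : T.Nonempty := by
    rw [Finset.nonempty_iff_ne_empty]
    rintro rfl
    have h := hT.cover
    simp only [Finset.notMem_empty, iUnion_of_empty, iUnion_empty] at h
    exact (h ▸ hΩn.closure).ne_empty rfl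
  have hpos := hT.exists_ball_subset hd hσ hτ hK₀
  have hκ : 0 < (4 * σ * τ)⁻¹ := by
    have h1 := hpos.1
    have h2 := hpos.2.1
    positivity
  obtain ⟨V, GV, gV, hV, hVu⟩ := hT.exists_memXH_approx hd hΩo hΩb hΩc hΩn hκ
    (fun K hK => (hT.exists_ball_subset hd hσ hτ hK).2.2) hu.1 hu2
  set H := HMM.meshSize T with hH
  set e := HMM.eHMM T x Abar AH with he
  set U := HMM.normH2 Ω u Gu Du with hU
  set F := HMM.normHneg1 Ω f with hF
  have hH0 : 0 ≤ H := HMM.meshSize_nonneg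
  have he0 : 0 ≤ e := HMM.eHMM_nonneg x Abar AH
  have hU0 : 0 ≤ U := Real.sqrt_nonneg _
  have hF0 : 0 ≤ F := HMM.normHneg1_nonneg hf
  have hbounds : ∀ K ∈ T, ∀ l, ∀ ξ : HMM.Vec d,
      lam * ‖ξ‖ ^ 2 ≤ inner ℝ ξ (AH K l ξ) ∧ ‖AH K l ξ‖ ≤ Lam * ‖ξ‖ := fun K hK l ξ =>
    HMM.IsCellMatrix.bounds hδ hlam hLam (hAcell K hK l) (hXh K hK l) (hAH K hK l) ξ
  have hdiff : ∀ K ∈ T, ∀ l, ‖Abar (x K l) - AH K l‖ ≤ M + Lam := fun K hK l =>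
    (norm_sub_le _ _).trans (add_le_add (hAb _ (hT.simplex_subset hK (hq.node_mem K hK l)))
      (ContinuousLinearMap.opNorm_le_bound _ hLam.le fun ξ => (hbounds K hK l ξ).2))
  have heb : e ≤ M + Lam := by
    refine Real.sSup_le ?_ (by positivity)
    rintro _ ⟨K, hK, l, rfl⟩
    exact hdiff K hK l
  set N₁ := HMM.normL2 Ω (fun y => Gu y - GV y) with hN₁
  set N₂ := HMM.normL2 Ω GV with hN₂
  set N₃ := HMM.normL2 Ω (fun y => GH y - GV y) with hN₃
  have hstrang : lam * N₃ ≤ M * N₁ + (M * H + e) * N₂ :=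
    huH.norm_gradient_sub_le hT hΩo hΩc hΩn hq hAbar.1 hAb hAl
      (fun K hK l ξ => (hbounds K hK l ξ).1) (fun K hK l => HMM.le_eHMM hdiff hK l) he0 hu hV
  have hGu := hu.1.1.2.1
  have hGV := hV.1.1.2.1
  have hGH := huH.1.1.1.2.1
  have hN₁U : N₁ ≤ CI * H * U := by
    have h1 := Real.sqrt_le_sqrt hVu
    have h2 := HMM.localInterpConst_nonneg (d := d) hκ
    have h3 : 0 ≤ HMM.interpConst d (4 * σ * τ)⁻¹ := by
      unfold HMM.interpConst
      positivity
    rw [Real.sqrt_mul (by positivity), Real.sqrt_mul h3, Real.sqrt_sq hH0] at h1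
    refine h1.trans ?_
    have h4 : √(HMM.hessianSq Du Ω) ≤ U := HMM.normL2_le_normH2.2
    gcongr
  have hGuU : HMM.normL2 Ω Gu ≤ U := HMM.normL2_le_normH2.1
  have hGuF : HMM.normL2 Ω Gu ≤ CP * F := hAbar.norm_gradient_le hd hΩR hlam hS hA hf hu
  have hN₂' : N₂ ≤ HMM.normL2 Ω Gu + N₁ := by
    have h := HMM.normL2_le_normL2_add hGV hGu
    rwa [HMM.normL2_sub_comm GV Gu] at h
  have hHR : H ≤ 2 * R := hT.meshSize_le hR hΩR
  have htri : HMM.normL2 Ω (fun y => Gu y - GH y) ≤ N₁ + N₃ := by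
    have h := HMM.normL2_le_normL2_add (hGu.sub hGH) (hGu.sub hGV)
    have e1 : ∀ y, Gu y - GH y - (Gu y - GV y) = -(GH y - GV y) := fun y => by abel
    simpa only [hN₁, hN₃, HMM.normL2, Pi.sub_apply, e1, norm_neg] using h
  have hb : lam * N₃ ≤
      (M * CI + M * (1 + 2 * R * CI) + (M + Lam) * CI) * (H * U) + CP * (e * F) := by
    have h1 : M * N₁ ≤ M * (CI * H * U) := by gcongr
    have h2 : M * H * N₂ ≤ M * H * (U + CI * (2 * R) * U) := by
      have : N₂ ≤ U + CI * (2 * R) * U := by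
        have : CI * H * U ≤ CI * (2 * R) * U := by gcongr
        linarith
      gcongr
    have h3 : e * N₂ ≤ e * (CP * F) + (M + Lam) * (CI * H * U) := by
      have h4 : e * N₂ ≤ e * (CP * F + CI * H * U) := by
        gcongr
        linarith
      have h5 : e * (CI * H * U) ≤ (M + Lam) * (CI * H * U) := by gcongr
      linarith
    linarith
  have hN₃ : N₃ ≤ (M * CI + M * (1 + 2 * R * CI) + (M + Lam) * CI) / lam * (H * U) +
      CP / lam * (e * F) := by
    refine le_of_mul_le_mul_left (hb.trans_eq ?_) hlam
    field_simp
  have hHU : 0 ≤ H * U := mul_nonneg hH0 hU0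
  have heF : 0 ≤ e * F := mul_nonneg he0 hF0
  calc HMM.normL2 Ω (fun y => Gu y - GH y) ≤ N₁ + N₃ := htri
    _ ≤ C₁ * (H * U) + CP / lam * (e * F) := by
      rw [hC₁]
      linarith
    _ ≤ C₁ * (H * U) + CP / lam * (e * F) + (C₁ * (e * F) + CP / lam * (H * U)) :=
      le_add_of_nonneg_right (by positivity)
    _ = (C₁ + CP / lam) * (H * U + e * F) := by ring
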